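/- **Setting.** Let $k$ be a field of characteristic $0$, $Q$ a finite quiver with vertex set $Q_0$ and arrow set $Q_1$, $B=kQ$ its path algebra (paths composed from right to left), and $R\subset B$ the subalgebra spanned by the trivial paths. For an algebra $C$ over a subalgebra $R'$, $\Omega_{R'}C=T_C(\Omega^1_{R'}C)$ is the algebra of noncommutative differential forms, with differential $d$. If $C$ is graded (by weight $|\cdot|$), $\Omega_{R'}C$ is bigraded by weight and form degree $\|\cdot\|$, and $\mathrm{DR}\,C=\Omega_{R'}C/[\Omega_{R'}C,\Omega_{R'}C]$ is the Karoubi–de Rham complex, where $[-,-]$ is the linear span of the commutators $\alpha\beta-(-1)^{|\alpha||\beta|+\|\alpha\|\|\beta\|}\beta\alpha$; $[\alpha]$ is the class of $\alpha$ and $d_{\mathrm{DR}}[\alpha]=[d\alpha]$. The algebra $B$ has weight $0$. Let $A$ be the graded path algebra of the quiver with vertex set $Q_0$ and, for each $a\in Q_1$, arrows $a$ (weight $0$) and $\widehat a$ (weight $1$) parallel to $a$, and arrows $a^*$ (weight $2$) and $\widehat a^{\,*}$ (weight $1$) in the opposite direction. Thus $B=A^0$ and $A^1$ is a $B$-bimodule.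 Let $\omega=\big[\sum_{a\in Q_1}(da\,da^*+d\widehat a\,d\widehat a^{\,*})\big]\in \mathrm{DR}^2A$. For a graded double derivation $\Theta\colon A\to A\otimes A$ (a derivation for the outer bimodule structure, vanishing on the trivial paths) let $\iota_\Theta\colon\mathrm{DR}\,A\to\Omega A$ be the reduced contraction, that is, the contraction $i_\Theta\colon\Omega A\to\Omega A\otimes\Omega A$ followed by $\alpha\otimes\beta\mapsto(-1)^{|\alpha||\beta|+\|\alpha\|\|\beta\|}\beta\alpha$. For $x\in A$ homogeneous, let $H_x$ be its Hamiltonian double derivation, $\iota_{H_x}\omega=dx$, of weight $|x|-2$; put $⦃x,y⦄_\omega=H_x(y)$, extended linearly, and $\{x,y\}_\omega=m(⦃x,y⦄_\omega)$, with $m$ the multiplication of $A$. Let $\lambda\colon\Omega_RB\to A$ be the algebra morphism with $\lambda(b)=b$ for $b\in B$ and $\lambda(da)=\widehat a$ for $a\in Q_1$, and let $S_0=\sum_{a\in Q_1}a^*\widehat a$. **Lemma.** Let $\varphi\in\Omega^3_RB$ and $S_\varphi=S_0+\lambda(\varphi)$. Then: 1. Every element $x\in A$ of weight $w$ has a unique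 Hamiltonian double derivation of weight $w-2$ (so $⦃-,-⦄_\omega$ is well defined), and $S_\varphi\in A^3$. 2. The class of $\{S_\varphi,S_\varphi\}_\omega$ in $\mathrm{DR}^0A=A/[A,A]$ (graded commutators) vanishes if and only if $d_{\mathrm{DR}}[\varphi]=0$ in $\mathrm{DR}^4B$; moreover $d_{\mathrm{DR}}[\varphi]=0$ in $\mathrm{DR}^4B$ if and only if the image of $\varphi$ under $\Omega_RB\to\Omega A$ satisfies $d_{\mathrm{DR}}[\varphi]=0$ in $\mathrm{DR}^4A$. 3. If $d_{\mathrm{DR}}[\varphi]=0$, then the $B$-bimodule $E=A^1$ with $$\langle e,e'\rangle=⦃e,e'⦄_\omega,\qquad \rho(e)(b)=⦃\{S_\varphi,e\}_\omega,b⦄_\omega,\qquad ⟦e,e'⟧=⦃\{S_\varphi,e\}_\omega,e'⦄_\omega$$ is a double Courant algebroid over $B$ (a twisted deformation of the standard one, which is the case $\varphi=0$). Here a *double Courant algebroid* over an $R$-algebra $B$ is a finitely generated projective $B$-bimodule $E$ with a symmetric non-degenerate pairing $\langle-,-\rangle\colon E\otimes E\to B\otimes B$ (a bimodule map for the outer structure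 in the second argument and the inner one in the first; symmetric: $\langle e,e'\rangle=\langle e',e\rangle^\sigma$; non-degenerate: every bimodule map $E\to B\otimes B$ for the outer structure is $\langle e,-\rangle$ for a unique $e$), a $B$-bimodule map $\rho\colon E\to\mathbb{D}\mathrm{er}_RB$ (inner structure on double derivations), and a bracket $⟦-,-⟧\colon E\otimes E\to E\otimes B\oplus B\otimes E$, $R$-linear for the outer structure in the second argument and the inner one in the first, such that, with $\mathcal D b\in E$ defined by $\langle e,\mathcal D b\rangle=\rho(e)(b)$, * $⟦e_1,be_2⟧=\rho(e_1)(b)e_2+b⟦e_1,e_2⟧$ and $⟦e_1,e_2b⟧=e_2\rho(e_1)(b)+⟦e_1,e_2⟧b$; * $\mathcal D\langle e,e\rangle=⟦e,e⟧+⟦e,e⟧^\sigma$, where $\mathcal D(b'\otimes b'')=\mathcal Db'\otimes b''+b'\otimes\mathcal Db''$ and $\sigma$ is the flip; * $(\rho(e_1)\otimes\mathrm{id})\langle e_2,e_2\rangle=\langle⟦e_1,e_2⟧^l,e_2\rangle_L+\langle e_2,⟦e_1,e_2⟧^r\rangle_R$, where $^l$ and $^r$ are the components in $E\otimes B$ and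 $B\otimes E$, $\langle e\otimes b,e'\rangle_L=\langle e,e'\rangle\otimes_1b$ and $\langle e',b\otimes e\rangle_R=b\otimes\langle e',e\rangle$; * $⟦e_1,⟦e_2,e_3⟧⟧_L=⟦e_2,⟦e_1,e_3⟧⟧_R+⟦⟦e_1,e_2⟧,e_3⟧_L$, where $(y\otimes z)\otimes_1w=y\otimes w\otimes z$, $⟦e,x\otimes y⟧_L=⟦e,x⟧\otimes y$, $⟦e,x\otimes y⟧_R=x\otimes⟦e,y⟧$, $⟦e,b⟧=\rho(e)(b)$, $⟦e\otimes b,e'⟧_L=⟦e,e'⟧\otimes_1b+\langle e,e'\rangle\otimes_1\mathcal Db$ and $⟦b\otimes e,e'⟧_L=-\langle\mathcal Db,e'\rangle\otimes_1e$. -/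

import Mathlib

open scoped TensorProduct DirectSum
set_option linter.unusedSectionVars false

/-! ### Gradings by words in homogeneous generators -/

section WordGrading

variable {k ι X A : Type*} [CommRing k] [AddCommMonoid ι] [Ring A] [Algebra k A]

/-- The span of all products of generators `gen x` of total degree `i`, where `gen x` has
degree `deg x`. -/
def wordGrading (k : Type*) {ι X A : Type*} [CommRing k] [AddCommMonoid ι] [Ring A] [Algebra k A]
    (gen : X → A) (deg : X → ι) (i : ι) : Submodule k A :=
  Submodule.span k {a | ∃ l : List X, (l.map deg).sum = i ∧ (l.map gen).prod = a}

theorem gen_mem_wordGrading (gen : X → A) (deg : X → ι) (x : X) :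
    gen x ∈ wordGrading k gen deg (deg x) :=
  Submodule.subset_span ⟨[x], by simp, by simp⟩

instance wordGrading.gradedMonoid (gen : X → A) (deg : X → ι) :
    SetLike.GradedMonoid (wordGrading k gen deg) where
  one_mem := Submodule.subset_span ⟨[], by simp, by simp⟩
  mul_mem := by
    intro i j a b ha hb
    have h : wordGrading k gen deg i * wordGrading k gen deg j ≤ wordGrading k gen deg (i + j) := by
      rw [wordGrading, wordGrading, Submodule.span_mul_span]
      refine Submodule.span_mono ?_
      rintro _ ⟨_, ⟨l, hl, rfl⟩, _, ⟨m, hm, rfl⟩, rfl⟩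
      exact ⟨l ++ m, by simp [hl, hm], by simp⟩
    exact h (Submodule.mul_mem_mul ha hb)

theorem DirectSum.of_mul_of_mk [DecidableEq ι] {𝒜 : ι → Submodule k A} [SetLike.GradedMonoid 𝒜] {i j l : ι}
    {a b c : A} (ha : a ∈ 𝒜 i) (hb : b ∈ 𝒜 j) (hc : c ∈ 𝒜 l) (hl : i + j = l) (hab : a * b = c) :
    DirectSum.of (fun i => 𝒜 i) i ⟨a, ha⟩ * DirectSum.of (fun i => 𝒜 i) j ⟨b, hb⟩ =
      DirectSum.of (fun i => 𝒜 i) l ⟨c, hc⟩ := by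
  subst hl hab
  rw [DirectSum.of_mul_of]
  rfl

/-- If the degree of generators is compatible with all relations, in the sense that there is an
algebra morphism to the direct sum of the word gradings sending each generator to itself, then the
word grading is an algebra grading. -/
@[reducible] def wordGradedAlgebra [DecidableEq ι] (gen : X → A) (deg : X → ι)
    (f : A →ₐ[k] ⨁ i, wordGrading k gen deg i)
    (hf : ∀ x, f (gen x) =
      DirectSum.of (fun i => wordGrading k gen deg i) (deg x) ⟨gen x, gen_mem_wordGrading gen deg x⟩)
    (hgen : ∀ g : A →ₐ[k] A, (∀ x, g (gen x) = gen x) → g = AlgHom.id k A) :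
    GradedAlgebra (wordGrading k gen deg) :=
  GradedAlgebra.ofAlgHom _ f
    (hgen _ fun x => by simp [hf])
    (by
      rintro i ⟨a, ha⟩
      have key : ∀ l : List X, ∃ h, f (l.map gen).prod =
          DirectSum.of (fun i => wordGrading k gen deg i) (l.map deg).sum
            ⟨(l.map gen).prod, h⟩ := by
        intro l
        induction l with
        | nil => exact ⟨SetLike.GradedOne.one_mem, by simp; rfl⟩
        | cons x l ih =>
          obtain ⟨h, ih⟩ := ih
          refine ⟨SetLike.GradedMul.mul_mem (gen_mem_wordGrading gen deg x) h, ?_⟩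
          simp only [List.map_cons, List.prod_cons, map_mul, ih, hf]
          rw [DirectSum.of_mul_of]
          rfl
      have : ∀ (a : A) (ha : a ∈ wordGrading k gen deg i), f a =
          DirectSum.lof k ι (fun i => wordGrading k gen deg i) i ⟨a, ha⟩ := by
        intro a ha
        induction ha using Submodule.span_induction with
        | mem x hx =>
          obtain ⟨l, rfl, rfl⟩ := hx
          obtain ⟨h, e⟩ := key l
          exact e
        | zero => rw [map_zero]; exact (map_zero _).symm
        | add x y hx hy ex ey => rw [map_add, ex, ey, ← map_add]; rfl
        | smul c x hx ex => rw [map_smul, ex, ← map_smul]; rfl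
      exact this a ha)

end WordGrading

/-! ### Graded quivers and their path algebras -/

/-- A graded quiver with vertex set `V` and arrow set `E`. -/
structure GradedQuiver (V E : Type*) where
  tail : E → V
  head : E → V
  weight : E → ℕ

namespace GradedQuiver

variable {V E : Type*}

/-- The weight `N` double: `Sum.inl a` is the arrow `a` and `Sum.inr a` is the reverse arrow `a*`,
of weight `N - |a|` (meant for `N` at least the weight of every arrow). -/
def double (P : GradedQuiver V E) (N : ℕ) : GradedQuiver V (E ⊕ E) where
  tail := Sum.elim P.tail P.head
  head := Sum.elim P.head P.tail
  weight := Sum.elim P.weight fun a => N - P.weight a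

/-- The relations of the path algebra; paths are composed from right to left. -/
inductive PathRel (k : Type*) [Field k] [Fintype V] (P : GradedQuiver V E) :
    FreeAlgebra k (V ⊕ E) → FreeAlgebra k (V ⊕ E) → Prop
  | idem (i : V) : PathRel k P
      (FreeAlgebra.ι k (Sum.inl i) * FreeAlgebra.ι k (Sum.inl i)) (FreeAlgebra.ι k (Sum.inl i))
  | orth (i j : V) (hij : i ≠ j) : PathRel k P
      (FreeAlgebra.ι k (Sum.inl i) * FreeAlgebra.ι k (Sum.inl j)) 0
  | unit : PathRel k P (∑ i : V, FreeAlgebra.ι k (Sum.inl i)) 1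
  | head (a : E) : PathRel k P
      (FreeAlgebra.ι k (Sum.inl (P.head a)) * FreeAlgebra.ι k (Sum.inr a))
      (FreeAlgebra.ι k (Sum.inr a))
  | tail (a : E) : PathRel k P
      (FreeAlgebra.ι k (Sum.inr a) * FreeAlgebra.ι k (Sum.inl (P.tail a)))
      (FreeAlgebra.ι k (Sum.inr a))

variable (k : Type*) [Field k] [Fintype V] (P : GradedQuiver V E)

/-- The path algebra `kP`, presented by trivial paths `e i` and arrows. -/
def PathAlgebra : Type _ := RingQuot (PathRel k P)

namespace PathAlgebra

instance : Ring (PathAlgebra k P) := inferInstanceAs (Ring (RingQuot (PathRel k P)))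
instance : Algebra k (PathAlgebra k P) := inferInstanceAs (Algebra k (RingQuot (PathRel k P)))

/-- The generators: trivial paths and arrows. -/
def gen (x : V ⊕ E) : PathAlgebra k P := RingQuot.mkAlgHom k (PathRel k P) (FreeAlgebra.ι k x)

/-- The trivial path at `i`. -/
def e (i : V) : PathAlgebra k P := gen k P (Sum.inl i)

/-- An arrow, as an element of the path algebra. -/
def arrow (a : E) : PathAlgebra k P := gen k P (Sum.inr a)

variable {k P}

theorem e_mul_self (i : V) : e k P i * e k P i = e k P i := by
  have := RingQuot.mkAlgHom_rel k (PathRel.idem (k := k) (P := P) i)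
  rwa [map_mul] at this

theorem e_mul_e {i j : V} (h : i ≠ j) : e k P i * e k P j = 0 := by
  have := RingQuot.mkAlgHom_rel k (PathRel.orth (k := k) (P := P) i j h)
  rwa [map_mul, map_zero] at this

theorem sum_e : ∑ i, e k P i = 1 := by
  have := RingQuot.mkAlgHom_rel k (PathRel.unit (k := k) (P := P))
  rwa [map_sum, map_one] at this

theorem e_head_mul (a : E) : e k P (P.head a) * arrow k P a = arrow k P a := by
  have := RingQuot.mkAlgHom_rel k (PathRel.head (k := k) (P := P) a)
  rwa [map_mul] at this

theorem mul_e_tail (a : E) : arrow k P a * e k P (P.tail a) = arrow k P a := by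
  have := RingQuot.mkAlgHom_rel k (PathRel.tail (k := k) (P := P) a)
  rwa [map_mul] at this

/-- The universal property of the path algebra. -/
def lift {C : Type*} [Ring C] [Algebra k C] (f : V → C) (g : E → C)
    (idem : ∀ i, f i * f i = f i) (orth : ∀ i j, i ≠ j → f i * f j = 0) (unit : ∑ i, f i = 1)
    (head : ∀ a, f (P.head a) * g a = g a) (tail : ∀ a, g a * f (P.tail a) = g a) :
    PathAlgebra k P →ₐ[k] C :=
  RingQuot.liftAlgHom k ⟨FreeAlgebra.lift k (Sum.elim f g), by
    intro x y h
    cases h with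
    | idem i => simp [idem]
    | orth i j hij => simp [orth i j hij]
    | unit => simp [unit]
    | head a => simp [head]
    | tail a => simp [tail]⟩

section lift

variable {C : Type*} [Ring C] [Algebra k C] {f : V → C} {g : E → C}
    {idem : ∀ i, f i * f i = f i} {orth : ∀ i j, i ≠ j → f i * f j = 0} {unit : ∑ i, f i = 1}
    {head : ∀ a, f (P.head a) * g a = g a} {tail : ∀ a, g a * f (P.tail a) = g a}

@[simp] theorem lift_e (i : V) :
    (lift f g idem orth unit head tail : PathAlgebra k P →ₐ[k] C) (e k P i) = f i := by
  unfold lift e gen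
  erw [RingQuot.liftAlgHom_mkAlgHom_apply]
  simp

@[simp] theorem lift_arrow (a : E) :
    (lift f g idem orth unit head tail : PathAlgebra k P →ₐ[k] C) (arrow k P a) = g a := by
  unfold lift arrow gen
  erw [RingQuot.liftAlgHom_mkAlgHom_apply]
  simp

end lift

theorem algHom_ext {C : Type*} [Ring C] [Algebra k C] {f g : PathAlgebra k P →ₐ[k] C}
    (h : ∀ x, f (gen k P x) = g (gen k P x)) : f = g := by
  refine RingQuot.ringQuot_ext' k (s := PathRel k P) f g ?_
  refine FreeAlgebra.hom_ext ?_
  funext x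
  exact h x

end PathAlgebra

/-- The weight of a generator: trivial paths have weight `0`. -/
def genWeight : V ⊕ E → ℕ := Sum.elim (fun _ => 0) P.weight

/-- The weight grading: `grade k P w` is spanned by the paths of weight `w`. -/
abbrev grade : ℕ → Submodule k (PathAlgebra k P) :=
  wordGrading k (PathAlgebra.gen k P) P.genWeight

theorem e_mem_grade (i : V) : PathAlgebra.e k P i ∈ grade k P 0 :=
  gen_mem_wordGrading _ P.genWeight (Sum.inl i)

theorem arrow_mem_grade (a : E) : PathAlgebra.arrow k P a ∈ grade k P (P.weight a) :=
  gen_mem_wordGrading _ P.genWeight (Sum.inr a)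

instance gradedAlgebra : GradedAlgebra (grade k P) :=
  wordGradedAlgebra _ _
    (PathAlgebra.lift
      (fun i => DirectSum.of (fun w => grade k P w) 0
        ⟨PathAlgebra.e k P i, e_mem_grade k P i⟩)
      (fun a => DirectSum.of (fun w => grade k P w) (P.weight a)
        ⟨PathAlgebra.arrow k P a, arrow_mem_grade k P a⟩)
      (fun i => DirectSum.of_mul_of_mk _ _ _ (by simp) (PathAlgebra.e_mul_self i))
      (fun i j hij => by
        rw [DirectSum.of_mul_of_mk _ _ (zero_mem _) (add_zero 0) (PathAlgebra.e_mul_e hij)]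
        exact map_zero _)
      (by
        rw [← map_sum, DirectSum.one_def]
        congr 1
        ext
        simp [PathAlgebra.sum_e])
      (fun a => DirectSum.of_mul_of_mk _ _ _ (by simp) (PathAlgebra.e_head_mul a))
      (fun a => DirectSum.of_mul_of_mk _ _ _ (by simp) (PathAlgebra.mul_e_tail a)))
    (by
      rintro (i | a)
      · exact PathAlgebra.lift_e i
      · exact PathAlgebra.lift_arrow a)
    (fun g hg => PathAlgebra.algHom_ext hg)

/-- The subalgebra `R` spanned by the trivial paths. -/
def vertexAlgebra : Subalgebra k (PathAlgebra k P) :=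
  Algebra.adjoin k (Set.range (PathAlgebra.e k P))

end GradedQuiver
/-! ### Noncommutative differential forms -/

/-- The base algebra lies in weight `0`. -/
class BaseDegreeZero {k A : Type*} [Field k] [Ring A] [Algebra k A] (𝒜 : ℕ → Submodule k A)
    (R : Subalgebra k A) : Prop where
  mem_zero : ∀ r ∈ R, r ∈ 𝒜 0

/-- The relations of the algebra of noncommutative forms of `A` relative to `R`, on generators
`a = Sum.inl a` and `da = Sum.inr a`: the product of `A` is kept, `d` is linear, satisfies the
Leibniz rule, and vanishes on `R`. -/
inductive FormRel {k A : Type*} [Field k] [Ring A] [Algebra k A] (R : Subalgebra k A) :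
    FreeAlgebra k (A ⊕ A) → FreeAlgebra k (A ⊕ A) → Prop
  | one : FormRel R (FreeAlgebra.ι k (Sum.inl 1)) 1
  | mul (a b : A) : FormRel R (FreeAlgebra.ι k (Sum.inl (a * b)))
      (FreeAlgebra.ι k (Sum.inl a) * FreeAlgebra.ι k (Sum.inl b))
  | add (a b : A) : FormRel R (FreeAlgebra.ι k (Sum.inl (a + b)))
      (FreeAlgebra.ι k (Sum.inl a) + FreeAlgebra.ι k (Sum.inl b))
  | smul (c : k) (a : A) : FormRel R (FreeAlgebra.ι k (Sum.inl (c • a)))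
      (c • FreeAlgebra.ι k (Sum.inl a))
  | d_add (a b : A) : FormRel R (FreeAlgebra.ι k (Sum.inr (a + b)))
      (FreeAlgebra.ι k (Sum.inr a) + FreeAlgebra.ι k (Sum.inr b))
  | d_smul (c : k) (a : A) : FormRel R (FreeAlgebra.ι k (Sum.inr (c • a)))
      (c • FreeAlgebra.ι k (Sum.inr a))
  | d_mul (a b : A) : FormRel R (FreeAlgebra.ι k (Sum.inr (a * b)))
      (FreeAlgebra.ι k (Sum.inr a) * FreeAlgebra.ι k (Sum.inl b) +
        FreeAlgebra.ι k (Sum.inl a) * FreeAlgebra.ι k (Sum.inr b))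
  | d_base (r : A) (hr : r ∈ R) : FormRel R (FreeAlgebra.ι k (Sum.inr r)) 0

/-- The algebra `Ω_R A = T_A (Ω¹_R A)` of noncommutative differential forms of `A` relative to the
subalgebra `R`: the universal algebra with a morphism from `A` and a derivation `d` on `A` that
vanishes on `R`. -/
def Forms {k A : Type*} [Field k] [Ring A] [Algebra k A] (R : Subalgebra k A) : Type _ :=
  RingQuot (FormRel R)

namespace Forms

section Basic

variable {k A : Type*} [Field k] [Ring A] [Algebra k A] {R : Subalgebra k A}

instance : Ring (Forms R) := inferInstanceAs (Ring (RingQuot (FormRel R)))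
instance : Algebra k (Forms R) := inferInstanceAs (Algebra k (RingQuot (FormRel R)))

/-- The inclusion of `A` as the forms of degree `0`. -/
def of (R : Subalgebra k A) : A →ₐ[k] Forms R :=
  AlgHom.ofLinearMap
    { toFun := fun a => RingQuot.mkAlgHom k (FormRel R) (FreeAlgebra.ι k (Sum.inl a))
      map_add' := fun a b => by
        rw [RingQuot.mkAlgHom_rel k (FormRel.add (R := R) a b), map_add]; rfl
      map_smul' := fun c a => by
        rw [RingQuot.mkAlgHom_rel k (FormRel.smul (R := R) c a), map_smul]; rfl }
    ((RingQuot.mkAlgHom_rel k (FormRel.one (R := R))).trans (map_one _))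
    (fun a b => (RingQuot.mkAlgHom_rel k (FormRel.mul (R := R) a b)).trans (map_mul _ _ _))

/-- The universal derivation, from `A` to the forms of degree `1`. -/
def der (R : Subalgebra k A) : A →ₗ[k] Forms R where
  toFun := fun a => RingQuot.mkAlgHom k (FormRel R) (FreeAlgebra.ι k (Sum.inr a))
  map_add' := fun a b => by
    rw [RingQuot.mkAlgHom_rel k (FormRel.d_add (R := R) a b), map_add]; rfl
  map_smul' := fun c a => by
    rw [RingQuot.mkAlgHom_rel k (FormRel.d_smul (R := R) c a), map_smul]; rfl

theorem der_mul (a b : A) : der R (a * b) = der R a * of R b + of R a * der R b := by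
  refine (RingQuot.mkAlgHom_rel k (FormRel.d_mul (R := R) a b)).trans ?_
  rw [map_add, map_mul, map_mul]
  rfl

theorem der_base {r : A} (hr : r ∈ R) : der R r = 0 :=
  (RingQuot.mkAlgHom_rel k (FormRel.d_base (R := R) r hr)).trans (map_zero _)

/-- The universal property of the algebra of noncommutative forms. -/
def lift {C : Type*} [Semiring C] [Algebra k C] (f : A →ₐ[k] C) (D : A →ₗ[k] C)
    (hmul : ∀ a b, D (a * b) = D a * f b + f a * D b) (hbase : ∀ r ∈ R, D r = 0) :
    Forms R →ₐ[k] C :=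
  RingQuot.liftAlgHom k ⟨FreeAlgebra.lift k (Sum.elim f D), by
    intro x y h
    cases h with
    | d_base r hr => simp [hbase r hr]
    | _ => simp [hmul]⟩

section lift

variable {C : Type*} [Semiring C] [Algebra k C] {f : A →ₐ[k] C} {D : A →ₗ[k] C}
    {hmul : ∀ a b, D (a * b) = D a * f b + f a * D b} {hbase : ∀ r ∈ R, D r = 0}

@[simp] theorem lift_of (a : A) : lift f D hmul hbase (of R a) = f a := by
  refine (RingQuot.liftAlgHom_mkAlgHom_apply k _ _ _).trans ?_
  simp

@[simp] theorem lift_der (a : A) : lift f D hmul hbase (der R a) = D a := by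
  refine (RingQuot.liftAlgHom_mkAlgHom_apply k _ _ _).trans ?_
  simp

end lift

theorem algHom_ext {C : Type*} [Ring C] [Algebra k C] {f g : Forms R →ₐ[k] C}
    (h0 : ∀ a, f (of R a) = g (of R a)) (h1 : ∀ a, f (der R a) = g (der R a)) : f = g := by
  refine RingQuot.ringQuot_ext' k (s := FormRel R) f g ?_
  refine FreeAlgebra.hom_ext ?_
  funext x
  rcases x with a | a
  · exact h0 a
  · exact h1 a

theorem induction {motive : Forms R → Prop} (h0 : ∀ a, motive (of R a))
    (h1 : ∀ a, motive (der R a)) (hadd : ∀ x y, motive x → motive y → motive (x + y))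
    (hmul : ∀ x y, motive x → motive y → motive (x * y)) (x : Forms R) : motive x := by
  let S : Subalgebra k (Forms R) :=
    { carrier := {x | motive x}
      mul_mem' := fun ha hb => hmul _ _ ha hb
      add_mem' := fun ha hb => hadd _ _ ha hb
      algebraMap_mem' := fun c => by
        have := h0 (algebraMap k A c)
        rwa [AlgHom.commutes] at this }
  let f : Forms R →ₐ[k] S := lift ((of R).codRestrict S h0)
    { toFun := fun a => ⟨der R a, h1 a⟩
      map_add' := fun a b => Subtype.ext (map_add _ _ _)
      map_smul' := fun c a => Subtype.ext (map_smul _ _ _) }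
    (fun a b => Subtype.ext (der_mul a b)) (fun r hr => Subtype.ext (der_base hr))
  have : S.val.comp f = AlgHom.id k _ :=
    algHom_ext (fun a => by simp [f]) (fun a => by simp [f])
  have h := congrArg (fun g => g x) this
  simp only [AlgHom.comp_apply, AlgHom.id_apply] at h
  rw [← h]
  exact (f x).2

/-- Extensionality for upper triangular matrices of size two. -/
theorem triang_ext {C : Type*} [Ring C] {M N : Matrix (Fin 2) (Fin 2) C} (h00 : M 0 0 = N 0 0)
    (h01 : M 0 1 = N 0 1) (h10 : M 1 0 = N 1 0) (h11 : M 1 1 = N 1 1) : M = N := by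
  rw [Matrix.eta_fin_two M, Matrix.eta_fin_two N, h00, h01, h10, h11]

/-- A linear map to upper triangular matrices. -/
def triang {C : Type*} [Ring C] [Algebra k C] (u v w : A →ₗ[k] C) :
    A →ₗ[k] Matrix (Fin 2) (Fin 2) C where
  toFun := fun a => !![u a, v a; 0, w a]
  map_add' := fun a b => triang_ext (map_add u a b) (map_add v a b) (add_zero 0).symm
    (map_add w a b)
  map_smul' := fun c a => triang_ext (map_smul u c a) (map_smul v c a) (smul_zero c).symm
    (map_smul w c a)

@[simp] theorem triang_apply {C : Type*} [Ring C] [Algebra k C] (u v w : A →ₗ[k] C) (a : A) :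
    triang u v w a = !![u a, v a; 0, w a] := rfl

/-- The algebra morphism `α ↦ !![f α, D α; 0, g α]`, where `D` is the map on forms with
`D a = p a`, `D (da) = q a` and the twisted Leibniz rule `D (αβ) = f α * D β + D α * g β`. -/
def twistedHom {C : Type*} [Ring C] [Algebra k C] (f g : Forms R →ₐ[k] C) (p q : A →ₗ[k] C)
    (hp : ∀ a b, p (a * b) = f (of R a) * p b + p a * g (of R b))
    (hq : ∀ a b, q (a * b) = (f (der R a) * p b + q a * g (of R b)) +
      (f (of R a) * q b + p a * g (der R b)))
    (hbase : ∀ r ∈ R, q r = 0) : Forms R →ₐ[k] Matrix (Fin 2) (Fin 2) C :=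
  lift
    (AlgHom.ofLinearMap
      (triang (f.toLinearMap ∘ₗ (of R).toLinearMap) p (g.toLinearMap ∘ₗ (of R).toLinearMap))
      (by
        have h := hp 1 1
        simp only [mul_one, map_one, one_mul] at h
        have h' : p 1 = 0 := by simpa using h
        rw [triang_apply, h', Matrix.one_fin_two]
        simp)
      (fun a b => by
        simp only [triang_apply, Matrix.mul_fin_two, hp]
        simp))
    (triang (f.toLinearMap ∘ₗ der R) q (g.toLinearMap ∘ₗ der R))
    (fun a b => by
      simp only [AlgHom.ofLinearMap_apply, triang_apply, Matrix.mul_fin_two, hq]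
      refine triang_ext ?_ ?_ ?_ ?_ <;> simp [der_mul])
    (fun r hr => by
      rw [triang_apply, hbase r hr]
      refine triang_ext ?_ ?_ ?_ ?_ <;> simp [der_base hr])

/-- The map `D` on forms with `D a = p a`, `D (da) = q a` and the twisted Leibniz rule
`D (αβ) = f α * D β + D α * g β`. -/
def twistedDer {C : Type*} [Ring C] [Algebra k C] (f g : Forms R →ₐ[k] C) (p q : A →ₗ[k] C)
    (hp : ∀ a b, p (a * b) = f (of R a) * p b + p a * g (of R b))
    (hq : ∀ a b, q (a * b) = (f (der R a) * p b + q a * g (of R b)) +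
      (f (of R a) * q b + p a * g (der R b)))
    (hbase : ∀ r ∈ R, q r = 0) : Forms R →ₗ[k] C where
  toFun := fun x => twistedHom f g p q hp hq hbase x 0 1
  map_add' := fun x y => by simp
  map_smul' := fun c x => by simp

section twistedDer

variable {C : Type*} [Ring C] [Algebra k C] {f g : Forms R →ₐ[k] C} {p q : A →ₗ[k] C}
    {hp : ∀ a b, p (a * b) = f (of R a) * p b + p a * g (of R b)}
    {hq : ∀ a b, q (a * b) = (f (der R a) * p b + q a * g (of R b)) +
      (f (of R a) * q b + p a * g (der R b))}
    {hbase : ∀ r ∈ R, q r = 0}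

@[simp] theorem twistedDer_of (a : A) : twistedDer f g p q hp hq hbase (of R a) = p a := by
  simp [twistedDer, twistedHom]

@[simp] theorem twistedDer_der (a : A) : twistedDer f g p q hp hq hbase (der R a) = q a := by
  simp [twistedDer, twistedHom]

theorem twistedHom_entries (x : Forms R) :
    twistedHom f g p q hp hq hbase x 0 0 = f x ∧ twistedHom f g p q hp hq hbase x 1 0 = 0 ∧
      twistedHom f g p q hp hq hbase x 1 1 = g x := by
  induction x using induction with
  | h0 a => simp [twistedHom]
  | h1 a => simp [twistedHom]
  | hadd x y hx hy => simp [hx, hy]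
  | hmul x y hx hy => simp [Matrix.mul_apply, Fin.sum_univ_two, hx, hy]

theorem twistedDer_mul (x y : Forms R) : twistedDer f g p q hp hq hbase (x * y) =
    f x * twistedDer f g p q hp hq hbase y + twistedDer f g p q hp hq hbase x * g y := by
  have hx := twistedHom_entries (hp := hp) (hq := hq) (hbase := hbase) x
  have hy := twistedHom_entries (hp := hp) (hq := hq) (hbase := hbase) y
  simp [twistedDer, Matrix.mul_apply, Fin.sum_univ_two, hx, hy]

end twistedDer

/-- The sign automorphism of forms extending `s` on `A` and with `da ↦ - d(s a)`. -/
def signHom (s : A →ₐ[k] A) (hs : ∀ r ∈ R, s r = r) : Forms R →ₐ[k] Forms R :=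
  lift ((of R).comp s) (-(der R ∘ₗ s.toLinearMap))
    (fun a b => by simp [der_mul]; abel)
    (fun r hr => by simp [hs r hr, der_base hr])

@[simp] theorem signHom_of (s : A →ₐ[k] A) (hs : ∀ r ∈ R, s r = r) (a : A) :
    signHom s hs (of R a) = of R (s a) := by simp [signHom]

@[simp] theorem signHom_der (s : A →ₐ[k] A) (hs : ∀ r ∈ R, s r = r) (a : A) :
    signHom s hs (der R a) = - der R (s a) := by simp [signHom]

/-- The sign automorphism `α ↦ (-1)^‖α‖ α` of forms. -/
def sgn (R : Subalgebra k A) : Forms R →ₐ[k] Forms R := signHom (AlgHom.id k A) fun _ _ => rfl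

@[simp] theorem sgn_of (a : A) : sgn R (of R a) = of R a := signHom_of _ _ a
@[simp] theorem sgn_der (a : A) : sgn R (der R a) = -der R a := signHom_der _ _ a

/-- The de Rham differential on noncommutative forms: `d a = da`, `d (da) = 0`, and
`d (αβ) = (dα) β + (-1)^‖α‖ α (dβ)`. -/
def d (R : Subalgebra k A) : Forms R →ₗ[k] Forms R :=
  twistedDer (sgn R) (AlgHom.id k _) (der R) 0
    (fun a b => by simp [der_mul, add_comm]) (fun a b => by simp) (fun _ _ => rfl)

@[simp] theorem d_of (a : A) : d R (of R a) = der R a := by simp [d]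
@[simp] theorem d_der (a : A) : d R (der R a) = 0 := by simp [d]

theorem d_mul (x y : Forms R) :
    d R (x * y) = sgn R x * d R y + d R x * y :=
  twistedDer_mul x y

/-- The map on forms induced by a morphism of algebras over the base subalgebras. -/
def map {A' : Type*} [Ring A'] [Algebra k A'] {R' : Subalgebra k A'} (f : A →ₐ[k] A')
    (hf : ∀ r ∈ R, f r ∈ R') : Forms R →ₐ[k] Forms R' :=
  lift ((of R').comp f) (der R' ∘ₗ f.toLinearMap) (fun a b => by simp [der_mul])
    (fun r hr => by simp [der_base (hf r hr)])

end Basic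

section Graded

variable {k A : Type*} [Field k] [Ring A] [Algebra k A]

/-- Homogeneous generators of the algebra of forms: `(a, false)` stands for `a` and `(a, true)` for
`da`, with `a` homogeneous. -/
abbrev Gen (𝒜 : ℕ → Submodule k A) : Type _ := (Σ w, 𝒜 w) × Bool

/-- A homogeneous generator as a form. -/
def gen (𝒜 : ℕ → Submodule k A) (R : Subalgebra k A) (x : Gen 𝒜) : Forms R :=
  if x.2 then der R x.1.2 else of R x.1.2

/-- The bidegree (weight, form degree) of a homogeneous generator. -/
def genDeg (𝒜 : ℕ → Submodule k A) (x : Gen 𝒜) : ℕ × ℕ := (x.1.1, if x.2 then 1 else 0)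

/-- The bigrading of forms by weight and form degree. -/
abbrev grade (𝒜 : ℕ → Submodule k A) (R : Subalgebra k A) : ℕ × ℕ → Submodule k (Forms R) :=
  wordGrading k (gen 𝒜 R) (genDeg 𝒜)

variable (𝒜 : ℕ → Submodule k A) (R : Subalgebra k A)

theorem of_mem_grade {w : ℕ} {a : A} (ha : a ∈ 𝒜 w) : of R a ∈ grade 𝒜 R (w, 0) :=
  gen_mem_wordGrading (gen 𝒜 R) (genDeg 𝒜) (⟨w, ⟨a, ha⟩⟩, false)

theorem der_mem_grade {w : ℕ} {a : A} (ha : a ∈ 𝒜 w) : der R a ∈ grade 𝒜 R (w, 1) :=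
  gen_mem_wordGrading (gen 𝒜 R) (genDeg 𝒜) (⟨w, ⟨a, ha⟩⟩, true)

theorem sgn_of_mem {w p : ℕ} {x : Forms R} (hx : x ∈ grade 𝒜 R (w, p)) :
    sgn R x = (-1 : ℤ) ^ p • x := by
  induction hx using Submodule.span_induction with
  | zero => simp
  | add x y _ _ hx hy => simp [hx, hy]
  | smul c x _ hx => simp [hx]
  | mem x hx =>
    obtain ⟨l, hl, rfl⟩ := hx
    induction l generalizing w p with
    | nil =>
      obtain rfl : 0 = p := congrArg Prod.snd hl
      simp
    | cons y l ih =>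
      obtain ⟨⟨v, a⟩, b⟩ := y
      rw [List.map_cons, List.sum_cons] at hl
      obtain rfl : _ = p := congrArg Prod.snd hl
      rw [List.map_cons, List.prod_cons, map_mul, ih (w := ((l.map (genDeg 𝒜)).sum).1)
        (p := ((l.map (genDeg 𝒜)).sum).2) rfl]
      rcases Nat.even_or_odd ((l.map (genDeg 𝒜)).sum).2 with h | h <;> cases b <;>
        simp [genDeg, gen, pow_add, h.neg_one_pow]

theorem d_mem {w p : ℕ} {x : Forms R} (hx : x ∈ grade 𝒜 R (w, p)) :
    d R x ∈ grade 𝒜 R (w, p + 1) := by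
  induction hx using Submodule.span_induction with
  | zero => simp
  | add x y _ _ hx hy => rw [map_add]; exact add_mem hx hy
  | smul c x _ hx => rw [map_smul]; exact Submodule.smul_mem _ _ hx
  | mem x hx =>
    obtain ⟨l, hl, rfl⟩ := hx
    induction l generalizing w p with
    | nil =>
      have := d_mul (R := R) 1 1
      simp only [mul_one, map_one, one_mul, left_eq_add] at this
      simp [this]
    | cons y l ih =>
      have ih := ih (w := ((l.map (genDeg 𝒜)).sum).1)
        (p := ((l.map (genDeg 𝒜)).sum).2) rfl
      have hl' : (l.map (gen 𝒜 R)).prod ∈ grade 𝒜 R (l.map (genDeg 𝒜)).sum :=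
        Submodule.subset_span ⟨l, rfl, rfl⟩
      obtain ⟨⟨v, a⟩, b⟩ := y
      rw [List.map_cons, List.sum_cons] at hl
      have h1 := congrArg Prod.fst hl
      have h2 := congrArg Prod.snd hl
      rw [List.map_cons, List.prod_cons, d_mul]
      cases b
      · simp only [genDeg, Prod.fst_add, Prod.snd_add] at h1 h2
        simp only [gen, sgn_of, d_of, Bool.false_eq_true, if_false]
        refine add_mem ?_ ?_
        · convert SetLike.GradedMul.mul_mem (of_mem_grade 𝒜 R a.2) ih using 2
          ext <;> simp [← h1, ← h2]
        · convert SetLike.GradedMul.mul_mem (der_mem_grade 𝒜 R a.2) hl' using 2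
          ext <;> simp [← h1, ← h2]
          omega
      · simp only [genDeg, Prod.fst_add, Prod.snd_add] at h1 h2
        simp only [gen, sgn_der, d_der, if_true, zero_mul, add_zero, neg_mul]
        refine neg_mem ?_
        convert SetLike.GradedMul.mul_mem (der_mem_grade 𝒜 R a.2) ih using 2
        ext <;> simp [← h1, ← h2]
        omega

variable [GradedAlgebra 𝒜]

/-- The linear map from `A` to a direct sum sending `a` of weight `w` to `f w a`. -/
def ofHomogeneous {M : Type*} [AddCommMonoid M] [Module k M] (f : ∀ w, 𝒜 w →ₗ[k] M) : A →ₗ[k] M :=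
  DirectSum.toModule k ℕ M f ∘ₗ (DirectSum.decomposeLinearEquiv 𝒜).toLinearMap

theorem ofHomogeneous_apply {M : Type*} [AddCommMonoid M] [Module k M] (f : ∀ w, 𝒜 w →ₗ[k] M)
    {w : ℕ} {a : A} (ha : a ∈ 𝒜 w) : ofHomogeneous 𝒜 f a = f w ⟨a, ha⟩ := by
  have : DirectSum.decompose 𝒜 a = DirectSum.lof k ℕ (fun w => 𝒜 w) w ⟨a, ha⟩ :=
    DirectSum.decompose_of_mem 𝒜 ha
  change DirectSum.toModule k ℕ M f (DirectSum.decompose 𝒜 a) = _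
  rw [this, DirectSum.toModule_lof]

/-- The coordinate in bidegree `(w, 0)`. -/
def ofSum : A →ₗ[k] ⨁ i, grade 𝒜 R i :=
  ofHomogeneous 𝒜 fun w => DirectSum.lof k (ℕ × ℕ) (fun i => grade 𝒜 R i) (w, 0) ∘ₗ
    ((of R).toLinearMap.restrict fun _ ha => of_mem_grade 𝒜 R ha)

/-- The coordinate in bidegree `(w, 1)`. -/
def derSum : A →ₗ[k] ⨁ i, grade 𝒜 R i :=
  ofHomogeneous 𝒜 fun w => DirectSum.lof k (ℕ × ℕ) (fun i => grade 𝒜 R i) (w, 1) ∘ₗ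
    ((der R).restrict fun _ ha => der_mem_grade 𝒜 R ha)

theorem ofSum_apply {w : ℕ} {a : A} (ha : a ∈ 𝒜 w) : ofSum 𝒜 R a =
    DirectSum.of (fun i => grade 𝒜 R i) (w, 0) ⟨of R a, of_mem_grade 𝒜 R ha⟩ := by
  rw [ofSum, ofHomogeneous_apply 𝒜 _ ha]; rfl

theorem derSum_apply {w : ℕ} {a : A} (ha : a ∈ 𝒜 w) : derSum 𝒜 R a =
    DirectSum.of (fun i => grade 𝒜 R i) (w, 1) ⟨der R a, der_mem_grade 𝒜 R ha⟩ := by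
  rw [derSum, ofHomogeneous_apply 𝒜 _ ha]; rfl

theorem bilin_ext {M : Type*} [AddCommGroup M] {f g : A → A → M}
    (hf1 : ∀ a b c, f (a + b) c = f a c + f b c) (hf2 : ∀ a b c, f a (b + c) = f a b + f a c)
    (hg1 : ∀ a b c, g (a + b) c = g a c + g b c) (hg2 : ∀ a b c, g a (b + c) = g a b + g a c)
    (h : ∀ i j, ∀ a ∈ 𝒜 i, ∀ b ∈ 𝒜 j, f a b = g a b) (a b : A) : f a b = g a b := by
  induction a using DirectSum.Decomposition.inductionOn 𝒜 with
  | zero =>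
    have h1 := hf1 0 0 b
    have h2 := hg1 0 0 b
    simp only [add_zero, left_eq_add] at h1 h2
    rw [h1, h2]
  | add x y hx hy => rw [hf1, hg1, hx, hy]
  | homogeneous x =>
    induction b using DirectSum.Decomposition.inductionOn 𝒜 with
    | zero =>
      have h1 := hf2 x 0 0
      have h2 := hg2 x 0 0
      simp only [add_zero, left_eq_add] at h1 h2
      rw [h1, h2]
    | add y z hy hz => rw [hf2, hg2, hy, hz]
    | homogeneous y => exact h _ _ _ x.2 _ y.2

theorem ofSum_mul (a b : A) : ofSum 𝒜 R (a * b) = ofSum 𝒜 R a * ofSum 𝒜 R b := by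
  refine bilin_ext 𝒜 (f := fun a b => ofSum 𝒜 R (a * b))
    (g := fun a b => ofSum 𝒜 R a * ofSum 𝒜 R b) (by simp [add_mul]) (by simp [mul_add])
    (by simp [add_mul]) (by simp [mul_add]) ?_ a b
  intro i j a ha b hb
  simp only [ofSum_apply 𝒜 R ha, ofSum_apply 𝒜 R hb,
    ofSum_apply 𝒜 R (SetLike.GradedMul.mul_mem ha hb)]
  exact (DirectSum.of_mul_of_mk (𝒜 := grade 𝒜 R) (of_mem_grade 𝒜 R ha) (of_mem_grade 𝒜 R hb)
    (of_mem_grade 𝒜 R (SetLike.GradedMul.mul_mem ha hb)) rfl (map_mul (of R) a b).symm).symm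

theorem derSum_mul (a b : A) :
    derSum 𝒜 R (a * b) = derSum 𝒜 R a * ofSum 𝒜 R b + ofSum 𝒜 R a * derSum 𝒜 R b := by
  refine bilin_ext 𝒜 (f := fun a b => derSum 𝒜 R (a * b))
    (g := fun a b => derSum 𝒜 R a * ofSum 𝒜 R b + ofSum 𝒜 R a * derSum 𝒜 R b)
    (by simp [add_mul]) (by simp [mul_add])
    (by intros; simp only [map_add, add_mul]; abel)
    (by intros; simp only [map_add, mul_add]; abel) ?_ a b
  intro i j a ha b hb
  simp only [ofSum_apply 𝒜 R ha, ofSum_apply 𝒜 R hb, derSum_apply 𝒜 R ha, derSum_apply 𝒜 R hb,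
    derSum_apply 𝒜 R (SetLike.GradedMul.mul_mem ha hb)]
  have h1 := SetLike.GradedMul.mul_mem (der_mem_grade 𝒜 R ha) (of_mem_grade 𝒜 R hb)
  have h2 := SetLike.GradedMul.mul_mem (of_mem_grade 𝒜 R ha) (der_mem_grade 𝒜 R hb)
  rw [DirectSum.of_mul_of_mk _ _ h1 rfl rfl,
    DirectSum.of_mul_of_mk (l := (i, 0) + (j, 1)) _ _ h2 rfl rfl]
  change _ = DirectSum.of (fun i => grade 𝒜 R i) (i + j, 1) _ +
    DirectSum.of (fun i => grade 𝒜 R i) (i + j, 1) _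
  rw [← map_add]
  congr 1
  ext
  exact der_mul a b

/-- The multiplicative form of `ofSum`. -/
def ofSumHom : A →ₐ[k] ⨁ i, grade 𝒜 R i :=
  AlgHom.ofLinearMap (ofSum 𝒜 R)
    (by
      rw [ofSum_apply 𝒜 R SetLike.GradedOne.one_mem, DirectSum.one_def]
      congr 1
      ext
      exact map_one _)
    (ofSum_mul 𝒜 R)

/-- The decomposition of a form into its homogeneous parts. -/
def decomposeHom [BaseDegreeZero 𝒜 R] : Forms R →ₐ[k] ⨁ i, grade 𝒜 R i :=
  lift (R := R) (ofSumHom 𝒜 R) (derSum 𝒜 R) (derSum_mul 𝒜 R) (fun r hr => by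
    rw [derSum_apply 𝒜 R (BaseDegreeZero.mem_zero r hr)]
    have : (⟨der R r, der_mem_grade 𝒜 R (BaseDegreeZero.mem_zero r hr)⟩ : grade 𝒜 R (0, 1)) = 0 :=
      Subtype.ext (der_base hr)
    rw [this, map_zero])

instance gradedAlgebra [BaseDegreeZero 𝒜 R] : GradedAlgebra (grade 𝒜 R) :=
  wordGradedAlgebra _ _ (decomposeHom 𝒜 R)
    (by
      rintro ⟨⟨w, a⟩, b⟩
      cases b
      · exact (lift_of (a : A)).trans (ofSum_apply 𝒜 R a.2)
      · exact (lift_der (a : A)).trans (derSum_apply 𝒜 R a.2))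
    (fun g hg => algHom_ext
      (fun a => by
        induction a using DirectSum.Decomposition.inductionOn 𝒜 with
        | zero => simp
        | add x y hx hy => simp_all
        | homogeneous x => exact hg (⟨_, x⟩, false))
      (fun a => by
        induction a using DirectSum.Decomposition.inductionOn 𝒜 with
        | zero => simp
        | add x y hx hy => simp_all
        | homogeneous x => exact hg (⟨_, x⟩, true)))

end Graded
end Forms

/-! ### The Karoubi–de Rham complex -/

/-- The Koszul sign of a pair of bidegrees. -/
def koszulSign (i j : ℕ × ℕ) : ℤ := (-1) ^ (i.1 * j.1 + i.2 * j.2)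

section DR

variable {k A : Type*} [Field k] [Ring A] [Algebra k A] (𝒜 : ℕ → Submodule k A)
  (R : Subalgebra k A)

/-- The span `[Ω, Ω]` of the bigraded commutators `αβ - (-1)^(|α||β| + ‖α‖‖β‖) βα`. -/
def formCommutators : Submodule k (Forms R) :=
  Submodule.span k {x | ∃ i j, ∃ α ∈ Forms.grade 𝒜 R i, ∃ β ∈ Forms.grade 𝒜 R j,
    α * β - koszulSign i j • (β * α) = x}

/-- The space `DR A = Ω_R A / [Ω_R A, Ω_R A]`. -/
abbrev DR : Type _ := Forms R ⧸ formCommutators 𝒜 R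

/-- The class of a form. -/
abbrev DR.mk : Forms R →ₗ[k] DR 𝒜 R := (formCommutators 𝒜 R).mkQ

theorem d_mem_formCommutators : formCommutators 𝒜 R ≤ (formCommutators 𝒜 R).comap (Forms.d R) := by
  refine Submodule.span_le.mpr ?_
  rintro _ ⟨i, j, α, hα, β, hβ, rfl⟩
  have h1 : ∀ i j, ∀ α ∈ Forms.grade 𝒜 R i, ∀ β ∈ Forms.grade 𝒜 R j,
      α * β - koszulSign i j • (β * α) ∈ formCommutators 𝒜 R :=
    fun i j α hα β hβ => Submodule.subset_span ⟨i, j, α, hα, β, hβ, rfl⟩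
  have h2 := h1 _ _ _ (Forms.d_mem 𝒜 R hα) _ hβ
  have h3 := Submodule.smul_mem _ ((-1 : k) ^ i.2) (h1 _ _ _ hα _ (Forms.d_mem 𝒜 R hβ))
  have h4 := add_mem h2 h3
  change Forms.d R _ ∈ formCommutators 𝒜 R
  convert h4 using 1
  rw [map_sub, map_zsmul, Forms.d_mul, Forms.d_mul, Forms.sgn_of_mem 𝒜 R hα,
    Forms.sgn_of_mem 𝒜 R hβ]
  rcases Nat.even_or_odd i.2 with hi | hi <;> rcases Nat.even_or_odd j.2 with hj | hj <;>
  simp [koszulSign, pow_add, hi.neg_one_pow, hj.neg_one_pow, pow_mul, add_mul, mul_add, smul_sub] <;>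
  abel

/-- The differential of the Karoubi–de Rham complex, `d[α] = [dα]`. -/
def DR.d : DR 𝒜 R →ₗ[k] DR 𝒜 R := Submodule.mapQ _ _ (Forms.d R) (d_mem_formCommutators 𝒜 R)

end DR

/-! ### Double derivations and contractions -/

section DoubleDer

variable {k A : Type*} [Field k] [Ring A] [Algebra k A] (𝒜 : ℕ → Submodule k A)
  (R : Subalgebra k A)

/-- The part of weight `n` of `A ⊗ A`. -/
def tensorGrade (n : ℤ) : Submodule k (A ⊗[k] A) :=
  Submodule.span k {t | ∃ i j : ℕ, (i : ℤ) + j = n ∧ ∃ u ∈ 𝒜 i, ∃ v ∈ 𝒜 j, u ⊗ₜ[k] v = t}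

/-- The sign `(-1)^n` as an integer. -/
def parity (n : ℤ) : ℤ := (n.negOnePow : ℤ)

theorem parity_add (m n : ℤ) : parity (m + n) = parity m * parity n := by
  simp [parity, Int.negOnePow_add]

@[simp] theorem parity_zero : parity 0 = 1 := by simp [parity]

theorem parity_eq (n : ℤ) : parity n = 1 ∨ parity n = -1 := by
  rcases Int.units_eq_one_or n.negOnePow with h | h <;> simp [parity, h]

theorem parity_natCast (n : ℕ) : parity n = (-1) ^ n := by
  simp [parity, Int.negOnePow]

theorem parity_congr {m n : ℤ} (h : Even (m - n)) : parity m = parity n := by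
  rw [parity, parity, (Int.negOnePow_eq_iff m n).mpr h]

/-- An `R`-linear graded double derivation of weight `n`: a derivation `A → A ⊗ A` for the outer
bimodule structure, `Θ (ab) = Θ(a) b + (-1)^(n|a|) a Θ(b)`, of weight `n` and vanishing on `R`.
In terms of the algebra `A ⊗ A` with product `(a ⊗ b)(c ⊗ d) = ac ⊗ bd`, the outer action is
`a t b = (a ⊗ 1) t (1 ⊗ b)`. -/
structure DoubleDer (n : ℤ) where
  toLin : A →ₗ[k] A ⊗[k] A
  base : ∀ r ∈ R, toLin r = 0
  leibniz : ∀ (i : ℕ), ∀ a ∈ 𝒜 i, ∀ b : A,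
    toLin (a * b) = toLin a * (1 ⊗ₜ b) + parity (n * i) • ((a ⊗ₜ 1) * toLin b)
  weight : ∀ (i : ℕ), ∀ a ∈ 𝒜 i, toLin a ∈ tensorGrade 𝒜 (n + i)

instance (n : ℤ) : Zero (DoubleDer 𝒜 R n) :=
  ⟨{ toLin := 0
     base := fun _ _ => rfl
     leibniz := fun _ _ _ _ => by simp
     weight := fun _ _ _ => zero_mem _ }⟩

variable [GradedAlgebra 𝒜]

/-- The automorphism `a ↦ (-1)^(n|a|) a` of `A`. -/
def signAut (n : ℤ) : A →ₐ[k] A :=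
  AlgHom.ofLinearMap (Forms.ofHomogeneous 𝒜 fun w => parity (n * w) • (𝒜 w).subtype)
    (by rw [Forms.ofHomogeneous_apply 𝒜 _ SetLike.GradedOne.one_mem]; simp)
    (by
      refine Forms.bilin_ext 𝒜 (by simp [add_mul]) (by simp [mul_add])
        (by simp [add_mul]) (by simp [mul_add]) ?_
      intro i j a ha b hb
      rw [Forms.ofHomogeneous_apply 𝒜 _ ha, Forms.ofHomogeneous_apply 𝒜 _ hb,
        Forms.ofHomogeneous_apply 𝒜 _ (SetLike.GradedMul.mul_mem ha hb)]
      rcases parity_eq (n * i) with h | h <;> rcases parity_eq (n * j) with h' | h' <;>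
        simp [mul_add, parity_add, h, h'])

theorem signAut_apply (n : ℤ) {w : ℕ} {a : A} (ha : a ∈ 𝒜 w) :
    signAut 𝒜 n a = parity (n * w) • a :=
  Forms.ofHomogeneous_apply 𝒜 _ ha

namespace DoubleDer

variable {𝒜 R} {n : ℤ} (Θ : DoubleDer 𝒜 R n)

theorem leibniz' (a b : A) :
    Θ.toLin (a * b) = Θ.toLin a * (1 ⊗ₜ b) + (signAut 𝒜 n a ⊗ₜ 1) * Θ.toLin b := by
  induction a using DirectSum.Decomposition.inductionOn 𝒜 with
  | zero => simp
  | add x y hx hy =>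
    simp only [map_add, add_mul, hx, hy, TensorProduct.add_tmul]
    abel
  | @homogeneous i x =>
    rw [Θ.leibniz _ x x.2, signAut_apply 𝒜 n x.2]
    rcases parity_eq (n * i) with h | h <;> simp [h, TensorProduct.neg_tmul]

variable [BaseDegreeZero 𝒜 R]

/-- The sign automorphism of forms for an operator of bidegree `(n, -1)`. -/
def formSign (𝒜 : ℕ → Submodule k A) [GradedAlgebra 𝒜] (R : Subalgebra k A)
    [BaseDegreeZero 𝒜 R] (n : ℤ) : Forms R →ₐ[k] Forms R :=
  Forms.signHom (signAut 𝒜 n) fun r hr => by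
    rw [signAut_apply 𝒜 n (BaseDegreeZero.mem_zero (𝒜 := 𝒜) r hr)]
    simp

/-- The contraction `i_Θ : Ω → Ω ⊗ Ω`: the double derivation of bidegree `(n, -1)`, for the
outer bimodule structure, with `i_Θ a = 0` and `i_Θ (da) = Θ a`. -/
def contraction : Forms R →ₗ[k] Forms R ⊗[k] Forms R :=
  Forms.twistedDer
    (Algebra.TensorProduct.includeLeft.comp (formSign 𝒜 R n)) Algebra.TensorProduct.includeRight
    0 (TensorProduct.map (Forms.of R).toLinearMap (Forms.of R).toLinearMap ∘ₗ Θ.toLin)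
    (fun a b => by simp)
    (fun a b => by
      have h : ∀ x y : A ⊗[k] A,
          TensorProduct.map (Forms.of R).toLinearMap (Forms.of R).toLinearMap (x * y) =
          TensorProduct.map (Forms.of R).toLinearMap (Forms.of R).toLinearMap x *
          TensorProduct.map (Forms.of R).toLinearMap (Forms.of R).toLinearMap y :=
        fun x y => map_mul (Algebra.TensorProduct.map (Forms.of R) (Forms.of R)) x y
      simp [leibniz', h, formSign])
    (fun r hr => by simp [Θ.base r hr])

@[simp] theorem contraction_of (a : A) : Θ.contraction (Forms.of R a) = 0 := by
  simp [contraction]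

@[simp] theorem contraction_der (a : A) : Θ.contraction (Forms.der R a) =
    TensorProduct.map (Forms.of R).toLinearMap (Forms.of R).toLinearMap (Θ.toLin a) := by
  simp [contraction]

theorem contraction_mul (x y : Forms R) : Θ.contraction (x * y) =
    (formSign 𝒜 R n x ⊗ₜ 1) * Θ.contraction y + Θ.contraction x * (1 ⊗ₜ y) :=
  Forms.twistedDer_mul x y

end DoubleDer

/-- The map `α ⊗ β ↦ (-1)^(|α||β| + ‖α‖‖β‖) βα` for homogeneous forms. -/
def koszulMul [BaseDegreeZero 𝒜 R] : Forms R ⊗[k] Forms R →ₗ[k] Forms R :=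
  TensorProduct.lift
    (DirectSum.toModule k (ℕ × ℕ) (Forms R →ₗ[k] Forms R) (fun i => LinearMap.flip
      (DirectSum.toModule k (ℕ × ℕ) (Forms.grade 𝒜 R i →ₗ[k] Forms R) (fun j =>
        koszulSign i j • (LinearMap.mul k (Forms R)).domRestrict₁₂ (Forms.grade 𝒜 R j)
          (Forms.grade 𝒜 R i)) ∘ₗ
        (DirectSum.decomposeLinearEquiv (Forms.grade 𝒜 R)).toLinearMap)) ∘ₗ
      (DirectSum.decomposeLinearEquiv (Forms.grade 𝒜 R)).toLinearMap)

theorem koszulMul_tmul [BaseDegreeZero 𝒜 R] {i j : ℕ × ℕ} {x y : Forms R}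
    (hx : x ∈ Forms.grade 𝒜 R i) (hy : y ∈ Forms.grade 𝒜 R j) :
    koszulMul 𝒜 R (x ⊗ₜ y) = koszulSign i j • (y * x) := by
  have h1 : DirectSum.decompose (Forms.grade 𝒜 R) x =
      DirectSum.lof k _ (fun i => Forms.grade 𝒜 R i) i ⟨x, hx⟩ := DirectSum.decompose_of_mem _ hx
  have h2 : DirectSum.decompose (Forms.grade 𝒜 R) y =
      DirectSum.lof k _ (fun i => Forms.grade 𝒜 R i) j ⟨y, hy⟩ := DirectSum.decompose_of_mem _ hy
  simp only [koszulMul, TensorProduct.lift.tmul, LinearMap.comp_apply, LinearEquiv.coe_coe,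
    DirectSum.decomposeLinearEquiv_apply, h1, h2, DirectSum.toModule_lof, LinearMap.flip_apply]
  rfl

namespace DoubleDer

variable {𝒜 R} {n : ℤ} [BaseDegreeZero 𝒜 R]

theorem formSign_of_mem {i : ℕ × ℕ} {x : Forms R} (hx : x ∈ Forms.grade 𝒜 R i) :
    formSign 𝒜 R n x = parity (n * i.1 + i.2) • x := by
  induction hx using Submodule.span_induction with
  | zero => simp
  | add x y _ _ hx hy => simp only [map_add, hx, hy, smul_add]
  | smul c x _ hx => simp only [map_smul, hx, smul_comm c]
  | mem x hx =>
    obtain ⟨l, rfl, rfl⟩ := hx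
    induction l with
    | nil => simp
    | cons y l ih =>
      obtain ⟨⟨v, a⟩, b⟩ := y
      rw [List.map_cons, List.prod_cons, List.map_cons, List.sum_cons, map_mul, ih]
      have e : ∀ m : ℤ, parity (n * (v : ℤ) + m) = parity (n * v) * parity m :=
        fun m => parity_add _ _
      have h1 : parity 1 = -1 := by simp [parity]
      have h2 : ∀ b : Bool, formSign 𝒜 R n (Forms.gen 𝒜 R (⟨v, a⟩, b)) =
          parity (n * v + if b then 1 else 0) • Forms.gen 𝒜 R (⟨v, a⟩, b) := by
        intro b
        have := signAut_apply 𝒜 n a.2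
        cases b <;> rcases parity_eq (n * v) with h | h <;>
          simp [formSign, Forms.gen, this, e, h, h1]
      rw [h2, smul_mul_smul_comm, ← parity_add]
      congr 2
      simp [Forms.genDeg]
      cases b <;> simp <;> ring

/-- The target of the contraction by a double derivation of weight `n` on forms of bidegree `i`. -/
def contractionTarget (𝒜 : ℕ → Submodule k A) (R : Subalgebra k A) (n : ℤ) (i : ℕ × ℕ) :
    Submodule k (Forms R ⊗[k] Forms R) :=
  Submodule.span k {t | ∃ a b : ℕ × ℕ, (a.1 : ℤ) + b.1 = i.1 + n ∧ a.2 + b.2 + 1 = i.2 ∧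
    ∃ x ∈ Forms.grade 𝒜 R a, ∃ y ∈ Forms.grade 𝒜 R b, x ⊗ₜ[k] y = t}

theorem mul_mem_contractionTarget {i j : ℕ × ℕ} {x : Forms R} {t : Forms R ⊗[k] Forms R}
    (hx : x ∈ Forms.grade 𝒜 R i) (ht : t ∈ contractionTarget 𝒜 R n j) :
    (x ⊗ₜ 1) * t ∈ contractionTarget 𝒜 R n (i + j) := by
  induction ht using Submodule.span_induction with
  | zero => simp
  | add s t _ _ hs ht => rw [mul_add]; exact add_mem hs ht
  | smul c t _ ht => rw [mul_smul_comm]; exact Submodule.smul_mem _ _ ht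
  | mem t ht =>
    obtain ⟨a, b, h1, h2, u, hu, v, hv, rfl⟩ := ht
    refine Submodule.subset_span ⟨i + a, b, ?_, ?_, x * u, SetLike.GradedMul.mul_mem hx hu, v, hv,
      by simp⟩
    · simp only [Prod.fst_add]; push_cast; omega
    · simp only [Prod.snd_add]; omega

theorem mul_mem_contractionTarget' {i j : ℕ × ℕ} {x : Forms R} {t : Forms R ⊗[k] Forms R}
    (hx : x ∈ Forms.grade 𝒜 R i) (ht : t ∈ contractionTarget 𝒜 R n j) :
    t * (1 ⊗ₜ x) ∈ contractionTarget 𝒜 R n (j + i) := by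
  induction ht using Submodule.span_induction with
  | zero => simp
  | add s t _ _ hs ht => rw [add_mul]; exact add_mem hs ht
  | smul c t _ ht => rw [smul_mul_assoc]; exact Submodule.smul_mem _ _ ht
  | mem t ht =>
    obtain ⟨a, b, h1, h2, u, hu, v, hv, rfl⟩ := ht
    refine Submodule.subset_span ⟨a, b + i, ?_, ?_, u, hu, v * x, SetLike.GradedMul.mul_mem hv hx,
      by simp⟩
    · simp only [Prod.fst_add]; push_cast; omega
    · simp only [Prod.snd_add]; omega

theorem contraction_mem (Θ : DoubleDer 𝒜 R n) {i : ℕ × ℕ} {x : Forms R}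
    (hx : x ∈ Forms.grade 𝒜 R i) : Θ.contraction x ∈ contractionTarget 𝒜 R n i := by
  induction hx using Submodule.span_induction with
  | zero => simp
  | add x y _ _ hx hy => rw [map_add]; exact add_mem hx hy
  | smul c x _ hx => rw [map_smul]; exact Submodule.smul_mem _ _ hx
  | mem x hx =>
    obtain ⟨l, rfl, rfl⟩ := hx
    induction l with
    | nil =>
      have := Θ.contraction_of 1
      rw [map_one] at this
      simp [this]
    | cons y l ih =>
      have hy : Forms.gen 𝒜 R y ∈ Forms.grade 𝒜 R (Forms.genDeg 𝒜 y) := gen_mem_wordGrading _ _ y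
      have hl : (l.map (Forms.gen 𝒜 R)).prod ∈ Forms.grade 𝒜 R (l.map (Forms.genDeg 𝒜)).sum :=
        Submodule.subset_span ⟨l, rfl, rfl⟩
      simp only [List.map_cons, List.prod_cons, List.sum_cons]
      rw [contraction_mul,
        formSign_of_mem hy]
      refine add_mem (mul_mem_contractionTarget ?_ ih) (mul_mem_contractionTarget' hl ?_)
      · exact zsmul_mem hy _
      · obtain ⟨⟨v, a⟩, b⟩ := y
        cases b
        · simp [Forms.gen]
        · simp only [Forms.gen, if_true, contraction_der]
          have key : ∀ t ∈ tensorGrade 𝒜 (n + v),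
              TensorProduct.map (Forms.of R).toLinearMap (Forms.of R).toLinearMap t ∈
                contractionTarget 𝒜 R n (Forms.genDeg 𝒜 (⟨v, a⟩, true)) := by
            intro t ht
            induction ht using Submodule.span_induction with
            | zero => simp
            | add x y _ _ hx hy => rw [map_add]; exact add_mem hx hy
            | smul c x _ hx => rw [map_smul]; exact Submodule.smul_mem _ _ hx
            | mem t ht =>
              obtain ⟨p, q, hpq, u, hu, v, hv, rfl⟩ := ht
              exact Submodule.subset_span ⟨(p, 0), (q, 0), by simp [Forms.genDeg]; omega,
                by simp [Forms.genDeg], _, Forms.of_mem_grade 𝒜 R hu, _,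
                Forms.of_mem_grade 𝒜 R hv, rfl⟩
          exact key _ (Θ.weight v a a.2)

theorem koszulMul_contractionTarget {i j : ℕ × ℕ} {x : Forms R} {t : Forms R ⊗[k] Forms R}
    (hx : x ∈ Forms.grade 𝒜 R j) (ht : t ∈ contractionTarget 𝒜 R n i) :
    koszulMul 𝒜 R (t * (1 ⊗ₜ x)) =
      koszulSign i j • koszulMul 𝒜 R ((formSign 𝒜 R n x ⊗ₜ 1) * t) := by
  induction ht using Submodule.span_induction with
  | zero => simp
  | add s t _ _ hs ht => simp only [add_mul, mul_add, map_add, hs, ht, smul_add]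
  | smul c t _ ht =>
    simp only [smul_mul_assoc, mul_smul_comm, map_smul, ht, smul_comm c]
  | mem t ht =>
    obtain ⟨a, b, h1, h2, u, hu, v, hv, rfl⟩ := ht
    rw [formSign_of_mem hx, Algebra.TensorProduct.tmul_mul_tmul, ← TensorProduct.smul_tmul',
      smul_mul_assoc, Algebra.TensorProduct.tmul_mul_tmul, map_zsmul, mul_one, one_mul,
      koszulMul_tmul 𝒜 R hu (SetLike.GradedMul.mul_mem hv hx),
      koszulMul_tmul 𝒜 R (SetLike.GradedMul.mul_mem hx hu) hv, smul_smul, smul_smul, mul_assoc v]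
    congr 1
    simp only [koszulSign, ← parity_natCast, ← parity_add]
    refine parity_congr ⟨-(b.1 * j.1 + b.2 * j.2 + j.2), ?_⟩
    have h2' : (a.2 : ℤ) + b.2 + 1 = i.2 := by exact_mod_cast h2
    simp only [Prod.fst_add, Prod.snd_add]
    push_cast
    linear_combination (j.1 : ℤ) * h1 + (j.2 : ℤ) * h2'

/-- The reduced contraction `ι_Θ` on forms. -/
def reducedContraction (Θ : DoubleDer 𝒜 R n) : Forms R →ₗ[k] Forms R :=
  koszulMul 𝒜 R ∘ₗ Θ.contraction

theorem koszulSign_mul_self (i j : ℕ × ℕ) : koszulSign i j * koszulSign j i = 1 := by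
  rw [koszulSign, koszulSign, ← pow_add, Even.neg_one_pow]
  exact ⟨i.1 * j.1 + i.2 * j.2, by ring⟩

theorem formCommutators_le_ker (Θ : DoubleDer 𝒜 R n) :
    formCommutators 𝒜 R ≤ LinearMap.ker Θ.reducedContraction := by
  refine Submodule.span_le.mpr ?_
  rintro _ ⟨i, j, α, hα, β, hβ, rfl⟩
  change Θ.reducedContraction _ = 0
  have h1 := koszulMul_contractionTarget hβ (Θ.contraction_mem hα)
  have h2 := koszulMul_contractionTarget hα (Θ.contraction_mem hβ)
  simp only [reducedContraction, map_sub, map_zsmul, LinearMap.comp_apply, contraction_mul,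
    map_add, h1, h2, smul_add, smul_smul, koszulSign_mul_self, one_smul]
  abel

/-- The reduced contraction `ι_Θ : DR A → Ω_R A`. -/
def iota (Θ : DoubleDer 𝒜 R n) : DR 𝒜 R →ₗ[k] Forms R :=
  (formCommutators 𝒜 R).liftQ Θ.reducedContraction Θ.formCommutators_le_ker

end DoubleDer
end DoubleDer
/-! ### Hamiltonian double derivations and the double bracket of a 2-form -/

section Bracket

variable {k A : Type*} [Field k] [Ring A] [Algebra k A] {𝒜 : ℕ → Submodule k A}
  {R : Subalgebra k A} [GradedAlgebra 𝒜] [BaseDegreeZero 𝒜 R]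

/-- `Θ` is a Hamiltonian double derivation of `a`: `ι_Θ ω = da`. -/
def IsHamiltonian (ω : DR 𝒜 R) (a : A) {n : ℤ} (Θ : DoubleDer 𝒜 R n) : Prop :=
  Θ.iota ω = Forms.der R a

open Classical in
/-- The Hamiltonian double derivation `H_a` of an element `a` of weight `w`, for a form `ω` of
weight `N` (and `0` if there is none). -/
noncomputable def hamiltonian (ω : DR 𝒜 R) (N w : ℕ) (a : A) : DoubleDer 𝒜 R ((w : ℤ) - N) :=
  if h : ∃ Θ : DoubleDer 𝒜 R ((w : ℤ) - N), IsHamiltonian ω a Θ then h.choose else 0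

open Classical in
/-- The double bracket `⦃a, b⦄_ω = H_a b` of a bi-symplectic form `ω` of weight `N`, where
`H_a` is the sum of the Hamiltonian double derivations of the homogeneous parts of `a`. -/
noncomputable def doubleBracket (ω : DR 𝒜 R) (N : ℕ) (a b : A) : A ⊗[k] A :=
  ∑ w ∈ (DirectSum.decompose 𝒜 a).support,
    (hamiltonian ω N w (DirectSum.decompose 𝒜 a w : A)).toLin b

/-- The associated bracket `{a, b}_ω`, the product of the two factors of `⦃a, b⦄_ω`. -/
noncomputable def assocBracket (ω : DR 𝒜 R) (N : ℕ) (a b : A) : A :=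
  LinearMap.mul' k A (doubleBracket ω N a b)

end Bracket

/-! ### The standard graded quiver of a quiver -/

namespace GradedQuiver

section

variable (k : Type*) [Field k] {V E : Type*} [Fintype V] (P : GradedQuiver V E)

instance : BaseDegreeZero (grade k P) (vertexAlgebra k P) where
  mem_zero := fun r hr => by
    induction hr using Algebra.adjoin_induction with
    | mem x hx =>
      obtain ⟨i, rfl⟩ := hx
      exact e_mem_grade k P i
    | algebraMap c => exact SetLike.algebraMap_mem_graded _ c
    | add x y _ _ hx hy => exact add_mem hx hy
    | mul x y _ _ hx hy => simpa using SetLike.GradedMul.mul_mem hx hy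

/-- The canonical form `∑ da da*` on the path algebra of the weight `N` double of `P`. -/
def canonicalForm [Fintype E] (N : ℕ) :
    DR (grade k (P.double N)) (vertexAlgebra k (P.double N)) :=
  DR.mk _ _ (∑ a : E, Forms.der _ (PathAlgebra.arrow k (P.double N) (Sum.inl a)) *
    Forms.der _ (PathAlgebra.arrow k (P.double N) (Sum.inr a)))

end

end GradedQuiver

/-- A quiver with vertex set `V` and arrow set `E`. -/
structure PlainQuiver (V E : Type*) where
  tail : E → V
  head : E → V

namespace PlainQuiver

variable {V E : Type*}

/-- A quiver as a graded quiver concentrated in weight `0`. -/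
def toGraded (Q : PlainQuiver V E) : GradedQuiver V E where
  tail := Q.tail
  head := Q.head
  weight := fun _ => 0

/-- The graded quiver with an arrow `a = Sum.inl a` of weight `0` and a parallel arrow
`â = Sum.inr a` of weight `1` for each arrow `a` of `Q`. -/
def hatted (Q : PlainQuiver V E) : GradedQuiver V (E ⊕ E) where
  tail := Sum.elim Q.tail Q.tail
  head := Sum.elim Q.head Q.head
  weight := Sum.elim (fun _ => 0) (fun _ => 1)

variable (k : Type*) [Field k] [Fintype V] (Q : PlainQuiver V E)

/-- The path algebra `B = kQ`. -/
abbrev B : Type _ := GradedQuiver.PathAlgebra k Q.toGraded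

/-- The grading of `B`, concentrated in weight `0`. -/
abbrev gradeB : ℕ → Submodule k (B k Q) := GradedQuiver.grade k Q.toGraded

/-- The subalgebra of `B` spanned by the trivial paths. -/
abbrev baseB : Subalgebra k (B k Q) := GradedQuiver.vertexAlgebra k Q.toGraded

/-- The graded path algebra `A` of the weight `2` double of `Q.hatted`. -/
abbrev A : Type _ := GradedQuiver.PathAlgebra k (Q.hatted.double 2)

/-- The weight grading of `A`. -/
abbrev gradeA : ℕ → Submodule k (A k Q) := GradedQuiver.grade k (Q.hatted.double 2)

/-- The subalgebra of `A` spanned by the trivial paths. -/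
abbrev baseA : Subalgebra k (A k Q) := GradedQuiver.vertexAlgebra k (Q.hatted.double 2)

/-- The arrow `a` of weight `0`, in `A`. -/
def arr (a : E) : A k Q := GradedQuiver.PathAlgebra.arrow k _ (Sum.inl (Sum.inl a))

/-- The arrow `â` of weight `1`, in `A`. -/
def hat (a : E) : A k Q := GradedQuiver.PathAlgebra.arrow k _ (Sum.inl (Sum.inr a))

/-- The arrow `a*` of weight `2`, in `A`. -/
def star (a : E) : A k Q := GradedQuiver.PathAlgebra.arrow k _ (Sum.inr (Sum.inl a))

theorem e_head_arr (a : E) :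
    GradedQuiver.PathAlgebra.e k _ (Q.toGraded.head a) * arr k Q a = arr k Q a :=
  GradedQuiver.PathAlgebra.e_head_mul (P := Q.hatted.double 2) (Sum.inl (Sum.inl a))

theorem arr_e_tail (a : E) :
    arr k Q a * GradedQuiver.PathAlgebra.e k _ (Q.toGraded.tail a) = arr k Q a :=
  GradedQuiver.PathAlgebra.mul_e_tail (P := Q.hatted.double 2) (Sum.inl (Sum.inl a))

theorem e_head_hat (a : E) :
    GradedQuiver.PathAlgebra.e k _ (Q.toGraded.head a) * hat k Q a = hat k Q a :=
  GradedQuiver.PathAlgebra.e_head_mul (P := Q.hatted.double 2) (Sum.inl (Sum.inr a))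

theorem hat_e_tail (a : E) :
    hat k Q a * GradedQuiver.PathAlgebra.e k _ (Q.toGraded.tail a) = hat k Q a :=
  GradedQuiver.PathAlgebra.mul_e_tail (P := Q.hatted.double 2) (Sum.inl (Sum.inr a))

open GradedQuiver.PathAlgebra in
/-- The inclusion of `B` in `A`. -/
def incl : B k Q →ₐ[k] A k Q :=
  lift (e k _) (arr k Q) e_mul_self (fun _ _ h => e_mul_e h) sum_e
    (e_head_arr k Q) (arr_e_tail k Q)

@[simp] theorem incl_e (i : V) : incl k Q (GradedQuiver.PathAlgebra.e k _ i) =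
    GradedQuiver.PathAlgebra.e k _ i := GradedQuiver.PathAlgebra.lift_e i

@[simp] theorem incl_arrow (a : E) : incl k Q (GradedQuiver.PathAlgebra.arrow k _ a) = arr k Q a :=
  GradedQuiver.PathAlgebra.lift_arrow a

open GradedQuiver.PathAlgebra in
/-- The algebra morphism `b ↦ (b, λ(db))` to the square-zero extension of `A` by `A`. -/
def inclHat : B k Q →ₐ[k] TrivSqZeroExt (A k Q) (A k Q) :=
  lift (fun i => TrivSqZeroExt.inl (e k _ i))
    (fun a => TrivSqZeroExt.inl (arr k Q a) + TrivSqZeroExt.inr (hat k Q a))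
    (fun i => by rw [TrivSqZeroExt.inl_mul_inl, e_mul_self])
    (fun i j h => by rw [TrivSqZeroExt.inl_mul_inl, e_mul_e h, TrivSqZeroExt.inl_zero])
    (by
      ext
      · simp [TrivSqZeroExt.fst_sum, sum_e]
      · simp [TrivSqZeroExt.snd_sum])
    (fun a => by
      ext
      · simp [e_head_arr]
      · simp [e_head_hat])
    (fun a => by
      ext
      · simp [arr_e_tail]
      · simp [hat_e_tail])

@[simp] theorem inclHat_e (i : V) : inclHat k Q (GradedQuiver.PathAlgebra.e k _ i) =
    TrivSqZeroExt.inl (GradedQuiver.PathAlgebra.e k (Q.hatted.double 2) i) :=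
  GradedQuiver.PathAlgebra.lift_e i

@[simp] theorem inclHat_arrow (a : E) : inclHat k Q (GradedQuiver.PathAlgebra.arrow k _ a) =
    TrivSqZeroExt.inl (arr k Q a) + TrivSqZeroExt.inr (hat k Q a) :=
  GradedQuiver.PathAlgebra.lift_arrow a

theorem fst_inclHat (b : B k Q) : (inclHat k Q b).fst = incl k Q b := by
  have : (TrivSqZeroExt.fstHom k (A k Q) (A k Q)).comp (inclHat k Q) = incl k Q := by
    refine GradedQuiver.PathAlgebra.algHom_ext ?_
    rintro (i | a)
    · change TrivSqZeroExt.fst (inclHat k Q (GradedQuiver.PathAlgebra.e k _ i)) =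
        incl k Q (GradedQuiver.PathAlgebra.e k _ i)
      simp
    · change TrivSqZeroExt.fst (inclHat k Q (GradedQuiver.PathAlgebra.arrow k _ a)) =
        incl k Q (GradedQuiver.PathAlgebra.arrow k _ a)
      simp
  exact congrArg (fun f => f b) this

/-- The derivation `b ↦ λ(db)` from `B` to `A`, with `a ↦ â` and vanishing on trivial paths. -/
def hatDer : B k Q →ₗ[k] A k Q :=
  TrivSqZeroExt.sndHom (A k Q) (A k Q) |>.restrictScalars k |>.comp (inclHat k Q).toLinearMap

@[simp] theorem hatDer_arrow (a : E) :
    hatDer k Q (GradedQuiver.PathAlgebra.arrow k _ a) = hat k Q a := by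
  simp [hatDer]

theorem hatDer_mul (a b : B k Q) :
    hatDer k Q (a * b) = hatDer k Q a * incl k Q b + incl k Q a * hatDer k Q b := by
  simp [hatDer, fst_inclHat, add_comm]

theorem hatDer_base (r : B k Q) (hr : r ∈ baseB k Q) : hatDer k Q r = 0 := by
  induction hr using Algebra.adjoin_induction with
  | mem x hx =>
    obtain ⟨i, rfl⟩ := hx
    simp [hatDer]
  | algebraMap c => simp [hatDer, TrivSqZeroExt.algebraMap_eq_inl']
  | add x y _ _ hx hy => simp [hx, hy]
  | mul x y _ _ hx hy => simp [hatDer_mul, hx, hy]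

/-- The morphism `λ : Ω_R B → A` with `λ(a) = a` and `λ(da) = â` for the arrows `a`. -/
def lam : Forms (baseB k Q) →ₐ[k] A k Q :=
  Forms.lift (incl k Q) (hatDer k Q) (hatDer_mul k Q) (hatDer_base k Q)

theorem incl_base (r : B k Q) (hr : r ∈ baseB k Q) : incl k Q r ∈ baseA k Q := by
  induction hr using Algebra.adjoin_induction with
  | mem x hx =>
    obtain ⟨i, rfl⟩ := hx
    refine Algebra.subset_adjoin ⟨i, ?_⟩
    simp
  | algebraMap c => rw [AlgHom.commutes]; exact Subalgebra.algebraMap_mem _ c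
  | add x y _ _ hx hy => rw [map_add]; exact add_mem hx hy
  | mul x y _ _ hx hy => rw [map_mul]; exact mul_mem hx hy

/-- The map `Ω_R B → Ω_R A` induced by the inclusion of `B` in `A`. -/
def inclForms : Forms (baseB k Q) →ₐ[k] Forms (baseA k Q) := Forms.map (incl k Q) (incl_base k Q)

variable [Fintype E]

/-- The form `ω₀ = ∑ (da da* + dâ dâ*)` of weight `2` on `A`. -/
abbrev omega : DR (gradeA k Q) (baseA k Q) := Q.hatted.canonicalForm k 2

/-- The standard Hamiltonian `S₀ = ∑ a* â`. -/
def stdHamiltonian : A k Q := ∑ a : E, star k Q a * hat k Q a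

/-- The deformed Hamiltonian `S_φ = S₀ + λ(φ)`. -/
def deformedHamiltonian (φ : Forms (baseB k Q)) : A k Q := stdHamiltonian k Q + lam k Q φ

/-- The double bracket of `ω₀`. -/
noncomputable abbrev dbr (x y : A k Q) : A k Q ⊗[k] A k Q := doubleBracket (omega k Q) 2 x y

/-- The bracket associated with the double bracket of `ω₀`. -/
noncomputable abbrev br (x y : A k Q) : A k Q := assocBracket (omega k Q) 2 x y

end PlainQuiver

/-! ### Double Courant algebroids -/

section Bimodule

variable (k : Type*) {B : Type*} [Field k] [Ring B] [Algebra k B]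

/-- The map `x ⊗ y ↦ bx ⊗ yc`, the outer action on a tensor product. -/
def outerAct {X Y : Type*} [AddCommGroup X] [AddCommGroup Y] [Module k X] [Module k Y]
    [Module B X] [IsScalarTower k B X] [Module Bᵐᵒᵖ Y] [IsScalarTower k Bᵐᵒᵖ Y] (b c : B) :
    X ⊗[k] Y →ₗ[k] X ⊗[k] Y :=
  TensorProduct.map (Algebra.lsmul k k X b) (Algebra.lsmul k k Y (MulOpposite.op c))

/-- The map `x ⊗ y ↦ xc ⊗ by`, the inner action on a tensor product. -/
def innerAct {X Y : Type*} [AddCommGroup X] [AddCommGroup Y] [Module k X] [Module k Y]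
    [Module Bᵐᵒᵖ X] [IsScalarTower k Bᵐᵒᵖ X] [Module B Y] [IsScalarTower k B Y] (b c : B) :
    X ⊗[k] Y →ₗ[k] X ⊗[k] Y :=
  TensorProduct.map (Algebra.lsmul k k X (MulOpposite.op c)) (Algebra.lsmul k k Y b)

/-- The map `b ↦ be`. -/
def actLeft {E : Type*} [AddCommGroup E] [Module k E] [Module B E] [IsScalarTower k B E] (e : E) :
    B →ₗ[k] E :=
  (LinearMap.toSpanSingleton B E e).restrictScalars k

/-- The map `b ↦ eb`. -/
def actRight {E : Type*} [AddCommGroup E] [Module k E] [Module Bᵐᵒᵖ E] [IsScalarTower k Bᵐᵒᵖ E]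
    (e : E) : B →ₗ[k] E :=
  (LinearMap.toSpanSingleton Bᵐᵒᵖ E e).restrictScalars k ∘ₗ
    (MulOpposite.opLinearEquiv k : B ≃ₗ[k] Bᵐᵒᵖ).toLinearMap

/-- The map `x ⊗ w ↦ f(x) ⊗₁ w`, where `(y ⊗ z) ⊗₁ w = y ⊗ w ⊗ z` is the inner product. -/
def insertMid {X Y Z W : Type*} [AddCommGroup X] [AddCommGroup Y] [AddCommGroup Z]
    [AddCommGroup W] [Module k X] [Module k Y] [Module k Z] [Module k W] (f : X →ₗ[k] Y ⊗[k] Z) :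
    X ⊗[k] W →ₗ[k] (Y ⊗[k] W) ⊗[k] Z :=
  (TensorProduct.rightComm k Y Z W).toLinearMap ∘ₗ f.rTensor W

/-- The map `w ⊗ x ↦ w ⊗ f(x)`, with values in the tensor product bracketed to the left. -/
def prepend {X Y Z W : Type*} [AddCommGroup X] [AddCommGroup Y] [AddCommGroup Z]
    [AddCommGroup W] [Module k X] [Module k Y] [Module k Z] [Module k W] (f : X →ₗ[k] Y ⊗[k] Z) :
    W ⊗[k] X →ₗ[k] (W ⊗[k] Y) ⊗[k] Z :=
  (TensorProduct.assoc k W Y Z).symm.toLinearMap ∘ₗ f.lTensor W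

end Bimodule

/-- A double Courant algebroid over an `R`-algebra `B`, on a `B`-bimodule `E`. The double Dorfman
bracket with values in `E ⊗ B ⊕ B ⊗ E` is given by its components `brL` and `brR`, and
`coanchor` is the composite of `ρ^∨ : Ω¹ B → E` with the universal derivation, which is determined
by the inner product and the anchor. -/
structure DoubleCourantAlgebroid (k : Type*) {B : Type*} [Field k] [Ring B] [Algebra k B]
    (R : Subalgebra k B) (E : Type*) [AddCommGroup E] [Module k E] [Module B E] [Module Bᵐᵒᵖ E]
    [IsScalarTower k B E] [IsScalarTower k Bᵐᵒᵖ E] [SMulCommClass B Bᵐᵒᵖ E] where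
  finite : letI : Module (B ⊗[k] Bᵐᵒᵖ) E := TensorProduct.Algebra.module
    Module.Finite (B ⊗[k] Bᵐᵒᵖ) E
  projective : letI : Module (B ⊗[k] Bᵐᵒᵖ) E := TensorProduct.Algebra.module
    Module.Projective (B ⊗[k] Bᵐᵒᵖ) E
  /-- The inner product. -/
  pairing : E →ₗ[k] E →ₗ[k] B ⊗[k] B
  pairing_outer : ∀ (b c : B) (e e' : E),
    pairing e (b • MulOpposite.op c • e') = outerAct k b c (pairing e e')
  pairing_inner : ∀ (b c : B) (e e' : E),
    pairing (b • MulOpposite.op c • e) e' = innerAct k b c (pairing e e')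
  pairing_symm : ∀ e e', pairing e e' = TensorProduct.comm k B B (pairing e' e)
  pairing_nondegenerate : ∀ f : E →ₗ[k] B ⊗[k] B,
    (∀ (b c : B) (e : E), f (b • MulOpposite.op c • e) = outerAct k b c (f e)) →
      ∃! e, pairing e = f
  /-- The anchor, a morphism of bimodules from `E` to the double derivations of `B`. -/
  anchor : E →ₗ[k] B →ₗ[k] B ⊗[k] B
  anchor_leibniz : ∀ (e : E) (x y : B),
    anchor e (x * y) = outerAct k 1 y (anchor e x) + outerAct k x 1 (anchor e y)
  anchor_base : ∀ (e : E), ∀ r ∈ R, anchor e r = 0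
  anchor_inner : ∀ (b c : B) (e : E) (x : B),
    anchor (b • MulOpposite.op c • e) x = innerAct k b c (anchor e x)
  /-- The map `b ↦ ρ^∨(db)`. -/
  coanchor : B →ₗ[k] E
  pairing_coanchor : ∀ (e : E) (b : B), pairing e (coanchor b) = anchor e b
  /-- The component in `E ⊗ B` of the double Dorfman bracket. -/
  brL : E →ₗ[k] E →ₗ[k] E ⊗[k] B
  /-- The component in `B ⊗ E` of the double Dorfman bracket. -/
  brR : E →ₗ[k] E →ₗ[k] B ⊗[k] E
  brL_outer : ∀ (e₁ e₂ : E), ∀ r ∈ R, ∀ s ∈ R,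
    brL e₁ (r • MulOpposite.op s • e₂) = outerAct k r s (brL e₁ e₂)
  brR_outer : ∀ (e₁ e₂ : E), ∀ r ∈ R, ∀ s ∈ R,
    brR e₁ (r • MulOpposite.op s • e₂) = outerAct k r s (brR e₁ e₂)
  brL_inner : ∀ (e₁ e₂ : E), ∀ r ∈ R, ∀ s ∈ R,
    brL (r • MulOpposite.op s • e₁) e₂ = innerAct k r s (brL e₁ e₂)
  brR_inner : ∀ (e₁ e₂ : E), ∀ r ∈ R, ∀ s ∈ R,
    brR (r • MulOpposite.op s • e₁) e₂ = innerAct k r s (brR e₁ e₂)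
  /-- `⟦e₁, b e₂⟧ = ρ(e₁)(b) e₂ + b ⟦e₁, e₂⟧`, in `E ⊗ B` and in `B ⊗ E`. -/
  brL_smul : ∀ (e₁ e₂ : E) (b : B), brL e₁ (b • e₂) = outerAct k b 1 (brL e₁ e₂)
  brR_smul : ∀ (e₁ e₂ : E) (b : B), brR e₁ (b • e₂) =
    (actLeft k e₂).lTensor B (anchor e₁ b) + outerAct k b 1 (brR e₁ e₂)
  /-- `⟦e₁, e₂ b⟧ = e₂ ρ(e₁)(b) + ⟦e₁, e₂⟧ b`, in `E ⊗ B` and in `B ⊗ E`. -/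
  brL_op_smul : ∀ (e₁ e₂ : E) (b : B), brL e₁ (MulOpposite.op b • e₂) =
    (actRight k e₂).rTensor B (anchor e₁ b) + outerAct k 1 b (brL e₁ e₂)
  brR_op_smul : ∀ (e₁ e₂ : E) (b : B), brR e₁ (MulOpposite.op b • e₂) =
    outerAct k 1 b (brR e₁ e₂)
  /-- `ρ^∨ d⟨e, e⟩ = ⟦e, e⟧ + ⟦e, e⟧^σ`, in `E ⊗ B` and in `B ⊗ E`. -/
  coanchor_pairing_left : ∀ e : E, coanchor.rTensor B (pairing e e) =
    brL e e + TensorProduct.comm k B E (brR e e)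
  coanchor_pairing_right : ∀ e : E, coanchor.lTensor B (pairing e e) =
    brR e e + TensorProduct.comm k E B (brL e e)
  /-- `ρ(e₁)⟨e₂, e₂⟩ = ⟨⟦e₁, e₂⟧, e₂⟩_L + ⟨e₂, ⟦e₁, e₂⟧⟩_R`. -/
  anchor_pairing : ∀ e₁ e₂ : E, (anchor e₁).rTensor B (pairing e₂ e₂) =
    insertMid k (pairing.flip e₂) (brL e₁ e₂) + prepend k (pairing e₂) (brR e₁ e₂)
  /-- The double Jacobi identity
  `⟦e₁, ⟦e₂, e₃⟧⟧_L = ⟦e₂, ⟦e₁, e₃⟧⟧_R + ⟦⟦e₁, e₂⟧, e₃⟧_L`,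
  in `E ⊗ B ⊗ B`, in `B ⊗ E ⊗ B`, and in `B ⊗ B ⊗ E`. It uses `⟦e, b⟧ = ρ(e)(b)`,
  `⟦b, e⟧ = -⟨ρ^∨ db, e⟩`, `⟦b ⊗ e, e'⟧_L = ⟦b, e'⟧ ⊗₁ e` and
  `⟦e ⊗ b, e'⟧_L = ⟦e, e'⟧ ⊗₁ b + ⟨e, e'⟩ ⊗₁ ρ^∨ db`. -/
  jacobi_left : ∀ e₁ e₂ e₃ : E, (brL e₁).rTensor B (brL e₂ e₃) =
    prepend k (anchor e₂) (brL e₁ e₃) + insertMid k (brL.flip e₃) (brL e₁ e₂)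
  jacobi_mid : ∀ e₁ e₂ e₃ : E, (brR e₁).rTensor B (brL e₂ e₃) =
    prepend k (brL e₂) (brR e₁ e₃) - insertMid k (pairing.flip e₃ ∘ₗ coanchor) (brR e₁ e₂) +
      insertMid k (pairing.flip e₃) (coanchor.lTensor E (brL e₁ e₂))
  jacobi_right : ∀ e₁ e₂ e₃ : E, (anchor e₁).rTensor E (brR e₂ e₃) =
    prepend k (brR e₂) (brR e₁ e₃) + insertMid k (brR.flip e₃) (brL e₁ e₂)

/-! ### The bimodule of elements of weight 1 -/

namespace PlainQuiver

variable {V E : Type*} (k : Type*) [Field k] [Fintype V] (Q : PlainQuiver V E)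

theorem incl_mem_grade (b : B k Q) : incl k Q b ∈ gradeA k Q 0 := by
  induction b using DirectSum.Decomposition.inductionOn (gradeB k Q) with
  | zero => rw [map_zero]; exact zero_mem _
  | add x y hx hy => rw [map_add]; exact add_mem hx hy
  | @homogeneous i x =>
    obtain ⟨x, hx⟩ := x
    change incl k Q x ∈ gradeA k Q 0
    induction hx using Submodule.span_induction with
    | zero => exact (map_zero (incl k Q)).symm ▸ zero_mem _
    | add x y _ _ hx hy => exact (map_add (incl k Q) x y).symm ▸ add_mem hx hy
    | smul c x _ hx => exact (map_smul (incl k Q) c x).symm ▸ Submodule.smul_mem _ c hx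
    | mem x hx =>
      obtain ⟨l, hl, rfl⟩ := hx
      clear hl
      induction l with
      | nil =>
        rw [List.map_nil, List.prod_nil, map_one]
        exact SetLike.GradedOne.one_mem
      | cons y l ih =>
        have hy : incl k Q (GradedQuiver.PathAlgebra.gen k Q.toGraded y) ∈ gradeA k Q 0 := by
          rcases y with i | a
          · have h := incl_e k Q i
            rw [GradedQuiver.PathAlgebra.e] at h
            rw [h]
            exact GradedQuiver.e_mem_grade k (Q.hatted.double 2) i
          · have h := incl_arrow k Q a
            rw [GradedQuiver.PathAlgebra.arrow] at h
            rw [h]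
            exact GradedQuiver.arrow_mem_grade k (Q.hatted.double 2) (Sum.inl (Sum.inl a))
        rw [List.map_cons, List.prod_cons, map_mul]
        have := SetLike.GradedMul.mul_mem hy (ih)
        rwa [add_zero] at this

/-- The space `A¹` of elements of weight `1`, with the `B`-bimodule structure given by the
multiplication of `A`. -/
def E1 : Type _ := gradeA k Q 1

namespace E1

instance : AddCommGroup (E1 k Q) := inferInstanceAs (AddCommGroup (gradeA k Q 1))
instance : Module k (E1 k Q) := inferInstanceAs (Module k (gradeA k Q 1))

/-- The inclusion of `A¹` in `A`. -/
def val : E1 k Q →ₗ[k] A k Q := (gradeA k Q 1).subtype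

variable {k Q} in
theorem val_injective : Function.Injective (val k Q) := Subtype.val_injective

variable {k Q} in
theorem val_mem (x : E1 k Q) : val k Q x ∈ gradeA k Q 1 := x.2

instance : SMul (B k Q) (E1 k Q) :=
  ⟨fun b x => (⟨incl k Q b * val k Q x, by
    simpa using SetLike.GradedMul.mul_mem (incl_mem_grade k Q b) (val_mem x)⟩ : gradeA k Q 1)⟩

instance : SMul (B k Q)ᵐᵒᵖ (E1 k Q) :=
  ⟨fun b x => (⟨val k Q x * incl k Q b.unop, by
    simpa using SetLike.GradedMul.mul_mem (val_mem x) (incl_mem_grade k Q b.unop)⟩ :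
      gradeA k Q 1)⟩

variable {k Q}

@[simp] theorem val_smul (b : B k Q) (x : E1 k Q) : val k Q (b • x) = incl k Q b * val k Q x := rfl

@[simp] theorem val_op_smul (b : (B k Q)ᵐᵒᵖ) (x : E1 k Q) :
    val k Q (b • x) = val k Q x * incl k Q b.unop := rfl

instance : Module (B k Q) (E1 k Q) where
  one_smul := fun x => val_injective (by simp)
  mul_smul := fun b c x => val_injective (by simp [mul_assoc])
  smul_zero := fun b => val_injective (by simp)
  smul_add := fun b x y => val_injective (by simp [mul_add])
  add_smul := fun b c x => val_injective (by simp [add_mul])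
  zero_smul := fun x => val_injective (by simp)

instance : Module (B k Q)ᵐᵒᵖ (E1 k Q) where
  one_smul := fun x => val_injective (by simp)
  mul_smul := fun b c x => val_injective (by simp [mul_assoc])
  smul_zero := fun b => val_injective (by simp)
  smul_add := fun b x y => val_injective (by simp [add_mul])
  add_smul := fun b c x => val_injective (by simp [mul_add])
  zero_smul := fun x => val_injective (by simp)

instance : IsScalarTower k (B k Q) (E1 k Q) :=
  ⟨fun c b x => val_injective (by simp)⟩

instance : IsScalarTower k (B k Q)ᵐᵒᵖ (E1 k Q) :=
  ⟨fun c b x => val_injective (by simp)⟩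

instance : SMulCommClass (B k Q) (B k Q)ᵐᵒᵖ (E1 k Q) :=
  ⟨fun b c x => val_injective (by simp [mul_assoc])⟩

end E1

variable [Fintype E]

/-- The double Courant algebroid `D` on the bimodule `A¹` is the one given by the derived brackets
of the Hamiltonian `S`: its inner product is `⟨e, e'⟩ = ⦃e, e'⦄_ω`, its anchor is
`ρ(e)(b) = ⦃{S, e}_ω, b⦄_ω`, and its bracket is `⟦e, e'⟧ = ⦃{S, e}_ω, e'⦄_ω`. Elements of
tensor products of `B` and `A¹` are regarded as elements of `A ⊗ A`. -/
def IsDerivedFrom (D : DoubleCourantAlgebroid k (baseB k Q) (E1 k Q)) (S : A k Q) : Prop :=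
  (∀ e e' : E1 k Q, TensorProduct.map (incl k Q).toLinearMap (incl k Q).toLinearMap
    (D.pairing e e') = dbr k Q (E1.val k Q e) (E1.val k Q e')) ∧
  (∀ (e : E1 k Q) (b : B k Q), TensorProduct.map (incl k Q).toLinearMap (incl k Q).toLinearMap
    (D.anchor e b) = dbr k Q (br k Q S (E1.val k Q e)) (incl k Q b)) ∧
  (∀ e e' : E1 k Q, TensorProduct.map (E1.val k Q) (incl k Q).toLinearMap (D.brL e e') +
    TensorProduct.map (incl k Q).toLinearMap (E1.val k Q) (D.brR e e') =
      dbr k Q (br k Q S (E1.val k Q e)) (E1.val k Q e'))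

end PlainQuiver

/-! ### Koszul signs -/

/-! Let ∂_c be the double derivation with c ↦ e ⊗ e that kills the other arrows. In a path algebra
every dx expands as a sum over the arrows c of dc, with the factors of ∂_c x placed on its two
sides, and the coefficients can be read off again (`der_eq_sum`, `coeff`). As ω pairs each arrow c
with its reverse c*, the equation ι_Θ ω = dx is solved coefficient by coefficient: up to sign, Θ(c)
is the signed flip of ∂_{c*} x (`hamiltonian_iff`). This gives existence and uniqueness of
Hamiltonian double derivations and replaces the bracket of ω by the explicit bracket `Duality.brLin`
(`doubleBracket_canonicalForm`).

The explicit bracket is double Poisson. Its Jacobiator is a twisted derivation in the last argument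
(`jacobiator_mul`) and is compatible with signed rotation (`jacobiator_rotate`), so it vanishes once
it does on generators; there it does, because a bracket of two generators is a combination of
tensors of trivial paths, which every further bracket kills. Consequently {S, -} is a derivation of
the double bracket (`IsPoisson.assocTensor_br`), and 2{S, {S, -}} = {{S, S}, -} for S of odd weight
(`IsPoisson.two_assoc_assoc`). Moreover {-, z} vanishes on graded commutators, so in characteristic
0 it is enough that {S, S} be zero modulo commutators to have {S, {S, -}} = 0.

On the image of λ the operator {S₀, -} is the de Rham differential (`assoc_std_lam`), while {S₀, S₀}
= 0 and ⦃λφ, λφ⦄ = 0. Hence {S_φ, S_φ} is 2λ(dφ) modulo commutators. The morphism λ has a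
retraction, and both match form degree in Ω B with weight in A, so λ(dφ) is a sum of commutators
exactly when dφ is. The comparison of DR B with DR A is a similar retract argument.

The axioms of the double Courant algebroid follow from weights. Elements b, e, {S, e} have weights
0, 1, 2 and the bracket lowers the total weight by 2; hence ⦃e, e'⦄ and ⦃{S, e}, b⦄ lie in B ⊗ B,
⦃{S, e}, e'⦄ lies in A¹ ⊗ B ⊕ B ⊗ A¹, and brackets of negative weight vanish. Each axiom is a
component of the Leibniz rule, of skew symmetry, of the derivation property of {S, -}, or of the
double Jacobi identity; only the Jacobi axiom of the algebroid needs {S, {S, -}} = 0. The arrows â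
and â* are dual to each other under the pairing, which gives non-degeneracy, finite generation and
projectivity. -/

theorem neg_one_pow_eq_of_zmod {k : Type*} [Ring k] {m n : ℕ} (h : (m : ZMod 2) = n) :
    (-1 : k) ^ m = (-1) ^ n := by
  rw [neg_one_pow_eq_pow_mod_two, neg_one_pow_eq_pow_mod_two (n := n),
    (ZMod.natCast_eq_natCast_iff' m n 2).mp h]

theorem neg_one_pow_mul_self {k : Type*} [Ring k] (n : ℕ) : (-1 : k) ^ n * (-1) ^ n = 1 := by
  rw [← pow_add, Even.neg_one_pow ⟨n, rfl⟩]

/-- The bracket has even weight -2, so modulo 2 the weights of the two factors of ⦃x, y⦄ add up to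
|x| + |y|. With `neg_one_pow_eq_of_zmod` this turns each check of Koszul signs into a polynomial
identity over `ZMod 2`. -/
theorem zmod_two_of_weight {p q n : ℕ} {m : ℤ} (h : (p : ℤ) + q = m - 2) (hm : m = n) :
    (p : ZMod 2) + q = n := by
  subst hm
  have h2 : (2 : ZMod 2) = 0 := rfl
  have := congrArg (Int.cast : ℤ → ZMod 2) h
  push_cast at this
  rw [this, h2, sub_zero]

/-! ### Homogeneous tensors and signed permutations of tensor factors. -/

section Homogeneous

variable {k A : Type*} [Field k] [Ring A] [Algebra k A] (𝒜 : ℕ → Submodule k A)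
  [GradedAlgebra 𝒜] {M : Type*} [AddCommGroup M] [Module k M]

theorem linearMap_ext_homogeneous {f g : A →ₗ[k] M} (h : ∀ i, ∀ a ∈ 𝒜 i, f a = g a) : f = g := by
  ext a
  induction a using DirectSum.Decomposition.inductionOn 𝒜 with
  | zero => simp
  | add x y hx hy => simp [hx, hy]
  | homogeneous x => exact h _ x x.2

theorem tensor_ext_homogeneous {f g : A ⊗[k] A →ₗ[k] M}
    (h : ∀ i j, ∀ a ∈ 𝒜 i, ∀ b ∈ 𝒜 j, f (a ⊗ₜ b) = g (a ⊗ₜ b)) : f = g := by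
  refine TensorProduct.ext ?_
  refine linearMap_ext_homogeneous 𝒜 fun i a ha => linearMap_ext_homogeneous 𝒜 fun j b hb => ?_
  exact h i j a ha b hb

theorem tensor_ext_homogeneous₃ {f g : (A ⊗[k] A) ⊗[k] A →ₗ[k] M}
    (h : ∀ i j l, ∀ a ∈ 𝒜 i, ∀ b ∈ 𝒜 j, ∀ c ∈ 𝒜 l, f (a ⊗ₜ b ⊗ₜ c) = g (a ⊗ₜ b ⊗ₜ c)) : f = g := by
  refine TensorProduct.ext ?_
  refine tensor_ext_homogeneous 𝒜 fun i j a ha b hb => linearMap_ext_homogeneous 𝒜 fun l c hc => ?_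
  exact h i j l a ha b hb c hc

theorem tensorGrade_induction {n : ℤ} {motive : A ⊗[k] A → Prop} {t : A ⊗[k] A}
    (ht : t ∈ tensorGrade 𝒜 n) (zero : motive 0) (add : ∀ s t, motive s → motive t → motive (s + t))
    (smul : ∀ (c : k) t, motive t → motive (c • t))
    (tmul : ∀ i j : ℕ, (i : ℤ) + j = n → ∀ u ∈ 𝒜 i, ∀ v ∈ 𝒜 j, motive (u ⊗ₜ v)) : motive t := by
  induction ht using Submodule.span_induction with
  | zero => exact zero
  | add s t _ _ hs ht => exact add s t hs ht
  | smul c t _ ht => exact smul c t ht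
  | mem t ht =>
    obtain ⟨i, j, hij, u, hu, v, hv, rfl⟩ := ht
    exact tmul i j hij u hu v hv

/-- In contrast with `tensor_ext_homogeneous`, the weights of the two factors come with their sum,
which is the relation that sign computations inside a bracket need. -/
theorem eqOn_tensorGrade {n : ℤ} {f g : A ⊗[k] A →ₗ[k] M}
    (h : ∀ i j : ℕ, (i : ℤ) + j = n → ∀ u ∈ 𝒜 i, ∀ v ∈ 𝒜 j, f (u ⊗ₜ v) = g (u ⊗ₜ v))
    {t : A ⊗[k] A} (ht : t ∈ tensorGrade 𝒜 n) : f t = g t := by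
  refine tensorGrade_induction 𝒜 (motive := fun t => f t = g t) ht (by simp) ?_ ?_ h
  · intro s t hs ht
    simp [hs, ht]
  · intro c t ht
    simp [ht]

theorem tmul_mem_tensorGrade {i j : ℕ} {n : ℤ} {u v : A} (hu : u ∈ 𝒜 i) (hv : v ∈ 𝒜 j)
    (h : (i : ℤ) + j = n) : u ⊗ₜ[k] v ∈ tensorGrade 𝒜 n :=
  Submodule.subset_span ⟨i, j, h, u, hu, v, hv, rfl⟩

/-- The automorphism `a ↦ (-1)^(n|a|) a`. -/
def koszulAut (n : ℕ) : A →ₐ[k] A := signAut 𝒜 n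

theorem koszulAut_apply (n : ℕ) {i : ℕ} {a : A} (ha : a ∈ 𝒜 i) :
    koszulAut 𝒜 n a = (-1 : k) ^ (n * i) • a := by
  rw [koszulAut, signAut_apply 𝒜 n ha, ← Nat.cast_mul, parity_natCast]
  rcases Nat.even_or_odd (n * i) with h | h <;> simp [h.neg_one_pow]

theorem koszulAut_mem (n : ℕ) {i : ℕ} {a : A} (ha : a ∈ 𝒜 i) : koszulAut 𝒜 n a ∈ 𝒜 i := by
  rw [koszulAut_apply 𝒜 n ha]
  exact Submodule.smul_mem _ _ ha

theorem koszulAut_congr {m n : ℕ} (h : (m : ZMod 2) = n) (a : A) :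
    koszulAut 𝒜 m a = koszulAut 𝒜 n a := by
  suffices (koszulAut 𝒜 m).toLinearMap = (koszulAut 𝒜 n).toLinearMap from
    LinearMap.congr_fun this a
  refine linearMap_ext_homogeneous 𝒜 fun i a ha => ?_
  simp only [AlgHom.toLinearMap_apply, koszulAut_apply 𝒜 _ ha]
  rw [neg_one_pow_eq_of_zmod (m := m * i) (n := n * i) (by push_cast; rw [h])]

theorem koszulAut_koszulAut (m n : ℕ) (a : A) :
    koszulAut 𝒜 m (koszulAut 𝒜 n a) = koszulAut 𝒜 (m + n) a := by
  suffices (koszulAut 𝒜 m).toLinearMap ∘ₗ (koszulAut 𝒜 n).toLinearMap =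
      (koszulAut 𝒜 (m + n)).toLinearMap from LinearMap.congr_fun this a
  refine linearMap_ext_homogeneous 𝒜 fun i a ha => ?_
  simp only [LinearMap.comp_apply, AlgHom.toLinearMap_apply, koszulAut_apply 𝒜 _ ha, map_smul,
    smul_smul, add_mul, pow_add]
  rw [mul_comm]

theorem koszulAut_self (n : ℕ) (a : A) : koszulAut 𝒜 n (koszulAut 𝒜 n a) = a := by
  rw [koszulAut_koszulAut, koszulAut_congr 𝒜 (n := 0) (by
    push_cast; exact CharTwo.add_self_eq_zero _)]
  have : (koszulAut 𝒜 0).toLinearMap = LinearMap.id (R := k) := by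
    refine linearMap_ext_homogeneous 𝒜 fun i a ha => ?_
    simp [koszulAut_apply 𝒜 _ ha]
  exact LinearMap.congr_fun this a

theorem koszulAut_of_zero (n : ℕ) {a : A} (ha : a ∈ 𝒜 0) : koszulAut 𝒜 n a = a := by
  simp [koszulAut_apply 𝒜 n ha]

theorem koszulAut_zero (a : A) : koszulAut 𝒜 0 a = a := by
  have := koszulAut_self 𝒜 0 a
  rwa [koszulAut_koszulAut] at this

/-- The flip with Koszul signs, `u ⊗ v ↦ (-1)^(|u||v|) v ⊗ u`. -/
def koszulFlip : A ⊗[k] A →ₗ[k] A ⊗[k] A :=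
  TensorProduct.lift (Forms.ofHomogeneous 𝒜 fun i =>
    LinearMap.lcomp k _ (koszulAut 𝒜 i).toLinearMap ∘ₗ (TensorProduct.mk k A A).flip ∘ₗ
      (𝒜 i).subtype)

theorem koszulFlip_tmul' {i : ℕ} {u : A} (hu : u ∈ 𝒜 i) (v : A) :
    koszulFlip 𝒜 (u ⊗ₜ v) = koszulAut 𝒜 i v ⊗ₜ u := by
  rw [koszulFlip, TensorProduct.lift.tmul, Forms.ofHomogeneous_apply 𝒜 _ hu]
  rfl

theorem koszulFlip_tmul {i j : ℕ} {u v : A} (hu : u ∈ 𝒜 i) (hv : v ∈ 𝒜 j) :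
    koszulFlip 𝒜 (u ⊗ₜ v) = (-1 : k) ^ (i * j) • (v ⊗ₜ u) := by
  rw [koszulFlip_tmul' 𝒜 hu, koszulAut_apply 𝒜 i hv, TensorProduct.smul_tmul']

theorem koszulFlip_mem {n : ℤ} {t : A ⊗[k] A} (ht : t ∈ tensorGrade 𝒜 n) :
    koszulFlip 𝒜 t ∈ tensorGrade 𝒜 n := by
  refine tensorGrade_induction 𝒜 (motive := fun t => koszulFlip 𝒜 t ∈ tensorGrade 𝒜 n) ht
    (by simp) ?_ ?_ ?_
  · intro s t hs ht
    rw [map_add]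
    exact add_mem hs ht
  · intro c t ht
    rw [map_smul]
    exact Submodule.smul_mem _ _ ht
  · intro i j hij u hu v hv
    rw [koszulFlip_tmul 𝒜 hu hv]
    exact Submodule.smul_mem _ _ (tmul_mem_tensorGrade 𝒜 hv hu (by omega))

/-- The cyclic permutation with Koszul signs, `(a ⊗ b) ⊗ c ↦ ± (c ⊗ a) ⊗ b`. -/
def koszulRotate : (A ⊗[k] A) ⊗[k] A →ₗ[k] (A ⊗[k] A) ⊗[k] A :=
  (koszulFlip 𝒜).rTensor A ∘ₗ (TensorProduct.assoc k A A A).symm.toLinearMap ∘ₗ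
    (koszulFlip 𝒜).lTensor A ∘ₗ (TensorProduct.assoc k A A A).toLinearMap

theorem koszulRotate_tmul {i j l : ℕ} {a b c : A} (ha : a ∈ 𝒜 i) (hb : b ∈ 𝒜 j) (hc : c ∈ 𝒜 l) :
    koszulRotate 𝒜 (a ⊗ₜ b ⊗ₜ c) = (-1 : k) ^ (l * (i + j)) • (c ⊗ₜ a ⊗ₜ b) := by
  simp only [koszulRotate, LinearMap.comp_apply, LinearEquiv.coe_coe, TensorProduct.assoc_tmul,
    LinearMap.lTensor_tmul, koszulFlip_tmul 𝒜 hb hc, TensorProduct.tmul_smul, map_smul,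
    TensorProduct.assoc_symm_tmul, LinearMap.rTensor_tmul, koszulFlip_tmul 𝒜 ha hc,
    ← TensorProduct.smul_tmul', smul_smul, ← pow_add]
  congr 2
  ring

/-- In the course of three turns each pair of factors is exchanged exactly twice, so all signs
cancel. -/
theorem koszulRotate_three (t : (A ⊗[k] A) ⊗[k] A) :
    koszulRotate 𝒜 (koszulRotate 𝒜 (koszulRotate 𝒜 t)) = t := by
  suffices koszulRotate 𝒜 ∘ₗ koszulRotate 𝒜 ∘ₗ koszulRotate 𝒜 = LinearMap.id from
    LinearMap.congr_fun this t
  refine tensor_ext_homogeneous₃ 𝒜 fun i j l a ha b hb c hc => ?_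
  simp only [LinearMap.comp_apply, koszulRotate_tmul 𝒜 ha hb hc, map_smul,
    koszulRotate_tmul 𝒜 hc ha hb, koszulRotate_tmul 𝒜 hb hc ha, smul_smul, ← pow_add,
    LinearMap.id_apply]
  rw [Even.neg_one_pow ⟨i * j + j * l + i * l, by ring⟩, one_smul]

end Homogeneous

/-! ### Graded double brackets -/

/-- A graded skew-symmetric double bracket of weight `-2`. -/
structure GradedDoubleBracket {k A : Type*} [Field k] [Ring A] [Algebra k A]
    (𝒜 : ℕ → Submodule k A) [GradedAlgebra 𝒜] where
  br : A →ₗ[k] A →ₗ[k] A ⊗[k] A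
  leibniz : ∀ {i : ℕ} {x : A}, x ∈ 𝒜 i → ∀ y z : A,
    br x (y * z) = br x y * (1 ⊗ₜ z) + (koszulAut 𝒜 i y ⊗ₜ 1) * br x z
  skew : ∀ {i j : ℕ} {x y : A}, x ∈ 𝒜 i → y ∈ 𝒜 j →
    br x y = -((-1 : k) ^ (i * j) • koszulFlip 𝒜 (br y x))
  weight : ∀ {i j : ℕ} {x y : A}, x ∈ 𝒜 i → y ∈ 𝒜 j → br x y ∈ tensorGrade 𝒜 ((i : ℤ) + j - 2)

namespace GradedDoubleBracket

variable {k A : Type*} [Field k] [Ring A] [Algebra k A] {𝒜 : ℕ → Submodule k A}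
  [GradedAlgebra 𝒜] (D : GradedDoubleBracket 𝒜)

/-- The element `1 ⊗ u ⊗ v`. -/
def ofRight (k A : Type*) [Field k] [Ring A] [Algebra k A] :
    A ⊗[k] A →ₗ[k] (A ⊗[k] A) ⊗[k] A :=
  (TensorProduct.assoc k A A A).symm.toLinearMap ∘ₗ TensorProduct.mk k A (A ⊗[k] A) 1

@[simp] theorem ofRight_tmul (u v : A) : ofRight k A (u ⊗ₜ v) = 1 ⊗ₜ u ⊗ₜ v := rfl

/-- The map `u ⊗ v ↦ ⦃x, u⦄ ⊗ v`. -/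
def actL (x : A) : A ⊗[k] A →ₗ[k] (A ⊗[k] A) ⊗[k] A := (D.br x).rTensor A

/-- The map `u ⊗ v ↦ (-1)^(j|u|) u ⊗ ⦃x, v⦄`. -/
def actR (j : ℕ) (x : A) : A ⊗[k] A →ₗ[k] (A ⊗[k] A) ⊗[k] A :=
  (TensorProduct.assoc k A A A).symm.toLinearMap ∘ₗ
    TensorProduct.map (koszulAut 𝒜 j).toLinearMap (D.br x)

@[simp] theorem actL_tmul (x u v : A) : D.actL x (u ⊗ₜ v) = D.br x u ⊗ₜ v := rfl

/-- Written as a product in the algebra `A ⊗ A ⊗ A`, the operation can be expanded by ring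
arithmetic in the Leibniz computations. -/
theorem actR_tmul (j : ℕ) (x u v : A) : D.actR j x (u ⊗ₜ v) =
    (koszulAut 𝒜 j u ⊗ₜ 1 ⊗ₜ 1) * ofRight k A (D.br x v) := by
  rw [actR, LinearMap.comp_apply, TensorProduct.map_tmul]
  induction D.br x v using TensorProduct.induction_on with
  | zero => simp
  | add s t hs ht => simp only [TensorProduct.tmul_add, map_add, hs, ht, mul_add]
  | tmul p q => simp

/-- The map `w ⊗ v ↦ w ⊗₁ v` on elements `w` of `A ⊗ A`. -/
def insert (k A : Type*) [Field k] [Ring A] [Algebra k A] :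
    (A ⊗[k] A) ⊗[k] A →ₗ[k] (A ⊗[k] A) ⊗[k] A :=
  (TensorProduct.rightComm k A A A).toLinearMap

@[simp] theorem insert_tmul (p q v : A) : insert k A (p ⊗ₜ q ⊗ₜ v) = p ⊗ₜ v ⊗ₜ q := rfl

/-- The bracket `⦃u, z⦄ ⊗₁ v` with the Koszul signs of moving `v`, of weight `q`, to the left. -/
def nested (q : ℕ) (u v : A) : A →ₗ[k] (A ⊗[k] A) ⊗[k] A :=
  insert k A ∘ₗ (TensorProduct.mk k (A ⊗[k] A) A).flip v ∘ₗ
    (koszulAut 𝒜 q).toLinearMap.lTensor A ∘ₗ D.br u ∘ₗ (koszulAut 𝒜 q).toLinearMap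

theorem nested_apply (q : ℕ) (u v z : A) : D.nested q u v z =
    insert k A (((koszulAut 𝒜 q).toLinearMap.lTensor A (D.br u (koszulAut 𝒜 q z))) ⊗ₜ v) := rfl

/-- The operation `u ⊗ v ↦ ⦃u ⊗ v, -⦄_L`. -/
def actNested : A ⊗[k] A →ₗ[k] A →ₗ[k] (A ⊗[k] A) ⊗[k] A :=
  TensorProduct.lift (Forms.ofHomogeneous 𝒜 fun q =>
    LinearMap.mk₂ k (fun (v : 𝒜 q) u => D.nested q u v)
      (fun v v' u => by ext z; simp [nested_apply, TensorProduct.tmul_add])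
      (fun c v u => by ext z; simp [nested_apply])
      (fun v u u' => by ext z; simp [nested_apply, TensorProduct.add_tmul])
      (fun c v u => by ext z; simp [nested_apply, ← TensorProduct.smul_tmul'])).flip

theorem actNested_tmul (u : A) {v : A} {q : ℕ} (hv : v ∈ 𝒜 q) :
    D.actNested (u ⊗ₜ v) = D.nested q u v := by
  rw [actNested, TensorProduct.lift.tmul, LinearMap.flip_apply, Forms.ofHomogeneous_apply 𝒜 _ hv]
  rfl

theorem br_one {i : ℕ} {x : A} (hx : x ∈ 𝒜 i) : D.br x 1 = 0 := by
  have h := D.leibniz hx 1 1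
  rw [mul_one, map_one (koszulAut 𝒜 i), ← Algebra.TensorProduct.one_def, mul_one, one_mul] at h
  simpa using h

theorem actL_mul_one (x w : A) (t : A ⊗[k] A) :
    D.actL x (t * (1 ⊗ₜ w)) = D.actL x t * (1 ⊗ₜ w) := by
  induction t using TensorProduct.induction_on with
  | zero => simp
  | add s t hs ht => simp only [add_mul, map_add, hs, ht]
  | tmul u v => simp

/-- The first summand is a cross term. It has to cancel, in `jacobiator_mul`, against the cross term
of `actR_mul_one`. -/
theorem actL_mul {i : ℕ} {x : A} (hx : x ∈ 𝒜 i) (y : A) (t : A ⊗[k] A) :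
    D.actL x ((y ⊗ₜ 1) * t) =
      (D.br x y ⊗ₜ 1) * ofRight k A t + (koszulAut 𝒜 i y ⊗ₜ 1 ⊗ₜ 1) * D.actL x t := by
  induction t using TensorProduct.induction_on with
  | zero => simp
  | add s t hs ht => simp only [mul_add, map_add, hs, ht]; abel
  | tmul u v =>
    simp only [Algebra.TensorProduct.tmul_mul_tmul, one_mul, actL_tmul, D.leibniz hx,
      TensorProduct.add_tmul, ofRight_tmul]

theorem ofRight_mul (s t : A ⊗[k] A) : ofRight k A (s * t) = ofRight k A s * ofRight k A t := by
  induction s using TensorProduct.induction_on with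
  | zero => simp
  | add s s' hs hs' => simp only [add_mul, map_add, hs, hs']
  | tmul u v =>
    induction t using TensorProduct.induction_on with
    | zero => simp
    | add s t hs ht => simp only [mul_add, map_add, hs, ht]
    | tmul p q => simp

theorem actR_mul_one {j : ℕ} {y : A} (hy : y ∈ 𝒜 j) (w : A) (t : A ⊗[k] A) :
    D.actR j y (t * (1 ⊗ₜ w)) = D.actR j y t * (1 ⊗ₜ w) +
      (TensorProduct.map (koszulAut 𝒜 j).toLinearMap (koszulAut 𝒜 j).toLinearMap t ⊗ₜ 1) *
        ofRight k A (D.br y w) := by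
  induction t using TensorProduct.induction_on with
  | zero => simp
  | add s t hs ht => simp only [add_mul, map_add, hs, ht, TensorProduct.add_tmul]; abel
  | tmul u v =>
    simp only [Algebra.TensorProduct.tmul_mul_tmul, mul_one, actR_tmul, D.leibniz hy, map_add,
      mul_add, ofRight_mul, ofRight_tmul, TensorProduct.map_tmul, AlgHom.toLinearMap_apply,
      ← mul_assoc, one_mul]
    rfl

theorem actR_mul (j : ℕ) (y z : A) (t : A ⊗[k] A) : D.actR j y ((z ⊗ₜ 1) * t) =
    (koszulAut 𝒜 j z ⊗ₜ 1 ⊗ₜ 1) * D.actR j y t := by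
  induction t using TensorProduct.induction_on with
  | zero => simp
  | add s t hs ht => simp only [mul_add, map_add, hs, ht]
  | tmul u v =>
    simp only [Algebra.TensorProduct.tmul_mul_tmul, actR_tmul, ← mul_assoc, one_mul, map_mul]

/-- The sign automorphism of v is applied to the argument and again to the second factor of the
result. On w the two applications cancel; on z the first one combines with the sign of u to give the
weight p + q. -/
theorem nested_mul {p q : ℕ} {u : A} (hu : u ∈ 𝒜 p) (v z w : A) :
    D.nested q u v (z * w) =
      D.nested q u v z * (1 ⊗ₜ w) + (koszulAut 𝒜 (p + q) z ⊗ₜ 1 ⊗ₜ 1) * D.nested q u v w := by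
  simp only [nested_apply, map_mul, D.leibniz hu, map_add, TensorProduct.add_tmul,
    koszulAut_koszulAut]
  congr 1
  · generalize D.br u (koszulAut 𝒜 q z) = t
    induction t using TensorProduct.induction_on with
    | zero => simp
    | add s t hs ht => simp only [add_mul, map_add, hs, ht, TensorProduct.add_tmul]
    | tmul a b => simp [koszulAut_self]
  · generalize D.br u (koszulAut 𝒜 q w) = t
    induction t using TensorProduct.induction_on with
    | zero => simp
    | add s t hs ht => simp only [mul_add, map_add, hs, ht, TensorProduct.add_tmul]
    | tmul a b => simp

/-- All summands u ⊗ v of a homogeneous tensor have the same total weight, so the twists of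
`nested_mul` agree, and only the parity of that weight matters. -/
theorem actNested_mul {n : ℤ} {m : ℕ} (hm : ∀ p q : ℕ, (p : ℤ) + q = n → (p + q : ZMod 2) = m)
    {t : A ⊗[k] A} (ht : t ∈ tensorGrade 𝒜 n) (z w : A) :
    D.actNested t (z * w) =
      D.actNested t z * (1 ⊗ₜ w) + (koszulAut 𝒜 m z ⊗ₜ 1 ⊗ₜ 1) * D.actNested t w := by
  refine tensorGrade_induction 𝒜 (motive := fun t => D.actNested t (z * w) =
      D.actNested t z * (1 ⊗ₜ w) + (koszulAut 𝒜 m z ⊗ₜ 1 ⊗ₜ 1) * D.actNested t w) ht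
    (by simp) ?_ ?_ ?_
  · intro s t hs ht
    simp only [map_add, LinearMap.add_apply, hs, ht, add_mul, mul_add]
    abel
  · intro c t ht
    simp only [map_smul, LinearMap.smul_apply, ht, smul_add, smul_mul_assoc, mul_smul_comm]
  · intro p q hpq u hu v hv
    rw [actNested_tmul D u hv, nested_mul D hu,
      koszulAut_congr 𝒜 (m := p + q) (n := m) (by push_cast; exact hm p q hpq)]

/-- The double Jacobiator of `x`, `y` of weights `i`, `j`. -/
def jacobiator (i j : ℕ) (x y : A) : A →ₗ[k] (A ⊗[k] A) ⊗[k] A :=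
  D.actL x ∘ₗ D.br y - (-1 : k) ^ (i * j) • D.actR j y ∘ₗ D.br x - D.actNested (D.br x y)

theorem jacobiator_apply (i j : ℕ) (x y z : A) : D.jacobiator i j x y z =
    D.actL x (D.br y z) - (-1 : k) ^ (i * j) • D.actR j y (D.br x z) -
      D.actNested (D.br x y) z := rfl

/-- The sign automorphism acts on ⦃x, z⦄ through its total weight |x| + |z| - 2, which has the
parity of |x| + |z|. -/
theorem map_koszulAut_br {i : ℕ} {x : A} (hx : x ∈ 𝒜 i) (j : ℕ) (z : A) :
    TensorProduct.map (koszulAut 𝒜 j).toLinearMap (koszulAut 𝒜 j).toLinearMap (D.br x z) =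
      (-1 : k) ^ (i * j) • D.br x (koszulAut 𝒜 j z) := by
  suffices TensorProduct.map (koszulAut 𝒜 j).toLinearMap (koszulAut 𝒜 j).toLinearMap ∘ₗ D.br x =
      (-1 : k) ^ (i * j) • (D.br x ∘ₗ (koszulAut 𝒜 j).toLinearMap) from LinearMap.congr_fun this z
  refine linearMap_ext_homogeneous 𝒜 fun l z hz => ?_
  simp only [LinearMap.comp_apply, LinearMap.smul_apply, AlgHom.toLinearMap_apply,
    koszulAut_apply 𝒜 j hz, map_smul, smul_smul, ← pow_add]
  refine eqOn_tensorGrade 𝒜 (g := (-1 : k) ^ (i * j + j * l) • LinearMap.id) ?_ (D.weight hx hz)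
  intro p q hpq u hu v hv
  simp only [TensorProduct.map_tmul, AlgHom.toLinearMap_apply, koszulAut_apply 𝒜 j hu,
    koszulAut_apply 𝒜 j hv, ← TensorProduct.smul_tmul', TensorProduct.tmul_smul, smul_smul,
    ← pow_add, LinearMap.smul_apply, LinearMap.id_apply]
  rw [neg_one_pow_eq_of_zmod]
  have := zmod_two_of_weight (n := i + l) hpq (by simp)
  push_cast at this ⊢
  linear_combination (j : ZMod 2) * this

/-- Each of the three terms is a twisted derivation in the last argument up to cross terms. The
cross terms of the first two are ⦃x, z⦄ times ⦃y, w⦄, equal by `map_koszulAut_br`, and cancel. -/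
theorem jacobiator_mul {i j : ℕ} {x y : A} (hx : x ∈ 𝒜 i) (hy : y ∈ 𝒜 j) (z w : A) :
    D.jacobiator i j x y (z * w) = D.jacobiator i j x y z * (1 ⊗ₜ w) +
      (koszulAut 𝒜 (i + j) z ⊗ₜ 1 ⊗ₜ 1) * D.jacobiator i j x y w := by
  have h := D.actNested_mul (m := i + j) (fun p q h => zmod_two_of_weight h (by simp))
    (D.weight hx hy) z w
  simp only [jacobiator_apply, D.leibniz hx, D.leibniz hy, map_add, actL_mul_one, actL_mul D hx,
    actR_mul_one D hy, actR_mul, h, map_koszulAut_br D hx, koszulAut_koszulAut, sub_mul, mul_sub,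
    smul_add, smul_mul_assoc, mul_smul_comm, ← TensorProduct.smul_tmul', smul_smul,
    neg_one_pow_mul_self, one_smul, add_comm j i]
  abel

end GradedDoubleBracket

/-! ### Cyclic symmetry of the double Jacobiator. -/

namespace GradedDoubleBracket

variable {k A : Type*} [Field k] [Ring A] [Algebra k A] {𝒜 : ℕ → Submodule k A}
  [GradedAlgebra 𝒜] (D : GradedDoubleBracket 𝒜)

/-- A bracket applied to the second factor is one applied to the first, seen after a flip and a
rotation. This and `rotate_rotate_actL` express the whole Jacobiator by `actL`. -/
theorem rotate_actL_flip {j : ℕ} {y : A} (hy : y ∈ 𝒜 j) (t : A ⊗[k] A) :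
    koszulRotate 𝒜 (D.actL y (koszulFlip 𝒜 t)) = D.actR j y t := by
  suffices koszulRotate 𝒜 ∘ₗ D.actL y ∘ₗ koszulFlip 𝒜 = D.actR j y from LinearMap.congr_fun this t
  refine tensor_ext_homogeneous 𝒜 fun p q u hu v hv => ?_
  rw [LinearMap.comp_apply, LinearMap.comp_apply, koszulFlip_tmul 𝒜 hu hv, map_smul, actL_tmul,
    actR, LinearMap.comp_apply, TensorProduct.map_tmul, AlgHom.toLinearMap_apply,
    koszulAut_apply 𝒜 _ hu, ← TensorProduct.smul_tmul', map_smul, map_smul]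
  refine eqOn_tensorGrade 𝒜 (t := D.br y v)
    (f := (-1 : k) ^ (p * q) • koszulRotate 𝒜 ∘ₗ (TensorProduct.mk k _ A).flip u)
    (g := (-1 : k) ^ (j * p) • (TensorProduct.assoc k A A A).symm.toLinearMap ∘ₗ
      TensorProduct.mk k A _ u) ?_ (D.weight hy hv)
  intro a b hab w hw x hx
  have h := zmod_two_of_weight (n := j + q) hab (by simp)
  change (-1 : k) ^ (p * q) • koszulRotate 𝒜 (w ⊗ₜ x ⊗ₜ u) = (-1 : k) ^ (j * p) • (u ⊗ₜ w ⊗ₜ x)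
  rw [koszulRotate_tmul 𝒜 hw hx hu, smul_smul, ← pow_add]
  rw [neg_one_pow_eq_of_zmod]
  push_cast at h ⊢
  -- What remains is an identity between parities under the weight constraint `h`, settled by
  -- running over all values.
  generalize (a : ZMod 2) = a at *
  generalize (b : ZMod 2) = b at *
  generalize (j : ZMod 2) = j at *
  generalize (p : ZMod 2) = p at *
  generalize (q : ZMod 2) = q at *
  revert h
  revert a b j p q
  decide

/-- Skew symmetry replaces ⦃z, u⦄ by the flip of ⦃u, z⦄, and two rotations then put v between its
factors. -/
theorem rotate_rotate_actL {p q l : ℕ} {u v z : A} (hu : u ∈ 𝒜 p) (hv : v ∈ 𝒜 q) (hz : z ∈ 𝒜 l) :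
    koszulRotate 𝒜 (koszulRotate 𝒜 (D.actL z (u ⊗ₜ v))) =
      -((-1 : k) ^ (l * (p + q)) • D.nested q u v z) := by
  rw [actL_tmul, D.skew hz hu, nested_apply, koszulAut_apply 𝒜 q hz]
  simp only [map_smul, TensorProduct.neg_tmul, ← TensorProduct.smul_tmul', map_neg]
  congr 1
  rw [smul_smul]
  refine eqOn_tensorGrade 𝒜 (t := D.br u z)
    (f := (-1 : k) ^ (l * p) • koszulRotate 𝒜 ∘ₗ koszulRotate 𝒜 ∘ₗ
      (TensorProduct.mk k _ A).flip v ∘ₗ koszulFlip 𝒜)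
    (g := ((-1 : k) ^ (l * (p + q)) * (-1 : k) ^ (q * l)) • insert k A ∘ₗ
      (TensorProduct.mk k _ A).flip v ∘ₗ (koszulAut 𝒜 q).toLinearMap.lTensor A) ?_ (D.weight hu hz)
  intro a b hab w hw x hx
  have h := zmod_two_of_weight (n := p + l) hab (by simp)
  simp only [LinearMap.comp_apply, LinearMap.smul_apply, LinearMap.flip_apply,
    TensorProduct.mk_apply, koszulFlip_tmul 𝒜 hw hx, LinearMap.lTensor_tmul,
    AlgHom.toLinearMap_apply, koszulAut_apply 𝒜 q hx, TensorProduct.tmul_smul, map_smul, insert_tmul, koszulRotate_tmul 𝒜 hx hw hv,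
    koszulRotate_tmul 𝒜 hv hx hw, smul_smul, ← pow_add]
  rw [neg_one_pow_eq_of_zmod]
  push_cast at h ⊢
  generalize (a : ZMod 2) = a at *
  generalize (b : ZMod 2) = b at *
  generalize (l : ZMod 2) = l at *
  generalize (p : ZMod 2) = p at *
  generalize (q : ZMod 2) = q at *
  revert h
  revert a b l p q
  decide

theorem actNested_eq {i j l : ℕ} {x y z : A} (hx : x ∈ 𝒜 i) (hy : y ∈ 𝒜 j) (hz : z ∈ 𝒜 l) :
    D.actNested (D.br x y) z = -((-1 : k) ^ (l * (i + j)) •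
      koszulRotate 𝒜 (koszulRotate 𝒜 (D.actL z (D.br x y)))) := by
  refine eqOn_tensorGrade 𝒜 (f := D.actNested.flip z) (g := -((-1 : k) ^ (l * (i + j)) •
      (koszulRotate 𝒜 ∘ₗ koszulRotate 𝒜 ∘ₗ D.actL z))) ?_ (D.weight hx hy)
  intro p q hpq u hu v hv
  have h := zmod_two_of_weight (n := i + j) hpq (by simp)
  rw [LinearMap.flip_apply, actNested_tmul D u hv, LinearMap.neg_apply, LinearMap.smul_apply,
    LinearMap.comp_apply, LinearMap.comp_apply, rotate_rotate_actL D hu hv hz, smul_neg, neg_neg,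
    neg_one_pow_eq_of_zmod (m := l * (p + q)) (n := l * (i + j)), smul_smul, neg_one_pow_mul_self,
    one_smul]
  push_cast at h ⊢
  rw [h]

theorem actR_eq {i j l : ℕ} {x y z : A} (hx : x ∈ 𝒜 i) (hy : y ∈ 𝒜 j) (hz : z ∈ 𝒜 l) :
    D.actR j y (D.br x z) = -((-1 : k) ^ (i * l) • koszulRotate 𝒜 (D.actL y (D.br z x))) := by
  rw [D.skew hz hx, map_neg, map_neg, map_smul, map_smul, rotate_actL_flip D hy, smul_neg, neg_neg,
    smul_smul, mul_comm l, neg_one_pow_mul_self, one_smul]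

/-- Skew symmetry brings the Jacobiator to a signed sum over cyclic permutations, the form in which
its symmetry is visible. -/
theorem jacobiator_eq {i j l : ℕ} {x y z : A} (hx : x ∈ 𝒜 i) (hy : y ∈ 𝒜 j) (hz : z ∈ 𝒜 l) :
    D.jacobiator i j x y z = D.actL x (D.br y z) +
      (-1 : k) ^ (i * (j + l)) • koszulRotate 𝒜 (D.actL y (D.br z x)) +
      (-1 : k) ^ (l * (i + j)) • koszulRotate 𝒜 (koszulRotate 𝒜 (D.actL z (D.br x y))) := by
  rw [jacobiator_apply, D.actNested_eq hx hy hz, D.actR_eq hx hy hz, smul_neg, smul_smul, ← pow_add,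
    mul_add i]
  abel

/-- Rotation has order three and permutes the three summands of `jacobiator_eq`; the signs agree by
a parity check. -/
theorem jacobiator_rotate {i j l : ℕ} {x y z : A} (hx : x ∈ 𝒜 i) (hy : y ∈ 𝒜 j) (hz : z ∈ 𝒜 l) :
    D.jacobiator i j x y z =
      (-1 : k) ^ (i * (j + l)) • koszulRotate 𝒜 (D.jacobiator j l y z x) := by
  rw [D.jacobiator_eq hx hy hz, D.jacobiator_eq hy hz hx]
  simp only [map_add, map_smul, koszulRotate_three, smul_add, smul_smul, ← pow_add]
  rw [Even.neg_one_pow (n := i * (j + l) + i * (j + l)) ⟨_, rfl⟩, one_smul,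
    neg_one_pow_eq_of_zmod (m := i * (j + l) + j * (l + i)) (n := l * (i + j))]
  · abel
  · push_cast
    generalize (i : ZMod 2) = i
    generalize (j : ZMod 2) = j
    generalize (l : ZMod 2) = l
    revert i j l
    decide

/-- The double Jacobi identity. -/
def IsPoisson : Prop :=
  ∀ {i j : ℕ} {x y : A}, x ∈ 𝒜 i → y ∈ 𝒜 j → D.jacobiator i j x y = 0

/-- The double Jacobi identity holds if it holds on homogeneous generators. -/
theorem isPoisson_of_generators {X : Type*} (gen : X → A) (deg : X → ℕ)
    (hgen : ∀ x, gen x ∈ 𝒜 (deg x))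
    (hind : ∀ F : A →ₗ[k] (A ⊗[k] A) ⊗[k] A, (∀ x, F (gen x) = 0) → F 1 = 0 →
      (∀ x y, F x = 0 → F y = 0 → F (x * y) = 0) → F = 0)
    (h : ∀ x y z, D.jacobiator (deg x) (deg y) (gen x) (gen y) (gen z) = 0) : D.IsPoisson := by
  -- By the twisted Leibniz rule, the arguments z on which the Jacobiator vanishes are closed under
  -- products.
  have key : ∀ {i j : ℕ} {x y : A}, x ∈ 𝒜 i → y ∈ 𝒜 j →
      (∀ z, D.jacobiator i j x y (gen z) = 0) → D.jacobiator i j x y = 0 := by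
    intro i j x y hx hy hz
    have hmul := D.jacobiator_mul hx hy
    refine hind _ hz ?_ ?_
    · have := hmul 1 1
      rw [mul_one, map_one (koszulAut 𝒜 (i + j)), ← Algebra.TensorProduct.one_def,
        ← Algebra.TensorProduct.one_def, ← Algebra.TensorProduct.one_def, mul_one, one_mul] at this
      simpa using this
    · intro z w hz hw
      rw [hmul, hz, hw, zero_mul, mul_zero, add_zero]
  have h1 : ∀ x y, D.jacobiator (deg x) (deg y) (gen x) (gen y) = 0 := fun x y =>
    key (hgen x) (hgen y) (h x y)
  -- Only the last argument can be made general directly; rotation brings the other two into that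
  -- position in turn.
  have h2 : ∀ {i : ℕ} {x : A}, x ∈ 𝒜 i → ∀ y, D.jacobiator i (deg y) x (gen y) = 0 := by
    intro i x hx y
    refine key hx (hgen y) fun z => ?_
    rw [D.jacobiator_rotate hx (hgen y) (hgen z), h1]
    simp
  intro i j x y hx hy
  refine key hx hy fun z => ?_
  rw [D.jacobiator_rotate hx hy (hgen z), h2 hy]
  simp

end GradedDoubleBracket

/-! ### Multiplication, signed flips and graded commutators. -/

theorem two_eq_zero_zmod_two : (2 : ZMod 2) = 0 := rfl

section

variable {k A : Type*} [Field k] [Ring A] [Algebra k A] (𝒜 : ℕ → Submodule k A)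
  [GradedAlgebra 𝒜]

/-- Conjugation by the signed flip exchanges outer and inner multiplication, at the cost of the sign
of moving y past one factor. Together with `koszulFlip_mul_flip` it transports the Leibniz rule to
the first argument of a bracket. -/
theorem koszulFlip_flip_mul {j : ℕ} {y : A} (hy : y ∈ 𝒜 j) (t : A ⊗[k] A) :
    koszulFlip 𝒜 (koszulFlip 𝒜 t * (1 ⊗ₜ y)) =
      (koszulAut 𝒜 j).toLinearMap.lTensor A t * (y ⊗ₜ 1) := by
  suffices koszulFlip 𝒜 ∘ₗ LinearMap.mulRight k (1 ⊗ₜ y) ∘ₗ koszulFlip 𝒜 =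
    LinearMap.mulRight k (y ⊗ₜ 1) ∘ₗ (koszulAut 𝒜 j).toLinearMap.lTensor A from
      LinearMap.congr_fun this t
  refine tensor_ext_homogeneous 𝒜 fun p q u hu v hv => ?_
  simp only [LinearMap.comp_apply, koszulFlip_tmul 𝒜 hu hv, map_smul, LinearMap.mulRight_apply,
    Algebra.TensorProduct.tmul_mul_tmul, mul_one, LinearMap.lTensor_tmul,
    koszulFlip_tmul 𝒜 hv (SetLike.GradedMul.mul_mem hu hy), AlgHom.toLinearMap_apply,
    koszulAut_apply 𝒜 j hv, TensorProduct.tmul_smul, smul_smul, ← pow_add]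
  rw [neg_one_pow_eq_of_zmod]
  push_cast
  linear_combination (p * q : ZMod 2) * two_eq_zero_zmod_two

theorem koszulFlip_mul_flip {i : ℕ} {x : A} (hx : x ∈ 𝒜 i) (t : A ⊗[k] A) :
    koszulFlip 𝒜 ((x ⊗ₜ 1) * koszulFlip 𝒜 t) =
      (1 ⊗ₜ x) * (koszulAut 𝒜 i).toLinearMap.rTensor A t := by
  suffices koszulFlip 𝒜 ∘ₗ LinearMap.mulLeft k (x ⊗ₜ 1) ∘ₗ koszulFlip 𝒜 =
    LinearMap.mulLeft k (1 ⊗ₜ x) ∘ₗ (koszulAut 𝒜 i).toLinearMap.rTensor A from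
      LinearMap.congr_fun this t
  refine tensor_ext_homogeneous 𝒜 fun p q u hu v hv => ?_
  simp only [LinearMap.comp_apply, koszulFlip_tmul 𝒜 hu hv, map_smul, LinearMap.mulLeft_apply,
    Algebra.TensorProduct.tmul_mul_tmul, one_mul, LinearMap.rTensor_tmul,
    koszulFlip_tmul 𝒜 (SetLike.GradedMul.mul_mem hx hv) hu, AlgHom.toLinearMap_apply,
    koszulAut_apply 𝒜 i hu, ← TensorProduct.smul_tmul', smul_smul, ← pow_add]
  rw [neg_one_pow_eq_of_zmod]
  push_cast
  linear_combination (p * q : ZMod 2) * two_eq_zero_zmod_two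

theorem mul'_mul_one (t : A ⊗[k] A) (z : A) :
    LinearMap.mul' k A (t * (1 ⊗ₜ z)) = LinearMap.mul' k A t * z := by
  induction t using TensorProduct.induction_on with
  | zero => simp
  | add s t hs ht => simp only [add_mul, map_add, hs, ht]
  | tmul u v => simp [mul_assoc]

theorem mul'_one_mul (t : A ⊗[k] A) (z : A) :
    LinearMap.mul' k A ((z ⊗ₜ 1) * t) = z * LinearMap.mul' k A t := by
  induction t using TensorProduct.induction_on with
  | zero => simp
  | add s t hs ht => simp only [mul_add, map_add, hs, ht]
  | tmul u v => simp [mul_assoc]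

theorem mul'_mem {n : ℤ} {m : ℕ} (h : n = m) {t : A ⊗[k] A} (ht : t ∈ tensorGrade 𝒜 n) :
    LinearMap.mul' k A t ∈ 𝒜 m := by
  refine tensorGrade_induction 𝒜 (motive := fun t => LinearMap.mul' k A t ∈ 𝒜 m) ht
    (by simp) ?_ ?_ ?_
  · intro s t hs ht
    rw [map_add]
    exact add_mem hs ht
  · intro c t ht
    rw [map_smul]
    exact Submodule.smul_mem _ _ ht
  · intro i j hij u hu v hv
    obtain rfl : i + j = m := by omega
    exact SetLike.GradedMul.mul_mem hu hv

/-- The span of the graded commutators of an algebra. -/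
def gradedCommutators : Submodule k A :=
  Submodule.span k {x | ∃ i j, ∃ a ∈ 𝒜 i, ∃ b ∈ 𝒜 j, a * b - (-1 : k) ^ (i * j) • (b * a) = x}

/-- With skew symmetry this compares {x, y} with {y, x} modulo commutators. -/
theorem mul'_koszulFlip_sub_mem (t : A ⊗[k] A) :
    LinearMap.mul' k A t - LinearMap.mul' k A (koszulFlip 𝒜 t) ∈ gradedCommutators 𝒜 := by
  suffices (gradedCommutators 𝒜).mkQ ∘ₗ (LinearMap.mul' k A - LinearMap.mul' k A ∘ₗ koszulFlip 𝒜) =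
      0 from (Submodule.Quotient.mk_eq_zero _).mp (LinearMap.congr_fun this t)
  refine tensor_ext_homogeneous 𝒜 fun p q u hu v hv => ?_
  refine (Submodule.Quotient.mk_eq_zero _).mpr (Submodule.subset_span ⟨p, q, u, hu, v, hv, ?_⟩)
  simp [koszulFlip_tmul 𝒜 hu hv]

end

/-! ### The associated bracket of a double Poisson bracket. -/

namespace GradedDoubleBracket

variable {k A : Type*} [Field k] [Ring A] [Algebra k A] {𝒜 : ℕ → Submodule k A}
  [GradedAlgebra 𝒜] (D : GradedDoubleBracket 𝒜)

/-- Skew symmetry carries the Leibniz rule from the second argument, with the outer structure, to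
the first, with the inner structure. -/
theorem br_mul_left {i j : ℕ} {x y : A} (hx : x ∈ 𝒜 i) (hy : y ∈ 𝒜 j) (z : A) :
    D.br (x * y) z =
      (koszulAut 𝒜 j).toLinearMap.lTensor A (D.br x (koszulAut 𝒜 j z)) * (y ⊗ₜ 1) +
        (1 ⊗ₜ x) * (koszulAut 𝒜 i).toLinearMap.rTensor A (D.br y z) := by
  suffices D.br (x * y) = LinearMap.mulRight k (y ⊗ₜ 1) ∘ₗ
      (koszulAut 𝒜 j).toLinearMap.lTensor A ∘ₗ D.br x ∘ₗ (koszulAut 𝒜 j).toLinearMap +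
        LinearMap.mulLeft k (1 ⊗ₜ x) ∘ₗ (koszulAut 𝒜 i).toLinearMap.rTensor A ∘ₗ D.br y from
    LinearMap.congr_fun this z
  refine linearMap_ext_homogeneous 𝒜 fun l z hz => ?_
  simp only [LinearMap.comp_apply, LinearMap.add_apply, LinearMap.mulRight_apply,
    LinearMap.mulLeft_apply, AlgHom.toLinearMap_apply, koszulAut_apply 𝒜 j hz, map_smul]
  rw [D.skew (SetLike.GradedMul.mul_mem hx hy) hz, D.leibniz hz, D.skew hz hx, D.skew hz hy, map_add,
    neg_mul, mul_neg, smul_mul_assoc, mul_smul_comm, map_neg, map_neg, map_smul, map_smul,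
    koszulFlip_flip_mul 𝒜 hy, koszulAut_apply 𝒜 l hx, ← TensorProduct.smul_tmul', smul_mul_assoc,
    map_smul, koszulFlip_mul_flip 𝒜 hx, smul_add, neg_add, smul_neg, smul_neg, neg_neg, neg_neg,
    smul_smul, smul_smul, smul_smul, ← pow_add, ← pow_add, ← pow_add]
  congr 2
  · refine neg_one_pow_eq_of_zmod ?_
    push_cast
    linear_combination (i * l : ZMod 2) * two_eq_zero_zmod_two
  · rw [Even.neg_one_pow ⟨(i + j) * l, by ring⟩, one_smul]

/-- The associated bracket. -/
def assoc (x : A) : A →ₗ[k] A := LinearMap.mul' k A ∘ₗ D.br x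

theorem assoc_apply (x y : A) : D.assoc x y = LinearMap.mul' k A (D.br x y) := rfl

theorem assoc_mul {i : ℕ} {x : A} (hx : x ∈ 𝒜 i) (y z : A) :
    D.assoc x (y * z) = D.assoc x y * z + koszulAut 𝒜 i y * D.assoc x z := by
  rw [assoc_apply, D.leibniz hx, map_add, mul'_mul_one, mul'_one_mul]
  rfl

theorem assoc_mem {i j l : ℕ} {x y : A} (hx : x ∈ 𝒜 i) (hy : y ∈ 𝒜 j) (h : i + j = l + 2) :
    D.assoc x y ∈ 𝒜 l :=
  mul'_mem 𝒜 (by omega) (D.weight hx hy)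

theorem mul'_map_koszulAut (j : ℕ) {y : A} (t : A ⊗[k] A) :
    LinearMap.mul' k A ((koszulAut 𝒜 j).toLinearMap.rTensor A
      (TensorProduct.map (koszulAut 𝒜 j).toLinearMap (koszulAut 𝒜 j).toLinearMap t) * (y ⊗ₜ 1)) =
    LinearMap.mul' k A ((koszulAut 𝒜 j).toLinearMap.lTensor A t * (y ⊗ₜ 1)) := by
  induction t using TensorProduct.induction_on with
  | zero => simp
  | add s t hs ht => simp only [add_mul, map_add, hs, ht]
  | tmul u v => simp [koszulAut_self]

theorem mul'_inner (x : A) (t : A ⊗[k] A) :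
    LinearMap.mul' k A ((1 ⊗ₜ x) * t) = LinearMap.mul' k A (t * (x ⊗ₜ 1)) := by
  induction t using TensorProduct.induction_on with
  | zero => simp
  | add s t hs ht => simp only [add_mul, mul_add, map_add, hs, ht]
  | tmul u v => simp [mul_assoc]

/-- Once the factors u ⊗ v of ⦃x, z⦄ are multiplied, its contribution is u y v for xy as well as for
yx, since inner multiplication inserts y between the factors. The same holds for ⦃y, z⦄, so only the
Koszul sign differs. -/
theorem assoc_mul_comm {i j : ℕ} {x y : A} (hx : x ∈ 𝒜 i) (hy : y ∈ 𝒜 j) (z : A) :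
    D.assoc (x * y) z = (-1 : k) ^ (i * j) • D.assoc (y * x) z := by
  have key : ∀ {i j : ℕ} {x y : A}, x ∈ 𝒜 i → y ∈ 𝒜 j → LinearMap.mul' k A
      ((koszulAut 𝒜 j).toLinearMap.lTensor A (D.br x (koszulAut 𝒜 j z)) * (y ⊗ₜ 1)) =
      (-1 : k) ^ (i * j) • LinearMap.mul' k A
        ((1 ⊗ₜ y) * (koszulAut 𝒜 j).toLinearMap.rTensor A (D.br x z)) := by
    intro i j x y hx hy
    have h := D.map_koszulAut_br hx j (koszulAut 𝒜 j z)
    rw [koszulAut_self] at h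
    have h' : D.br x z = (-1 : k) ^ (i * j) • TensorProduct.map (koszulAut 𝒜 j).toLinearMap
        (koszulAut 𝒜 j).toLinearMap (D.br x (koszulAut 𝒜 j z)) := by
      rw [h, smul_smul, neg_one_pow_mul_self, one_smul]
    rw [h', map_smul, mul_smul_comm, map_smul, smul_smul, neg_one_pow_mul_self, one_smul,
      mul'_inner, mul'_map_koszulAut]
  have h1 := key hx hy
  have h2 := key hy hx
  rw [assoc_apply, assoc_apply, D.br_mul_left hx hy, D.br_mul_left hy hx, map_add, map_add, h1, h2,
    smul_add, smul_smul, mul_comm j i, neg_one_pow_mul_self, one_smul, add_comm]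

/-- This is what converts the vanishing of {S, S} modulo commutators into an exact identity for the
operator {S, -}. -/
theorem assoc_of_mem_gradedCommutators {x : A} (hx : x ∈ gradedCommutators 𝒜) (z : A) :
    D.assoc x z = 0 := by
  induction hx using Submodule.span_induction with
  | zero => simp [assoc]
  | add x y _ _ hx hy =>
    rw [assoc_apply, map_add, LinearMap.add_apply, map_add, ← assoc_apply, ← assoc_apply, hx, hy,
      add_zero]
  | smul c x _ hx =>
    rw [assoc_apply, map_smul, LinearMap.smul_apply, map_smul, ← assoc_apply, hx, smul_zero]
  | mem x hx =>
    obtain ⟨i, j, a, ha, b, hb, rfl⟩ := hx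
    rw [assoc_apply, map_sub, map_smul, LinearMap.sub_apply, map_sub, LinearMap.smul_apply,
      map_smul, ← assoc_apply, ← assoc_apply, D.assoc_mul_comm ha hb, sub_self]

/-- The action of `{S, -}` on `A ⊗ A`. -/
def assocTensor (N : ℕ) (S : A) : A ⊗[k] A →ₗ[k] A ⊗[k] A :=
  (D.assoc S).rTensor A + TensorProduct.map (koszulAut 𝒜 N).toLinearMap (D.assoc S)

@[simp] theorem assocTensor_tmul (N : ℕ) (S u v : A) : D.assocTensor N S (u ⊗ₜ v) =
    D.assoc S u ⊗ₜ v + koszulAut 𝒜 N u ⊗ₜ D.assoc S v := rfl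

theorem assoc_mul' {N : ℕ} {S : A} (hS : S ∈ 𝒜 N) (t : A ⊗[k] A) :
    D.assoc S (LinearMap.mul' k A t) = LinearMap.mul' k A (D.assocTensor N S t) := by
  induction t using TensorProduct.induction_on with
  | zero => simp
  | add s t hs ht => simp only [map_add, hs, ht]
  | tmul u v => simp [D.assoc_mul hS]

/-- The multiplication of the first two factors. -/
def mul₁₂ (k A : Type*) [Field k] [Ring A] [Algebra k A] : (A ⊗[k] A) ⊗[k] A →ₗ[k] A ⊗[k] A :=
  (LinearMap.mul' k A).rTensor A

/-- The multiplication of the last two factors. -/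
def mul₂₃ (k A : Type*) [Field k] [Ring A] [Algebra k A] : (A ⊗[k] A) ⊗[k] A →ₗ[k] A ⊗[k] A :=
  (LinearMap.mul' k A).lTensor A ∘ₗ (TensorProduct.assoc k A A A).toLinearMap

@[simp] theorem mul₁₂_tmul (u v w : A) : mul₁₂ k A (u ⊗ₜ v ⊗ₜ w) = (u * v) ⊗ₜ w := rfl
@[simp] theorem mul₂₃_tmul (u v w : A) : mul₂₃ k A (u ⊗ₜ v ⊗ₜ w) = u ⊗ₜ (v * w) := rfl

/-- Multiplying two adjacent factors out of three turns a triple expression into {x, -} acting on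
one factor of a tensor; `mul₂₃_actR` is the counterpart for the second factor. -/
theorem mul₁₂_actL (x : A) (t : A ⊗[k] A) :
    mul₁₂ k A (D.actL x t) = (D.assoc x).rTensor A t := by
  rw [mul₁₂, actL, assoc, LinearMap.rTensor_comp]
  rfl

theorem mul₂₃_actR (j : ℕ) (x : A) (t : A ⊗[k] A) : mul₂₃ k A (D.actR j x t) =
    TensorProduct.map (koszulAut 𝒜 j).toLinearMap (D.assoc x) t := by
  induction t using TensorProduct.induction_on with
  | zero => simp
  | add s t hs ht => simp only [map_add, hs, ht]
  | tmul u v =>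
    rw [actR, LinearMap.comp_apply, mul₂₃, LinearMap.comp_apply]
    simp [assoc]

theorem br_mul' {j : ℕ} {y : A} (hy : y ∈ 𝒜 j) (t : A ⊗[k] A) :
    D.br y (LinearMap.mul' k A t) = mul₁₂ k A (D.actR j y t) + mul₂₃ k A (D.actL y t) := by
  induction t using TensorProduct.induction_on with
  | zero => simp
  | add s t hs ht => simp only [map_add, hs, ht]; abel
  | tmul u v =>
    rw [LinearMap.mul'_apply, D.leibniz hy, add_comm, actR_tmul, actL_tmul]
    congr 1
    · generalize D.br y v = t
      induction t using TensorProduct.induction_on with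
      | zero => simp
      | add s t hs ht => simp only [map_add, mul_add, hs, ht]
      | tmul p q => simp
    · generalize D.br y u = t
      induction t using TensorProduct.induction_on with
      | zero => simp
      | add s t hs ht => simp only [map_add, add_mul, TensorProduct.add_tmul, hs, ht]
      | tmul p q => simp

/-- The two terms of `br_mul_left` are recovered from nested brackets, one for u ⊗ v and one for its
signed flip. -/
theorem br_mul'_left (z : A) (t : A ⊗[k] A) :
    D.br (LinearMap.mul' k A t) z =
      mul₁₂ k A (D.actNested t z) + mul₂₃ k A (D.actNested (koszulFlip 𝒜 t) z) := by
  suffices D.br.flip z ∘ₗ LinearMap.mul' k A = mul₁₂ k A ∘ₗ D.actNested.flip z +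
      mul₂₃ k A ∘ₗ D.actNested.flip z ∘ₗ koszulFlip 𝒜 from LinearMap.congr_fun this t
  refine tensor_ext_homogeneous 𝒜 fun p q u hu v hv => ?_
  simp only [LinearMap.comp_apply, LinearMap.add_apply, LinearMap.flip_apply, LinearMap.mul'_apply,
    D.br_mul_left hu hv, koszulFlip_tmul 𝒜 hu hv, map_smul,
    actNested_tmul D u hv, actNested_tmul D v hu]
  congr 1
  · rw [nested_apply]
    generalize D.br u (koszulAut 𝒜 q z) = t
    induction t using TensorProduct.induction_on with
    | zero => simp
    | add s t hs ht => simp only [map_add, add_mul, TensorProduct.add_tmul, hs, ht]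
    | tmul p q => simp
  · have h := D.map_koszulAut_br hv p z
    rw [nested_apply, mul_comm p q, ← map_smul, ← map_smul, TensorProduct.smul_tmul', ← map_smul,
      ← h]
    generalize D.br v z = t
    induction t using TensorProduct.induction_on with
    | zero => simp
    | add s t hs ht => simp only [map_add, mul_add, TensorProduct.add_tmul, hs, ht]
    | tmul p q => simp [koszulAut_self]

variable {D}

theorem IsPoisson.actL_br (hD : D.IsPoisson) {i j : ℕ} {x y : A} (hx : x ∈ 𝒜 i) (hy : y ∈ 𝒜 j) (z : A) :
    D.actL x (D.br y z) =
      (-1 : k) ^ (i * j) • D.actR j y (D.br x z) + D.actNested (D.br x y) z := by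
  have h := LinearMap.congr_fun (hD hx hy) z
  rw [jacobiator_apply, LinearMap.zero_apply, sub_sub, sub_eq_zero] at h
  exact h

/-- `{S, -}` is a derivation of the double bracket. -/
theorem IsPoisson.assocTensor_br (hD : D.IsPoisson) {N j : ℕ} {S y : A} (hS : S ∈ 𝒜 N) (hy : y ∈ 𝒜 j) (z : A) :
    D.assocTensor N S (D.br y z) =
      D.br (D.assoc S y) z + (-1 : k) ^ (N * j) • D.br y (D.assoc S z) := by
  -- The action of {S, -} on the first factor of ⦃y, z⦄ comes from the Jacobi identity for S, y with
  -- the first two factors multiplied; the action on the second factor comes from the identity for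
  -- y, S with the last two multiplied.
  have h1 := congrArg (mul₁₂ k A) (hD.actL_br hS hy z)
  have h2 := congrArg (mul₂₃ k A) (hD.actL_br hy hS z)
  have h3 := D.skew hy hS
  rw [mul₁₂_actL, map_add, map_smul] at h1
  rw [map_add, map_smul, mul₂₃_actR, h3, map_neg, map_smul, LinearMap.neg_apply,
    LinearMap.smul_apply, map_neg, map_smul, ← sub_eq_add_neg, ← smul_sub] at h2
  have h2' := congrArg (fun t => (-1 : k) ^ (j * N) • t) h2
  simp only [smul_smul, neg_one_pow_mul_self, one_smul] at h2'
  rw [eq_sub_iff_add_eq] at h2'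
  rw [assocTensor, LinearMap.add_apply, h1, ← h2', assoc_apply, assoc_apply, D.br_mul' hy,
    D.br_mul'_left, mul_comm j N, smul_add]
  abel

/-- Multiplying out the derivation property with y = S gives {S, {S, z}} = {{S, S}, z} - {S, {S,
z}}, the minus sign being due to the odd weight of S. -/
theorem IsPoisson.two_assoc_assoc (hD : D.IsPoisson) {N : ℕ} {S : A} (hN : Odd N) (hS : S ∈ 𝒜 N) (z : A) :
    (2 : k) • D.assoc S (D.assoc S z) = D.assoc (D.assoc S S) z := by
  have h := congrArg (LinearMap.mul' k A) (hD.assocTensor_br hS hS z)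
  rw [← D.assoc_mul' hS, (hN.mul hN).neg_one_pow, map_add, map_smul, ← assoc_apply, ← assoc_apply,
    ← assoc_apply, neg_one_smul] at h
  rw [two_smul]
  nth_rewrite 1 [h]
  abel

end GradedDoubleBracket

/-! ### Partial derivatives on path algebras -/

/-- The map `p ⊗ q ↦ (m ↦ f(p) m g(q))`. -/
def sandwich {k A C : Type*} [Field k] [Ring A] [Algebra k A] [Ring C] [Algebra k C]
    (f g : A →ₐ[k] C) : A ⊗[k] A →ₗ[k] C →ₗ[k] C :=
  TensorProduct.lift (LinearMap.mk₂ k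
    (fun p q => LinearMap.mulRight k (g q) ∘ₗ LinearMap.mulLeft k (f p))
    (fun p p' q => by ext m; simp [add_mul])
    (fun c p q => by ext m; simp)
    (fun p q q' => by ext m; simp [mul_add])
    (fun c p q => by ext m; simp))

section sandwich

variable {k A C : Type*} [Field k] [Ring A] [Algebra k A] [Ring C] [Algebra k C]
    (f g : A →ₐ[k] C)

@[simp] theorem sandwich_tmul (p q : A) (m : C) : sandwich f g (p ⊗ₜ q) m = f p * m * g q := rfl

theorem sandwich_mul_one (t : A ⊗[k] A) (z : A) (m : C) :
    sandwich f g (t * (1 ⊗ₜ z)) m = sandwich f g t m * g z := by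
  induction t using TensorProduct.induction_on with
  | zero => simp
  | add s t hs ht => simp only [add_mul, map_add, LinearMap.add_apply, hs, ht]
  | tmul u v => simp [mul_assoc]

theorem sandwich_one_mul (t : A ⊗[k] A) (z : A) (m : C) :
    sandwich f g ((z ⊗ₜ 1) * t) m = f z * sandwich f g t m := by
  induction t using TensorProduct.induction_on with
  | zero => simp
  | add s t hs ht => simp only [mul_add, map_add, LinearMap.add_apply, hs, ht]
  | tmul u v => simp [mul_assoc]

end sandwich

namespace GradedQuiver

variable {k V E : Type*} [Field k] [Fintype V] {P : GradedQuiver V E}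

namespace PathAlgebra

theorem induction {motive : PathAlgebra k P → Prop} (he : ∀ i, motive (e k P i))
    (harrow : ∀ a, motive (arrow k P a))
    (hone : motive 1) (hsmul : ∀ (c : k) x, motive x → motive (c • x))
    (hadd : ∀ x y, motive x → motive y → motive (x + y))
    (hmul : ∀ x y, motive x → motive y → motive (x * y)) (x : PathAlgebra k P) : motive x := by
  obtain ⟨y, rfl⟩ := RingQuot.mkAlgHom_surjective k (PathRel k P) x
  induction y using FreeAlgebra.induction with
  | grade0 c =>
    rw [AlgHom.commutes, Algebra.algebraMap_eq_smul_one]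
    exact hsmul c _ hone
  | grade1 x => exact x.rec he harrow
  | mul a b ha hb => rw [map_mul]; exact hmul _ _ ha hb
  | add a b ha hb => rw [map_add]; exact hadd _ _ ha hb

theorem linearMap_eq_zero {M : Type*} [AddCommGroup M] [Module k M] (F : PathAlgebra k P →ₗ[k] M)
    (hgen : ∀ x, F (gen k P x) = 0) (hone : F 1 = 0)
    (hmul : ∀ x y, F x = 0 → F y = 0 → F (x * y) = 0) : F = 0 := by
  ext x
  induction x using induction with
  | he i => exact hgen (Sum.inl i)
  | harrow a => exact hgen (Sum.inr a)
  | hone => exact hone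
  | hsmul c x hx => rw [map_smul, hx]; simp
  | hadd x y hx hy => rw [map_add, hx, hy]; simp
  | hmul x y hx hy => exact hmul x y hx hy

section twistedDer

variable {C : Type*} [Ring C] [Algebra k C] (f g : PathAlgebra k P →ₐ[k] C) (h : E → C)
  (hl : ∀ a, f (e k P (P.head a)) * h a = h a) (hr : ∀ a, h a * g (e k P (P.tail a)) = h a)

/-- The algebra morphism `x ↦ !![f x, D x; 0, g x]`, where `D` is the twisted derivation with
`D a = h a` for the arrows `a`, which vanishes on trivial paths. -/
def twistedHom : PathAlgebra k P →ₐ[k] Matrix (Fin 2) (Fin 2) C :=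
  lift (fun i => !![f (e k P i), 0; 0, g (e k P i)])
    (fun a => !![f (arrow k P a), h a; 0, g (arrow k P a)])
    (fun i => by
      rw [Matrix.mul_fin_two]
      refine Forms.triang_ext ?_ ?_ ?_ ?_ <;> simp [← map_mul, e_mul_self])
    (fun i j hij => by
      rw [Matrix.mul_fin_two]
      refine Forms.triang_ext ?_ ?_ ?_ ?_ <;> simp [← map_mul, e_mul_e hij])
    (by
      refine Forms.triang_ext ?_ ?_ ?_ ?_ <;> simp [Matrix.sum_apply, ← map_sum, sum_e])
    (fun a => by
      rw [Matrix.mul_fin_two]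
      refine Forms.triang_ext ?_ ?_ ?_ ?_ <;> simp [← map_mul, e_head_mul, hl])
    (fun a => by
      rw [Matrix.mul_fin_two]
      refine Forms.triang_ext ?_ ?_ ?_ ?_ <;> simp [← map_mul, mul_e_tail, hr])

theorem twistedHom_entries (x : PathAlgebra k P) :
    twistedHom f g h hl hr x 0 0 = f x ∧ twistedHom f g h hl hr x 1 0 = 0 ∧
      twistedHom f g h hl hr x 1 1 = g x := by
  induction x using induction with
  | he i => simp [twistedHom]
  | harrow a => simp [twistedHom]
  | hone => simp
  | hsmul c x hx => simp [hx]
  | hadd x y hx hy => simp [hx, hy]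
  | hmul x y hx hy => simp [Matrix.mul_apply, Fin.sum_univ_two, hx, hy]

/-- The twisted derivation with `D a = h a` for the arrows `a`, which vanishes on trivial paths. -/
def twistedDer : PathAlgebra k P →ₗ[k] C where
  toFun := fun x => twistedHom f g h hl hr x 0 1
  map_add' := fun x y => by simp
  map_smul' := fun c x => by simp

@[simp] theorem twistedDer_e (i : V) : twistedDer f g h hl hr (e k P i) = 0 := by
  simp [twistedDer, twistedHom]

@[simp] theorem twistedDer_arrow (a : E) : twistedDer f g h hl hr (arrow k P a) = h a := by
  simp [twistedDer, twistedHom]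

theorem twistedDer_mul (x y : PathAlgebra k P) : twistedDer f g h hl hr (x * y) =
    twistedDer f g h hl hr x * g y + f x * twistedDer f g h hl hr y := by
  have hx := twistedHom_entries f g h hl hr x
  have hy := twistedHom_entries f g h hl hr y
  simp [twistedDer, Matrix.mul_apply, Fin.sum_univ_two, hx, hy, add_comm]

end twistedDer

variable [DecidableEq E]

variable (k P) in
/-- The partial derivative with respect to an arrow `c`, the double derivation with
`c ↦ e ⊗ e` that vanishes on the other arrows. -/
def partialDer (c : E) : PathAlgebra k P →ₗ[k] PathAlgebra k P ⊗[k] PathAlgebra k P :=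
  twistedDer Algebra.TensorProduct.includeLeft Algebra.TensorProduct.includeRight
    (Pi.single c (e k P (P.head c) ⊗ₜ e k P (P.tail c)))
    (fun a => by
      rcases eq_or_ne a c with rfl | h
      · simp [e_mul_self]
      · simp [h])
    (fun a => by
      rcases eq_or_ne a c with rfl | h
      · simp [e_mul_self]
      · simp [h])

@[simp] theorem partialDer_e (c : E) (i : V) : partialDer k P c (e k P i) = 0 :=
  twistedDer_e ..

theorem partialDer_arrow (c a : E) : partialDer k P c (arrow k P a) =
    if a = c then e k P (P.head c) ⊗ₜ e k P (P.tail c) else 0 := by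
  rw [partialDer, twistedDer_arrow, Pi.single_apply]

theorem partialDer_mul (c : E) (x y : PathAlgebra k P) : partialDer k P c (x * y) =
    partialDer k P c x * (1 ⊗ₜ y) + (x ⊗ₜ 1) * partialDer k P c y :=
  twistedDer_mul ..

theorem partialDer_one (c : E) : partialDer k P c 1 = 0 := by
  rw [← sum_e, map_sum]
  simp

/-- For a path p c q, the left part p starts at the head of c and the right part q ends at its tail.
With `tail_mul_partialDer` this confines the values of ∂_c to a corner, which later makes Θ(c) well
placed. -/
theorem partialDer_mul_head (c : E) (x : PathAlgebra k P) :
    partialDer k P c x * (e k P (P.head c) ⊗ₜ 1) = partialDer k P c x := by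
  induction x using induction with
  | he i => simp
  | harrow a =>
    rw [partialDer_arrow]
    split_ifs <;> simp [e_mul_self]
  | hone => rw [partialDer_one, zero_mul]
  | hsmul c x hx => rw [map_smul, smul_mul_assoc, hx]
  | hadd x y hx hy => rw [map_add, add_mul, hx, hy]
  | hmul x y hx hy =>
    rw [partialDer_mul, add_mul, mul_assoc, mul_assoc, hy, Algebra.TensorProduct.tmul_mul_tmul,
      one_mul, mul_one]
    nth_rewrite 2 [← hx]
    rw [mul_assoc, Algebra.TensorProduct.tmul_mul_tmul, one_mul, mul_one]

theorem tail_mul_partialDer (c : E) (x : PathAlgebra k P) :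
    (1 ⊗ₜ e k P (P.tail c)) * partialDer k P c x = partialDer k P c x := by
  induction x using induction with
  | he i => simp
  | harrow a =>
    rw [partialDer_arrow]
    split_ifs <;> simp [e_mul_self]
  | hone => rw [partialDer_one, mul_zero]
  | hsmul c x hx => rw [map_smul, mul_smul_comm, hx]
  | hadd x y hx hy => rw [map_add, mul_add, hx, hy]
  | hmul x y hx hy =>
    rw [partialDer_mul, mul_add, ← mul_assoc, ← mul_assoc, hx,
      Algebra.TensorProduct.tmul_mul_tmul, one_mul, mul_one]
    nth_rewrite 2 [← hy]
    rw [← mul_assoc, Algebra.TensorProduct.tmul_mul_tmul, one_mul, mul_one]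

end PathAlgebra

theorem gen_mem_grade (x : V ⊕ E) : PathAlgebra.gen k P x ∈ grade k P (P.genWeight x) :=
  gen_mem_wordGrading _ P.genWeight x

theorem tmul_one_mul_mem {n : ℤ} {i : ℕ} {A : Type*} [Ring A] [Algebra k A]
    {𝒜 : ℕ → Submodule k A} [GradedAlgebra 𝒜] {x : A} (hx : x ∈ 𝒜 i) {t : A ⊗[k] A}
    (ht : t ∈ tensorGrade 𝒜 n) : (x ⊗ₜ 1) * t ∈ tensorGrade 𝒜 (i + n) := by
  refine tensorGrade_induction 𝒜 (motive := fun t => (x ⊗ₜ 1) * t ∈ tensorGrade 𝒜 (i + n)) ht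
    (by simp) ?_ ?_ ?_
  · intro s t hs ht
    rw [mul_add]
    exact add_mem hs ht
  · intro c t ht
    rw [mul_smul_comm]
    exact Submodule.smul_mem _ _ ht
  · intro p q hpq u hu v hv
    rw [Algebra.TensorProduct.tmul_mul_tmul, one_mul]
    exact tmul_mem_tensorGrade 𝒜 (SetLike.GradedMul.mul_mem hx hu) hv (by push_cast; omega)

theorem mul_one_tmul_mem {n : ℤ} {i : ℕ} {A : Type*} [Ring A] [Algebra k A]
    {𝒜 : ℕ → Submodule k A} [GradedAlgebra 𝒜] {x : A} (hx : x ∈ 𝒜 i) {t : A ⊗[k] A}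
    (ht : t ∈ tensorGrade 𝒜 n) : t * (1 ⊗ₜ x) ∈ tensorGrade 𝒜 (n + i) := by
  refine tensorGrade_induction 𝒜 (motive := fun t => t * (1 ⊗ₜ x) ∈ tensorGrade 𝒜 (n + i)) ht
    (by simp) ?_ ?_ ?_
  · intro s t hs ht
    rw [add_mul]
    exact add_mem hs ht
  · intro c t ht
    rw [smul_mul_assoc]
    exact Submodule.smul_mem _ _ ht
  · intro p q hpq u hu v hv
    rw [Algebra.TensorProduct.tmul_mul_tmul, mul_one]
    exact tmul_mem_tensorGrade 𝒜 hu (SetLike.GradedMul.mul_mem hv hx) (by push_cast; omega)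

/-- A twisted double derivation has weight `n` if it has weight `n` on the generators. -/
theorem mem_tensorGrade_of_leibniz (n : ℤ) (m : ℕ)
    (F : PathAlgebra k P →ₗ[k] PathAlgebra k P ⊗[k] PathAlgebra k P)
    (hF : ∀ x y, F (x * y) = F x * (1 ⊗ₜ y) + (koszulAut (grade k P) m x ⊗ₜ 1) * F y)
    (hgen : ∀ x, F (PathAlgebra.gen k P x) ∈ tensorGrade (grade k P) (n + P.genWeight x))
    (hone : F 1 = 0) {w : ℕ} {x : PathAlgebra k P} (hx : x ∈ grade k P w) :
    F x ∈ tensorGrade (grade k P) (n + w) := by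
  induction hx using Submodule.span_induction with
  | zero => simp
  | add x y _ _ hx hy => rw [map_add]; exact add_mem hx hy
  | smul c x _ hx => rw [map_smul]; exact Submodule.smul_mem _ _ hx
  | mem x hx =>
    obtain ⟨l, rfl, rfl⟩ := hx
    induction l with
    | nil => simp [hone]
    | cons y l ih =>
      rw [List.map_cons, List.map_cons, List.prod_cons, List.sum_cons, hF]
      have hl : (l.map (PathAlgebra.gen k P)).prod ∈ grade k P (l.map P.genWeight).sum :=
        Submodule.subset_span ⟨l, rfl, rfl⟩
      refine add_mem ?_ ?_
      · have := mul_one_tmul_mem hl (hgen y)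
        rwa [add_assoc, ← Nat.cast_add] at this
      · have := tmul_one_mul_mem (koszulAut_mem (grade k P) m (gen_mem_grade y)) ih
        rwa [add_left_comm, ← Nat.cast_add] at this

theorem partialDer_mem [DecidableEq E] (c : E) {w : ℕ} {x : PathAlgebra k P}
    (hx : x ∈ grade k P w) :
    PathAlgebra.partialDer k P c x ∈ tensorGrade (grade k P) ((w : ℤ) - P.weight c) := by
  -- Twist 0: the partial derivatives obey the Leibniz rule without signs.
  have := mem_tensorGrade_of_leibniz (-(P.weight c : ℤ)) 0 (PathAlgebra.partialDer k P c)
    (fun x y => by rw [koszulAut_zero, PathAlgebra.partialDer_mul])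
    (fun x => by
      rcases x with i | a
      · change PathAlgebra.partialDer k P c (PathAlgebra.e k P i) ∈ _
        simp
      · change PathAlgebra.partialDer k P c (PathAlgebra.arrow k P a) ∈ _
        rw [PathAlgebra.partialDer_arrow]
        split_ifs with h
        · subst h
          exact tmul_mem_tensorGrade _ (e_mem_grade k P _) (e_mem_grade k P _)
            (by simp [genWeight])
        · exact zero_mem _)
    (PathAlgebra.partialDer_one c) hx
  rwa [neg_add_eq_sub] at this

end GradedQuiver

/-! ### The double bracket of a symplectic graded quiver -/

/-- This is skew symmetry term by term. With s = ∂_c y and t = ∂_{c*} x the two sides are, up to the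
signs attached to c and c*, the c-summand of ⦃x, y⦄ and the flipped c*-summand of ⦃y, x⦄. -/
theorem sandwich_skew {k A : Type*} [Field k] [Ring A] [Algebra k A] (𝒜 : ℕ → Submodule k A)
    [GradedAlgebra 𝒜] {i j m m' : ℕ} (hm : (m' : ZMod 2) = m) {s t : A ⊗[k] A}
    (hs : s ∈ tensorGrade 𝒜 ((j : ℤ) - m)) (ht : t ∈ tensorGrade 𝒜 ((i : ℤ) - m')) :
    sandwich (Algebra.TensorProduct.includeLeft.comp (koszulAut 𝒜 i))
      Algebra.TensorProduct.includeRight s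
        ((koszulAut 𝒜 m).toLinearMap.rTensor A (koszulFlip 𝒜 t)) =
      (-1 : k) ^ (i * j + m) • koszulFlip 𝒜
        (sandwich (Algebra.TensorProduct.includeLeft.comp (koszulAut 𝒜 j))
          Algebra.TensorProduct.includeRight t
            ((koszulAut 𝒜 m').toLinearMap.rTensor A (koszulFlip 𝒜 s))) := by
  refine tensorGrade_induction 𝒜 (motive := fun s => sandwich _ _ s _ = _ • koszulFlip 𝒜
    (sandwich _ _ t (LinearMap.rTensor A _ (koszulFlip 𝒜 s)))) hs (by simp) ?_ ?_ ?_
  · intro s s' h h'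
    simp only [map_add, LinearMap.add_apply, h, h', smul_add]
  · intro c s h
    simp only [map_smul, LinearMap.smul_apply, h, smul_comm c]
  intro p q hpq u hu v hv
  refine tensorGrade_induction 𝒜 (motive := fun t => sandwich _ _ (u ⊗ₜ v)
    (LinearMap.rTensor A _ (koszulFlip 𝒜 t)) = _ • koszulFlip 𝒜
      (sandwich _ _ t (LinearMap.rTensor A _ (koszulFlip 𝒜 (u ⊗ₜ v))))) ht (by simp) ?_ ?_ ?_
  · intro s s' h h'
    simp only [map_add, LinearMap.add_apply, h, h', smul_add]
  · intro c s h
    simp only [map_smul, LinearMap.smul_apply, h, smul_comm c]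
  intro a b hab w hw z hz
  simp only [koszulFlip_tmul _ hu hv, koszulFlip_tmul _ hw hz, map_smul, LinearMap.rTensor_tmul,
    AlgHom.toLinearMap_apply, koszulAut_apply _ _ hv, koszulAut_apply _ _ hz,
    ← TensorProduct.smul_tmul', sandwich_tmul, AlgHom.comp_apply, koszulAut_apply _ _ hw,
    koszulAut_apply _ _ hu, Algebra.TensorProduct.includeLeft_apply,
    Algebra.TensorProduct.includeRight_apply, smul_mul_assoc,
    Algebra.TensorProduct.tmul_mul_tmul, one_mul, mul_one,
    koszulFlip_tmul _ (SetLike.GradedMul.mul_mem hw hv) (SetLike.GradedMul.mul_mem hu hz),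
    smul_smul, ← pow_add]
  rw [neg_one_pow_eq_of_zmod]
  -- The weight relations eliminate i and j, leaving an unconstrained identity in five parities.
  have h1 : (i : ZMod 2) = a + b + m := by
    have := congrArg (Int.cast : ℤ → ZMod 2) hab
    push_cast at this
    rw [this, hm, sub_add_cancel]
  have h2 : (j : ZMod 2) = p + q + m := by
    have := congrArg (Int.cast : ℤ → ZMod 2) hpq
    push_cast at this
    rw [this, sub_add_cancel]
  push_cast
  rw [h1, h2, hm]
  generalize (m : ZMod 2) = m
  generalize (a : ZMod 2) = a
  generalize (b : ZMod 2) = b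
  generalize (p : ZMod 2) = p
  generalize (q : ZMod 2) = q
  revert m a b p q
  decide

namespace GradedQuiver

/-- An involution `c ↦ c*` on the arrows of a graded quiver that reverses the arrows, with
`|c| + |c*| = 2`, and signs that are compatible with it. -/
structure Duality (k : Type*) [Field k] {V E : Type*} (P : GradedQuiver V E) where
  bar : E → E
  bar_bar : ∀ c, bar (bar c) = c
  head_bar : ∀ c, P.head (bar c) = P.tail c
  tail_bar : ∀ c, P.tail (bar c) = P.head c
  weight_bar : ∀ c, P.weight c + P.weight (bar c) = 2
  sign : E → k
  sign_bar : ∀ c, sign (bar c) = -((-1) ^ P.weight c * sign c)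
  sign_mul_self : ∀ c, sign c * sign c = 1

namespace Duality

open PathAlgebra

variable {k V E : Type*} [Field k] [Fintype V] {P : GradedQuiver V E} (U : P.Duality k)

theorem weight_bar_zmod (c : E) : (P.weight (U.bar c) : ZMod 2) = P.weight c := by
  have := congrArg (Nat.cast : ℕ → ZMod 2) (U.weight_bar c)
  push_cast at this
  rw [two_eq_zero_zmod_two] at this
  exact (CharTwo.add_eq_zero.mp this).symm

/-- The involution as a permutation of the arrows. -/
def perm : Equiv.Perm E := ⟨U.bar, U.bar, U.bar_bar, U.bar_bar⟩

@[simp] theorem perm_apply (c : E) : U.perm c = U.bar c := rfl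

variable [DecidableEq E]

/-- The value at `c` of the Hamiltonian double derivation of `x`. -/
def hamValue (c : E) : PathAlgebra k P →ₗ[k] PathAlgebra k P ⊗[k] PathAlgebra k P :=
  U.sign c • (koszulAut (grade k P) (P.weight c)).toLinearMap.rTensor _ ∘ₗ koszulFlip (grade k P) ∘ₗ
    partialDer k P (U.bar c)

theorem hamValue_apply (c : E) (x : PathAlgebra k P) : U.hamValue c x =
    U.sign c • (koszulAut (grade k P) (P.weight c)).toLinearMap.rTensor _
      (koszulFlip (grade k P) (partialDer k P (U.bar c) x)) := rfl

theorem flip_tail_mul (i : V) (t : PathAlgebra k P ⊗[k] PathAlgebra k P) :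
    koszulFlip (grade k P) ((1 ⊗ₜ e k P i) * t) = (e k P i ⊗ₜ 1) * koszulFlip (grade k P) t := by
  suffices koszulFlip (grade k P) ∘ₗ LinearMap.mulLeft k (1 ⊗ₜ e k P i) =
      LinearMap.mulLeft k (e k P i ⊗ₜ 1) ∘ₗ koszulFlip (grade k P) from LinearMap.congr_fun this t
  refine tensor_ext_homogeneous (grade k P) fun p q u hu v hv => ?_
  have h : e k P i * v ∈ grade k P q := by
    simpa using SetLike.GradedMul.mul_mem (e_mem_grade k P i) hv
  simp [koszulFlip_tmul _ hu hv, koszulFlip_tmul _ hu h]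

theorem flip_mul_head (i : V) (t : PathAlgebra k P ⊗[k] PathAlgebra k P) :
    koszulFlip (grade k P) (t * (e k P i ⊗ₜ 1)) = koszulFlip (grade k P) t * (1 ⊗ₜ e k P i) := by
  suffices koszulFlip (grade k P) ∘ₗ LinearMap.mulRight k (e k P i ⊗ₜ 1) =
      LinearMap.mulRight k (1 ⊗ₜ e k P i) ∘ₗ koszulFlip (grade k P) from LinearMap.congr_fun this t
  refine tensor_ext_homogeneous (grade k P) fun p q u hu v hv => ?_
  have h : u * e k P i ∈ grade k P p := by
    simpa using SetLike.GradedMul.mul_mem hu (e_mem_grade k P i)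
  simp [koszulFlip_tmul _ hu hv, koszulFlip_tmul _ h hv]

theorem koszulAut_e (n : ℕ) (i : V) : koszulAut (grade k P) n (e k P i) = e k P i :=
  koszulAut_of_zero _ n (e_mem_grade k P i)

theorem rTensor_koszulAut_mul (n : ℕ) (s t : PathAlgebra k P ⊗[k] PathAlgebra k P) :
    (koszulAut (grade k P) n).toLinearMap.rTensor _ (s * t) =
      (koszulAut (grade k P) n).toLinearMap.rTensor _ s *
        (koszulAut (grade k P) n).toLinearMap.rTensor _ t :=
  map_mul (Algebra.TensorProduct.map (koszulAut (grade k P) n) (AlgHom.id k _)) s t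

/-- With `hamValue_mul_tail`, the value lies in the corner of c, so inserting it into ∂_c c = e ⊗ e
returns it unchanged; this is how `brLin_arrow` recovers it. -/
theorem head_mul_hamValue (c : E) (x : PathAlgebra k P) :
    (e k P (P.head c) ⊗ₜ 1) * U.hamValue c x = U.hamValue c x := by
  rw [hamValue_apply, mul_smul_comm]
  congr 1
  nth_rewrite 2 [← tail_mul_partialDer]
  rw [U.tail_bar, flip_tail_mul, rTensor_koszulAut_mul, LinearMap.rTensor_tmul,
    AlgHom.toLinearMap_apply, koszulAut_e]

theorem hamValue_mul_tail (c : E) (x : PathAlgebra k P) :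
    U.hamValue c x * (1 ⊗ₜ e k P (P.tail c)) = U.hamValue c x := by
  rw [hamValue_apply, smul_mul_assoc]
  congr 1
  nth_rewrite 2 [← partialDer_mul_head]
  rw [U.head_bar, flip_mul_head, rTensor_koszulAut_mul, LinearMap.rTensor_tmul,
    AlgHom.toLinearMap_apply, map_one]

/-- The Hamiltonian double derivation of the elements of weight `w`. -/
def brAux [Fintype E] (w : ℕ) :
    PathAlgebra k P →ₗ[k] PathAlgebra k P →ₗ[k] PathAlgebra k P ⊗[k] PathAlgebra k P :=
  ∑ c, LinearMap.lcomp k _ (partialDer k P c) ∘ₗ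
    (sandwich (Algebra.TensorProduct.includeLeft.comp (koszulAut (grade k P) w))
      Algebra.TensorProduct.includeRight).flip ∘ₗ U.hamValue c

/-- The double bracket as a bilinear map. -/
def brLin [Fintype E] :
    PathAlgebra k P →ₗ[k] PathAlgebra k P →ₗ[k] PathAlgebra k P ⊗[k] PathAlgebra k P :=
  Forms.ofHomogeneous (grade k P) fun w => U.brAux w ∘ₗ (grade k P w).subtype

variable [Fintype E]

theorem brLin_apply {w : ℕ} {x : PathAlgebra k P} (hx : x ∈ grade k P w) (y : PathAlgebra k P) :
    U.brLin x y = ∑ c, sandwich (Algebra.TensorProduct.includeLeft.comp (koszulAut (grade k P) w))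
      Algebra.TensorProduct.includeRight (partialDer k P c y) (U.hamValue c x) := by
  rw [brLin, Forms.ofHomogeneous_apply _ _ hx]
  simp [brAux, LinearMap.sum_apply]

theorem brLin_mul {w : ℕ} {x : PathAlgebra k P} (hx : x ∈ grade k P w) (y z : PathAlgebra k P) :
    U.brLin x (y * z) = U.brLin x y * (1 ⊗ₜ z) +
      (koszulAut (grade k P) w y ⊗ₜ 1) * U.brLin x z := by
  simp only [U.brLin_apply hx, partialDer_mul, map_add, LinearMap.add_apply, sandwich_mul_one,
    sandwich_one_mul, Finset.sum_add_distrib, Finset.sum_mul, Finset.mul_sum]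
  rfl

theorem brLin_e (x : PathAlgebra k P) (i : V) : U.brLin x (e k P i) = 0 := by
  suffices U.brLin.flip (e k P i) = 0 from LinearMap.congr_fun this x
  refine linearMap_ext_homogeneous (grade k P) fun w x hx => ?_
  rw [LinearMap.flip_apply, U.brLin_apply hx]
  simp

theorem brLin_arrow (x : PathAlgebra k P) (c : E) : U.brLin x (arrow k P c) = U.hamValue c x := by
  suffices U.brLin.flip (arrow k P c) = U.hamValue c from LinearMap.congr_fun this x
  refine linearMap_ext_homogeneous (grade k P) fun w x hx => ?_
  rw [LinearMap.flip_apply, U.brLin_apply hx, Finset.sum_eq_single c]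
  · rw [partialDer_arrow, if_pos rfl, sandwich_tmul]
    change ((koszulAut (grade k P) w) (e k P (P.head c)) ⊗ₜ[k] 1) * _ * (1 ⊗ₜ e k P (P.tail c)) = _
    rw [koszulAut_e, head_mul_hamValue, hamValue_mul_tail]
  · intro b _ hb
    rw [partialDer_arrow, if_neg hb.symm, map_zero, LinearMap.zero_apply]
  · simp

theorem brLin_mem {i j : ℕ} {x y : PathAlgebra k P} (hx : x ∈ grade k P i) (hy : y ∈ grade k P j) :
    U.brLin x y ∈ tensorGrade (grade k P) ((i : ℤ) + j - 2) := by
  have := mem_tensorGrade_of_leibniz ((i : ℤ) - 2) i (U.brLin x) (U.brLin_mul hx)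
    (fun a => by
      rcases a with v | c
      · change U.brLin x (e k P v) ∈ _
        rw [brLin_e]
        exact zero_mem _
      · change U.brLin x (arrow k P c) ∈ _
        rw [brLin_arrow, hamValue_apply]
        refine Submodule.smul_mem _ _ ?_
        have h := koszulFlip_mem _ (partialDer_mem (U.bar c) hx)
        -- As |c| + |c*| = 2, the weight i - |c*| of ∂_{c*} x is the required i - 2 + |c|.
        have h2 := U.weight_bar c
        have h3 : (i : ℤ) - P.weight (U.bar c) = i - 2 + P.genWeight (Sum.inr c : V ⊕ E) := by
          simp only [genWeight, Sum.elim_inr]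
          omega
        rw [h3] at h
        refine tensorGrade_induction (grade k P) (motive := fun t =>
          (koszulAut (grade k P) (P.weight c)).toLinearMap.rTensor _ t ∈
            tensorGrade (grade k P) (i - 2 + P.genWeight (Sum.inr c : V ⊕ E))) h (by simp) ?_ ?_ ?_
        · intro s t hs ht
          rw [map_add]
          exact add_mem hs ht
        · intro c t ht
          rw [map_smul]
          exact Submodule.smul_mem _ _ ht
        · intro p q hpq u hu v hv
          exact tmul_mem_tensorGrade _ (koszulAut_mem _ _ hu) hv hpq)
    (by rw [← sum_e, map_sum]; simp [brLin_e]) hy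
  rwa [sub_add_eq_add_sub] at this

/-- Reindexing one sum by c ↦ c* matches the summands in pairs, each pair being governed by
`sandwich_skew` and the relation between the signs of c and c*. -/
theorem brLin_skew {i j : ℕ} {x y : PathAlgebra k P} (hx : x ∈ grade k P i)
    (hy : y ∈ grade k P j) :
    U.brLin x y = -((-1 : k) ^ (i * j) • koszulFlip (grade k P) (U.brLin y x)) := by
  rw [U.brLin_apply hx, U.brLin_apply hy, ← Equiv.sum_comp U.perm (fun c => sandwich _ _
    (partialDer k P c x) (U.hamValue c y)), map_sum, Finset.smul_sum, ← Finset.sum_neg_distrib]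
  refine Finset.sum_congr rfl fun c _ => ?_
  have h := sandwich_skew (grade k P) (U.weight_bar_zmod c) (partialDer_mem (k := k) c hy)
    (partialDer_mem (k := k) (U.bar c) hx)
  rw [perm_apply, hamValue_apply, hamValue_apply, U.bar_bar, map_smul, map_smul, map_smul, h,
    U.sign_bar, smul_smul, smul_smul, ← neg_smul]
  congr 1
  rw [pow_add]
  ring

/-- The double bracket. -/
def doubleBracket : GradedDoubleBracket (grade k P) where
  br := U.brLin
  leibniz := U.brLin_mul
  skew := U.brLin_skew
  weight := U.brLin_mem

@[simp] theorem doubleBracket_br : U.doubleBracket.br = U.brLin := rfl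

theorem e_brLin (i : V) (y : PathAlgebra k P) : U.brLin (e k P i) y = 0 := by
  rw [U.brLin_apply (e_mem_grade k P i)]
  simp [hamValue_apply]

theorem brLin_arrow_arrow (a c : E) : U.brLin (arrow k P a) (arrow k P c) =
    if a = U.bar c then U.sign c • e k P (P.head c) ⊗ₜ e k P (P.tail c) else 0 := by
  rw [brLin_arrow, hamValue_apply, partialDer_arrow]
  split_ifs
  · rw [koszulFlip_tmul _ (e_mem_grade k P _) (e_mem_grade k P _), mul_zero, pow_zero, one_smul,
      LinearMap.rTensor_tmul, AlgHom.toLinearMap_apply, koszulAut_e, U.head_bar, U.tail_bar]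
  · simp

/-- A bracket of two generators is zero or a multiple of a tensor of trivial paths, and every
bracket kills trivial paths. Hence each summand of the cyclic form of the Jacobiator vanishes
separately. -/
theorem actL_brLin_gen (x : PathAlgebra k P) (y z : V ⊕ E) :
    U.doubleBracket.actL x (U.doubleBracket.br (gen k P y) (gen k P z)) = 0 := by
  rw [doubleBracket_br]
  rcases y with i | a
  · change U.doubleBracket.actL x (U.brLin (e k P i) _) = 0
    rw [e_brLin, map_zero]
  rcases z with j | b
  · change U.doubleBracket.actL x (U.brLin _ (e k P j)) = 0
    rw [brLin_e, map_zero]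
  change U.doubleBracket.actL x (U.brLin (arrow k P a) (arrow k P b)) = 0
  rw [brLin_arrow_arrow]
  split_ifs
  · rw [map_smul, GradedDoubleBracket.actL_tmul, doubleBracket_br, brLin_e, TensorProduct.zero_tmul,
      smul_zero]
  · rw [map_zero]

theorem isPoisson : U.doubleBracket.IsPoisson := by
  refine GradedDoubleBracket.isPoisson_of_generators _ (gen k P) P.genWeight gen_mem_grade
    linearMap_eq_zero ?_
  intro x y z
  rw [GradedDoubleBracket.jacobiator_eq _ (gen_mem_grade x) (gen_mem_grade y) (gen_mem_grade z)]
  simp only [actL_brLin_gen, map_zero, smul_zero, add_zero]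

end Duality
end GradedQuiver

/-! ### Hamiltonian double derivations -/

theorem koszulSign_smul {k M : Type*} [Field k] [AddCommGroup M] [Module k M] (i j : ℕ × ℕ)
    (x : M) : koszulSign i j • x = (-1 : k) ^ (i.1 * j.1 + i.2 * j.2) • x := by
  rw [koszulSign, ← Int.cast_smul_eq_zsmul k]
  simp

section

variable {k A : Type*} [Field k] [Ring A] [Algebra k A] (𝒜 : ℕ → Submodule k A)
  [GradedAlgebra 𝒜]

theorem signAut_sub_two (w : ℕ) : signAut 𝒜 ((w : ℤ) - 2) = koszulAut 𝒜 w := by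
  refine AlgHom.toLinearMap_injective (linearMap_ext_homogeneous 𝒜 fun i a ha => ?_)
  rw [AlgHom.toLinearMap_apply, AlgHom.toLinearMap_apply, koszulAut, signAut_apply 𝒜 _ ha,
    signAut_apply 𝒜 _ ha, parity_congr (n := (w : ℤ) * i)]
  exact ⟨-i, by ring⟩

/-- This and `lTensor_flip_rTensor` state that the two twisted flips are mutually inverse: one
inversion solves the Hamiltonian equation for Θ(c), the other verifies the solution. -/
theorem rTensor_flip_lTensor (m : ℕ) (t : A ⊗[k] A) :
    (koszulAut 𝒜 m).toLinearMap.rTensor A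
      (koszulFlip 𝒜 ((koszulAut 𝒜 m).toLinearMap.lTensor A (koszulFlip 𝒜 t))) = t := by
  suffices (koszulAut 𝒜 m).toLinearMap.rTensor A ∘ₗ koszulFlip 𝒜 ∘ₗ
      (koszulAut 𝒜 m).toLinearMap.lTensor A ∘ₗ koszulFlip 𝒜 = LinearMap.id from
    LinearMap.congr_fun this t
  refine tensor_ext_homogeneous 𝒜 fun p q u hu v hv => ?_
  simp only [LinearMap.comp_apply, koszulFlip_tmul 𝒜 hu hv, map_smul, LinearMap.lTensor_tmul,
    AlgHom.toLinearMap_apply, koszulFlip_tmul 𝒜 hv (koszulAut_mem 𝒜 m hu), LinearMap.rTensor_tmul,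
    koszulAut_self, smul_smul, mul_comm q p, neg_one_pow_mul_self, one_smul, LinearMap.id_apply]

theorem lTensor_flip_rTensor (m : ℕ) (t : A ⊗[k] A) :
    (koszulAut 𝒜 m).toLinearMap.lTensor A
      (koszulFlip 𝒜 ((koszulAut 𝒜 m).toLinearMap.rTensor A (koszulFlip 𝒜 t))) = t := by
  suffices (koszulAut 𝒜 m).toLinearMap.lTensor A ∘ₗ koszulFlip 𝒜 ∘ₗ
      (koszulAut 𝒜 m).toLinearMap.rTensor A ∘ₗ koszulFlip 𝒜 = LinearMap.id from
    LinearMap.congr_fun this t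
  refine tensor_ext_homogeneous 𝒜 fun p q u hu v hv => ?_
  simp only [LinearMap.comp_apply, koszulFlip_tmul 𝒜 hu hv, map_smul, LinearMap.lTensor_tmul,
    AlgHom.toLinearMap_apply, koszulFlip_tmul 𝒜 (koszulAut_mem 𝒜 m hv) hu, LinearMap.rTensor_tmul,
    koszulAut_self, smul_smul, mul_comm q p, neg_one_pow_mul_self, one_smul, LinearMap.id_apply]

variable (R : Subalgebra k A) [BaseDegreeZero 𝒜 R]

/-- One half of ι_Θ(dx dy), where Θ contracts dx: the reversed multiplication puts dy between the
factors of t = Θ(x). The half where Θ contracts dy is `koszulMul_der_mul`. -/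
theorem koszulMul_mul_der {j : ℕ} {y : A} (hy : y ∈ 𝒜 j) (t : A ⊗[k] A) :
    koszulMul 𝒜 R (TensorProduct.map (Forms.of R).toLinearMap (Forms.of R).toLinearMap t *
      (1 ⊗ₜ Forms.der R y)) = sandwich (Forms.of R) (Forms.of R)
        ((koszulAut 𝒜 j).toLinearMap.lTensor A (koszulFlip 𝒜 t)) (Forms.der R y) := by
  suffices koszulMul 𝒜 R ∘ₗ LinearMap.mulRight k (1 ⊗ₜ Forms.der R y) ∘ₗ
      TensorProduct.map (Forms.of R).toLinearMap (Forms.of R).toLinearMap =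
      (sandwich (Forms.of R) (Forms.of R)).flip (Forms.der R y) ∘ₗ
        (koszulAut 𝒜 j).toLinearMap.lTensor A ∘ₗ koszulFlip 𝒜 from LinearMap.congr_fun this t
  refine tensor_ext_homogeneous 𝒜 fun p q u hu v hv => ?_
  simp only [LinearMap.comp_apply, TensorProduct.map_tmul, LinearMap.mulRight_apply,
    AlgHom.toLinearMap_apply, Algebra.TensorProduct.tmul_mul_tmul, mul_one, LinearMap.flip_apply,
    koszulFlip_tmul 𝒜 hu hv, map_smul, LinearMap.lTensor_tmul, koszulAut_apply 𝒜 _ hu,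
    sandwich_tmul, TensorProduct.tmul_smul, smul_smul]
  rw [koszulMul_tmul 𝒜 R (Forms.of_mem_grade 𝒜 R hu) (SetLike.GradedMul.mul_mem
    (Forms.of_mem_grade 𝒜 R hv) (Forms.der_mem_grade 𝒜 R hy)), koszulSign_smul (k := k), ← pow_add,
    neg_one_pow_eq_of_zmod]
  simp only [Prod.fst_add, Prod.snd_add]
  push_cast
  ring

/-- Here t stands for Θ(y) with |y| = m. The equal parity of m and |x|, true for an arrow and its
reverse, is what allows the same twist as in the other half of the contraction; the leftover sign
-(-1)^|x| comes from passing dx. -/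
theorem koszulMul_der_mul {w i m : ℕ} {x : A} (hx : x ∈ 𝒜 i) (hm : (m : ZMod 2) = i)
    {t : A ⊗[k] A} (ht : t ∈ tensorGrade 𝒜 ((w : ℤ) - 2 + m)) :
    koszulMul 𝒜 R ((DoubleDer.formSign 𝒜 R ((w : ℤ) - 2) (Forms.der R x) ⊗ₜ 1) *
      TensorProduct.map (Forms.of R).toLinearMap (Forms.of R).toLinearMap t) =
      -((-1 : k) ^ i • sandwich (Forms.of R) (Forms.of R)
        ((koszulAut 𝒜 m).toLinearMap.lTensor A (koszulFlip 𝒜 t)) (Forms.der R x)) := by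
  rw [DoubleDer.formSign, Forms.signHom_der, signAut_sub_two, koszulAut_apply 𝒜 w hx, map_smul,
    TensorProduct.neg_tmul, neg_mul, map_neg, ← TensorProduct.smul_tmul', smul_mul_assoc, map_smul]
  congr 1
  refine eqOn_tensorGrade 𝒜 (f := (-1 : k) ^ (w * i) • koszulMul 𝒜 R ∘ₗ
      LinearMap.mulLeft k (Forms.der R x ⊗ₜ 1) ∘ₗ
      TensorProduct.map (Forms.of R).toLinearMap (Forms.of R).toLinearMap)
    (g := (-1 : k) ^ i • (sandwich (Forms.of R) (Forms.of R)).flip (Forms.der R x) ∘ₗ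
        (koszulAut 𝒜 m).toLinearMap.lTensor A ∘ₗ koszulFlip 𝒜) ?_ ht
  intro p q hpq u hu v hv
  simp only [LinearMap.smul_apply, LinearMap.comp_apply, TensorProduct.map_tmul,
    LinearMap.mulLeft_apply, AlgHom.toLinearMap_apply, Algebra.TensorProduct.tmul_mul_tmul, one_mul,
    LinearMap.flip_apply, koszulFlip_tmul 𝒜 hu hv, map_smul, LinearMap.lTensor_tmul,
    koszulAut_apply 𝒜 _ hu, sandwich_tmul, TensorProduct.tmul_smul, smul_smul]
  rw [koszulMul_tmul 𝒜 R (SetLike.GradedMul.mul_mem (Forms.der_mem_grade 𝒜 R hx)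
    (Forms.of_mem_grade 𝒜 R hu)) (Forms.of_mem_grade 𝒜 R hv), koszulSign_smul (k := k), smul_smul,
    ← pow_add, ← pow_add, ← pow_add, neg_one_pow_eq_of_zmod, mul_assoc]
  have h1 : (w : ZMod 2) = p + q + i := by
    have := congrArg (Int.cast : ℤ → ZMod 2) hpq
    push_cast at this
    rw [this, hm, two_eq_zero_zmod_two, sub_zero, add_assoc, CharTwo.add_self_eq_zero, add_zero]
  simp only [Prod.fst_add, Prod.snd_add]
  push_cast
  rw [h1, hm]
  generalize (i : ZMod 2) = i
  generalize (p : ZMod 2) = p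
  generalize (q : ZMod 2) = q
  revert i p q
  decide

end

namespace GradedQuiver

open PathAlgebra

variable {k V E : Type*} [Field k] [Fintype V] {P : GradedQuiver V E}

theorem e_mem_vertexAlgebra (i : V) : e k P i ∈ vertexAlgebra k P :=
  Algebra.subset_adjoin ⟨i, rfl⟩

@[simp] theorem der_e (i : V) : Forms.der (vertexAlgebra k P) (e k P i) = 0 :=
  Forms.der_base (e_mem_vertexAlgebra i)

theorem eq_zero_of_mem_vertexAlgebra {M : Type*} [AddCommGroup M] [Module k M]
    (F : PathAlgebra k P →ₗ[k] M) (he : ∀ i, F (e k P i) = 0)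
    (hmul : ∀ x y, F x = 0 → F y = 0 → F (x * y) = 0) {r : PathAlgebra k P}
    (hr : r ∈ vertexAlgebra k P) : F r = 0 := by
  induction hr using Algebra.adjoin_induction with
  | mem x hx =>
    obtain ⟨i, rfl⟩ := hx
    exact he i
  | algebraMap c => rw [Algebra.algebraMap_eq_smul_one, map_smul, ← sum_e, map_sum]; simp [he]
  | add x y _ _ hx hy => rw [map_add, hx, hy, add_zero]
  | mul x y _ _ hx hy => exact hmul x y hx hy

variable (k P) in
/-- The projection of the forms to the forms of degree `0`. -/
def formsToBase : Forms (vertexAlgebra k P) →ₐ[k] PathAlgebra k P :=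
  Forms.lift (AlgHom.id k _) 0 (by simp) (by simp)

@[simp] theorem formsToBase_of (x : PathAlgebra k P) : formsToBase k P (Forms.of _ x) = x :=
  Forms.lift_of x

@[simp] theorem formsToBase_der (x : PathAlgebra k P) : formsToBase k P (Forms.der _ x) = 0 :=
  Forms.lift_der x

section partialDer

variable [DecidableEq E]

/-- Both sides satisfy the Leibniz rule, so it is enough to look at arrows, where c is written as e
c e with trivial paths on both sides. -/
theorem der_eq_sum [Fintype E] (x : PathAlgebra k P) : Forms.der (vertexAlgebra k P) x =
    ∑ c, sandwich (Forms.of _) (Forms.of _) (partialDer k P c x) (Forms.der _ (arrow k P c)) := by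
  induction x using PathAlgebra.induction with
  | he i => simp
  | harrow a =>
    rw [Finset.sum_eq_single a]
    · rw [partialDer_arrow, if_pos rfl, sandwich_tmul]
      nth_rewrite 1 [← e_head_mul, ← mul_e_tail]
      simp only [Forms.der_mul, der_e, zero_mul, zero_add, mul_zero, add_zero, map_mul, mul_assoc]
    · intro b _ hb
      rw [partialDer_arrow, if_neg hb.symm, map_zero, LinearMap.zero_apply]
    · simp
  | hone => rw [← sum_e, map_sum]; simp
  | hsmul c x hx => simp only [map_smul, hx, Finset.smul_sum, LinearMap.smul_apply]
  | hadd x y hx hy => simp only [map_add, hx, hy, LinearMap.add_apply, Finset.sum_add_distrib]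
  | hmul x y hx hy =>
    simp only [Forms.der_mul, hx, hy, partialDer_mul, map_add, LinearMap.add_apply,
      sandwich_mul_one, sandwich_one_mul, Finset.sum_add_distrib, Finset.sum_mul, Finset.mul_sum]

variable (k P) in
/-- The coefficient of `dc` in a form of degree `1`. -/
def coeff (c : E) : Forms (vertexAlgebra k P) →ₗ[k] PathAlgebra k P ⊗[k] PathAlgebra k P :=
  Forms.twistedDer (Algebra.TensorProduct.includeLeft.comp (formsToBase k P))
    (Algebra.TensorProduct.includeRight.comp (formsToBase k P)) 0 (partialDer k P c)
    (by simp) (fun x y => by simp [partialDer_mul, add_comm])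
    (fun r hr => eq_zero_of_mem_vertexAlgebra _ (partialDer_e c)
      (fun x y hx hy => by rw [partialDer_mul, hx, hy, zero_mul, mul_zero, add_zero]) hr)

theorem coeff_sandwich (c : E) (t : PathAlgebra k P ⊗[k] PathAlgebra k P) (x : PathAlgebra k P) :
    coeff k P c (sandwich (Forms.of _) (Forms.of _) t (Forms.der _ x)) =
      sandwich Algebra.TensorProduct.includeLeft Algebra.TensorProduct.includeRight t
        (partialDer k P c x) := by
  induction t using TensorProduct.induction_on with
  | zero => simp
  | add s t hs ht => simp only [map_add, LinearMap.add_apply, hs, ht]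
  | tmul u v => simp [coeff, Forms.twistedDer_mul]

namespace Duality

variable [Fintype E] (U : P.Duality k)

/-- The trivial paths inserted in the middle are absorbed, because the hypotheses place t in the
corner of c. -/
theorem sandwich_flip_tmul (m : ℕ) (c : E) {t : PathAlgebra k P ⊗[k] PathAlgebra k P}
    (h : (e k P (P.head c) ⊗ₜ 1) * t = t) (h' : t * (1 ⊗ₜ e k P (P.tail c)) = t) :
    sandwich Algebra.TensorProduct.includeLeft Algebra.TensorProduct.includeRight
      ((koszulAut (grade k P) m).toLinearMap.lTensor _ (koszulFlip (grade k P) t))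
      (e k P (P.tail c) ⊗ₜ e k P (P.head c)) =
    (koszulAut (grade k P) m).toLinearMap.lTensor _ (koszulFlip (grade k P) t) := by
  nth_rewrite 2 [← h, ← h']
  suffices (sandwich Algebra.TensorProduct.includeLeft Algebra.TensorProduct.includeRight).flip
      (e k P (P.tail c) ⊗ₜ e k P (P.head c)) ∘ₗ
      (koszulAut (grade k P) m).toLinearMap.lTensor _ ∘ₗ koszulFlip (grade k P) =
      (koszulAut (grade k P) m).toLinearMap.lTensor _ ∘ₗ koszulFlip (grade k P) ∘ₗ
        LinearMap.mulLeft k (e k P (P.head c) ⊗ₜ 1) ∘ₗ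
          LinearMap.mulRight k (1 ⊗ₜ e k P (P.tail c)) from LinearMap.congr_fun this t
  refine tensor_ext_homogeneous (grade k P) fun p q u hu v hv => ?_
  have hu' : e k P (P.head c) * u ∈ grade k P p := by
    simpa using SetLike.GradedMul.mul_mem (e_mem_grade k P (P.head c)) hu
  have hv' : v * e k P (P.tail c) ∈ grade k P q := by
    simpa using SetLike.GradedMul.mul_mem hv (e_mem_grade k P (P.tail c))
  simp [koszulFlip_tmul _ hu hv, koszulFlip_tmul _ hu' hv', koszulAut_e]

/-- The Hamiltonian double derivation of an element of weight `w`. -/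
def hamiltonian {w : ℕ} {x : PathAlgebra k P} (hx : x ∈ grade k P w) :
    DoubleDer (grade k P) (vertexAlgebra k P) ((w : ℤ) - 2) where
  toLin := U.brLin x
  base := fun _ hr => eq_zero_of_mem_vertexAlgebra _ (U.brLin_e x) (fun y z hy hz => by
    rw [U.brLin_mul hx, hy, hz, zero_mul, mul_zero, add_zero]) hr
  leibniz := fun i a ha b => by
    rw [U.brLin_mul hx, ← signAut_sub_two, signAut_apply _ _ ha]
    rcases parity_eq (((w : ℤ) - 2) * i) with h | h <;> simp [h, TensorProduct.neg_tmul]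
  weight := fun i a ha => by
    rw [sub_add_eq_add_sub]
    exact U.brLin_mem hx ha

theorem doubleDer_ext {n : ℤ} {Θ Θ' : DoubleDer (grade k P) (vertexAlgebra k P) n}
    (h : ∀ c, Θ.toLin (arrow k P c) = Θ'.toLin (arrow k P c)) : Θ = Θ' := by
  have : Θ.toLin - Θ'.toLin = 0 := by
    refine linearMap_eq_zero _ ?_ ?_ ?_
    · rintro (i | c)
      · exact sub_eq_zero.mpr ((Θ.base _ (e_mem_vertexAlgebra i)).trans
          (Θ'.base _ (e_mem_vertexAlgebra i)).symm)
      · exact sub_eq_zero.mpr (h c)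
    · rw [LinearMap.sub_apply, Θ.base _ (one_mem _), Θ'.base _ (one_mem _), sub_zero]
    · intro x y hx hy
      rw [LinearMap.sub_apply, sub_eq_zero] at hx hy ⊢
      rw [Θ.leibniz', Θ'.leibniz', hx, hy]
  cases Θ
  cases Θ'
  congr
  exact sub_eq_zero.mp this

/-- The coefficient of dc* in the equation involves only Θ(c); the twisted flip is invertible and
the sign is its own inverse, so Θ(c) is determined. Conversely, for the explicit derivation the
equation is the expansion of dx from `der_eq_sum`. -/
theorem hamiltonian_iff {w : ℕ} {x : PathAlgebra k P} (hx : x ∈ grade k P w)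
    (Θ : DoubleDer (grade k P) (vertexAlgebra k P) ((w : ℤ) - 2)) :
    ∑ c, U.sign c • sandwich (Forms.of _) (Forms.of _)
      ((koszulAut (grade k P) (P.weight c)).toLinearMap.lTensor _
        (koszulFlip (grade k P) (Θ.toLin (arrow k P c))))
          (Forms.der (vertexAlgebra k P) (arrow k P (U.bar c))) = Forms.der _ x ↔
      Θ = U.hamiltonian hx := by
  constructor
  · intro h
    refine doubleDer_ext fun d => ?_
    have h' := congrArg (coeff k P (U.bar d)) h
    rw [map_sum, Finset.sum_eq_single d, map_smul, coeff_sandwich, partialDer_arrow, if_pos rfl,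
      U.head_bar, U.tail_bar, sandwich_flip_tmul] at h'
    · have hcoeff : coeff k P (U.bar d) (Forms.der _ x) = partialDer k P (U.bar d) x := by
        simp [coeff]
      change _ = U.brLin x (arrow k P d)
      rw [brLin_arrow, hamValue_apply, ← hcoeff, ← h', map_smul, map_smul, rTensor_flip_lTensor,
        smul_smul, U.sign_mul_self, one_smul]
    -- Corner condition: Θ(c) = Θ(e c) = e Θ(c), as Θ kills trivial paths. The next case is the same
    -- on the other side.
    · conv_rhs => rw [← e_head_mul, Θ.leibniz', Θ.base _ (e_mem_vertexAlgebra _), zero_mul,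
        zero_add, signAut_sub_two, koszulAut_e]
    · conv_rhs => rw [← mul_e_tail, Θ.leibniz', Θ.base _ (e_mem_vertexAlgebra _), mul_zero,
        add_zero]
    · intro c _ hc
      rw [map_smul, coeff_sandwich, partialDer_arrow, if_neg, map_zero, smul_zero]
      exact fun h => hc (by rw [← U.bar_bar c, h, U.bar_bar])
    · simp
  · rintro rfl
    rw [der_eq_sum x, ← Equiv.sum_comp U.perm (fun c => sandwich _ _ (partialDer k P c x) _)]
    refine Finset.sum_congr rfl fun c _ => ?_
    change U.sign c • sandwich _ _ (LinearMap.lTensor _ _ (koszulFlip _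
      (U.brLin x (arrow k P c)))) _ = _
    rw [brLin_arrow, hamValue_apply, map_smul, map_smul, lTensor_flip_rTensor, map_smul,
      LinearMap.smul_apply, smul_smul, U.sign_mul_self, one_smul]
    rfl

end Duality

end partialDer

/-! ### The canonical form on a weight 2 double. -/

section double

variable (k P) in
/-- The duality of the weight `2` double of a graded quiver. -/
def doubleDuality (hP : ∀ a, P.weight a ≤ 2) : (P.double 2).Duality k where
  bar := Sum.swap
  bar_bar := Sum.swap_swap
  head_bar := by rintro (a | a) <;> rfl
  tail_bar := by rintro (a | a) <;> rfl
  weight_bar := by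
    rintro (a | a)
    · exact Nat.add_sub_of_le (hP a)
    · exact Nat.sub_add_cancel (hP a)
  -- The sign at a* is the one produced when the contraction passes da to reach da*, as in
  -- `koszulMul_der_mul`.
  sign := Sum.elim (fun _ => 1) fun a => -(-1) ^ P.weight a
  sign_bar := by
    rintro (a | a)
    · simp [double]
    · have : (-1 : k) ^ (2 - P.weight a) * (-1) ^ P.weight a = 1 := by
        rw [← pow_add, Nat.sub_add_cancel (hP a)]
        simp
      simp [double, this]
  sign_mul_self := by
    rintro (a | a)
    · simp
    · simp [neg_one_pow_mul_self]

variable [Fintype E]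

/-- Each da da* is contracted at either factor, which accounts for the summands c = a and c = a*. -/
theorem iota_canonicalForm (hP : ∀ a, P.weight a ≤ 2) {w : ℕ}
    (Θ : DoubleDer (grade k (P.double 2)) (vertexAlgebra k (P.double 2)) ((w : ℤ) - 2)) :
    Θ.iota (P.canonicalForm k 2) =
      ∑ c, (doubleDuality k P hP).sign c • sandwich (Forms.of _) (Forms.of _)
        ((koszulAut (grade k (P.double 2)) ((P.double 2).weight c)).toLinearMap.lTensor _
          (koszulFlip (grade k (P.double 2)) (Θ.toLin (arrow k (P.double 2) c))))
        (Forms.der (vertexAlgebra k (P.double 2))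
          (arrow k (P.double 2) ((doubleDuality k P hP).bar c))) := by
  change Θ.reducedContraction _ = _
  rw [map_sum, Fintype.sum_sum_type, ← Finset.sum_add_distrib]
  refine Finset.sum_congr rfl fun a _ => ?_
  have h1 := (doubleDuality k P hP).weight_bar_zmod (Sum.inl a)
  have h2 := arrow_mem_grade k (P.double 2) (Sum.inl a)
  have h3 := arrow_mem_grade k (P.double 2) (Sum.inr a)
  have h4 := koszulMul_der_mul (grade k (P.double 2)) (vertexAlgebra k (P.double 2)) h2 h1
    (Θ.weight _ _ h3)
  have h5 := koszulMul_mul_der (grade k (P.double 2)) (vertexAlgebra k (P.double 2)) h3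
    (Θ.toLin (arrow k (P.double 2) (Sum.inl a)))
  rw [DoubleDer.reducedContraction, LinearMap.comp_apply, DoubleDer.contraction_mul, map_add,
    DoubleDer.contraction_der, DoubleDer.contraction_der, h4, h5, add_comm]
  congr 1
  · change _ = (1 : k) • _
    rw [one_smul]
    have : (koszulAut (grade k (P.double 2)) ((P.double 2).weight (Sum.inr a))).toLinearMap =
        (koszulAut (grade k (P.double 2)) ((P.double 2).weight (Sum.inl a))).toLinearMap :=
      LinearMap.ext fun x => koszulAut_congr _ h1 x
    rw [this]
    rfl
  · exact (neg_smul _ _).symm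

theorem isHamiltonian_canonicalForm_iff [DecidableEq (E ⊕ E)] (hP : ∀ a, P.weight a ≤ 2) {w : ℕ}
    {x : PathAlgebra k (P.double 2)} (hx : x ∈ grade k (P.double 2) w)
    (Θ : DoubleDer (grade k (P.double 2)) (vertexAlgebra k (P.double 2)) ((w : ℤ) - 2)) :
    IsHamiltonian (P.canonicalForm k 2) x Θ ↔ Θ = (doubleDuality k P hP).hamiltonian hx := by
  rw [IsHamiltonian, iota_canonicalForm hP, Duality.hamiltonian_iff]

/-- The derivation chosen in the definition of the bracket is forced by uniqueness, and the
contributions of the homogeneous parts of x add up by linearity. -/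
theorem doubleBracket_canonicalForm [DecidableEq (E ⊕ E)] (hP : ∀ a, P.weight a ≤ 2)
    (x y : PathAlgebra k (P.double 2)) :
    _root_.doubleBracket (P.canonicalForm k 2) 2 x y = (doubleDuality k P hP).brLin x y := by
  classical
  rw [_root_.doubleBracket]
  conv_rhs => rw [← DirectSum.sum_support_decompose (grade k (P.double 2)) x, map_sum,
    LinearMap.sum_apply]
  refine Finset.sum_congr (by congr!) fun w _ => ?_
  have hx : (DirectSum.decompose (grade k (P.double 2)) x w : PathAlgebra k (P.double 2)) ∈
      grade k (P.double 2) w := SetLike.coe_mem _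
  have h : ∃ Θ : DoubleDer (grade k (P.double 2)) (vertexAlgebra k (P.double 2)) ((w : ℤ) - 2),
      IsHamiltonian (P.canonicalForm k 2)
        (DirectSum.decompose (grade k (P.double 2)) x w : PathAlgebra k (P.double 2)) Θ :=
    ⟨_, (isHamiltonian_canonicalForm_iff hP hx _).mpr rfl⟩
  have h' := (isHamiltonian_canonicalForm_iff hP hx _).mp h.choose_spec
  rw [_root_.hamiltonian]
  refine (congrArg (fun Θ => DoubleDer.toLin Θ y) ((dif_pos h).trans h')).trans ?_
  rfl

end double

end GradedQuiver

/-! ### Morphisms and word gradings -/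

section WordGradingMap

variable {k ι X A C : Type*} [Field k] [AddCommMonoid ι] [Ring A] [Algebra k A] [Ring C]
  [Algebra k C] {gen : X → A} {deg : X → ι}

theorem map_mem_of_wordGrading {ι' : Type*} [AddCommMonoid ι'] {𝒞 : ι' → Submodule k C}
    [SetLike.GradedMonoid 𝒞] (g : ι →+ ι') (f : A →ₐ[k] C) (h : ∀ x, f (gen x) ∈ 𝒞 (g (deg x)))
    {i : ι} {a : A} (ha : a ∈ wordGrading k gen deg i) : f a ∈ 𝒞 (g i) := by
  induction ha using Submodule.span_induction with
  | zero => simp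
  | add x y _ _ hx hy => rw [map_add]; exact add_mem hx hy
  | smul c x _ hx => rw [map_smul]; exact Submodule.smul_mem _ _ hx
  | mem x hx =>
    obtain ⟨l, rfl, rfl⟩ := hx
    induction l with
    | nil => simpa using SetLike.GradedOne.one_mem
    | cons y l ih =>
      simp only [List.map_cons, List.prod_cons, List.sum_cons, map_mul, map_add]
      exact SetLike.GradedMul.mul_mem (h y) ih

/-- A word of nonzero degree contains a letter of nonzero degree, and f kills that letter. -/
theorem map_eq_zero_of_wordGrading (g : ι →+ ℕ) (f : A →ₐ[k] C)
    (h : ∀ x, g (deg x) ≠ 0 → f (gen x) = 0) {i : ι} (hi : g i ≠ 0) {a : A}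
    (ha : a ∈ wordGrading k gen deg i) : f a = 0 := by
  induction ha using Submodule.span_induction with
  | zero => simp
  | add x y _ _ hx hy => rw [map_add, hx, hy, add_zero]
  | smul c x _ hx => rw [map_smul, hx, smul_zero]
  | mem x hx =>
    obtain ⟨l, rfl, rfl⟩ := hx
    induction l with
    | nil => simp at hi
    | cons y l ih =>
      simp only [List.map_cons, List.prod_cons, List.sum_cons, map_mul, map_add] at hi ⊢
      by_cases hy : g (deg y) = 0
      · rw [ih (by omega), mul_zero]
      · rw [h y hy, zero_mul]

end WordGradingMap

/-! ### Functoriality of forms and their commutators. -/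

namespace Forms

variable {k A C : Type*} [Field k] [Ring A] [Algebra k A] [Ring C] [Algebra k C]
  {R : Subalgebra k A} {R' : Subalgebra k C}

@[simp] theorem map_of (f : A →ₐ[k] C) (hf : ∀ r ∈ R, f r ∈ R') (a : A) :
    map f hf (of R a) = of R' (f a) := lift_of a

@[simp] theorem map_der (f : A →ₐ[k] C) (hf : ∀ r ∈ R, f r ∈ R') (a : A) :
    map f hf (der R a) = der R' (f a) := lift_der a

theorem map_sgn (f : A →ₐ[k] C) (hf : ∀ r ∈ R, f r ∈ R') (x : Forms R) :
    map f hf (sgn R x) = sgn R' (map f hf x) := by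
  have : (map f hf).comp (sgn R) = (sgn R').comp (map f hf) :=
    algHom_ext (fun a => by simp) (fun a => by simp)
  exact congrArg (fun g => g x) this

theorem map_d (f : A →ₐ[k] C) (hf : ∀ r ∈ R, f r ∈ R') (x : Forms R) :
    map f hf (d R x) = d R' (map f hf x) := by
  induction x using induction with
  | h0 a => simp
  | h1 a => simp
  | hadd x y hx hy => simp only [map_add, hx, hy]
  | hmul x y hx hy => simp only [d_mul, map_add, map_mul, hx, hy, map_sgn]

variable {𝒜 : ℕ → Submodule k A} {𝒞 : ℕ → Submodule k C}

theorem map_mem_grade (f : A →ₐ[k] C) (hf : ∀ r ∈ R, f r ∈ R')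
    (hw : ∀ w, ∀ a ∈ 𝒜 w, f a ∈ 𝒞 w) {i : ℕ × ℕ} {x : Forms R} (hx : x ∈ grade 𝒜 R i) :
    map f hf x ∈ grade 𝒞 R' i := by
  refine map_mem_of_wordGrading (AddMonoidHom.id _) (map f hf) ?_ hx
  rintro ⟨⟨w, a⟩, b⟩
  cases b
  · exact (map_of f hf (a : A)).symm ▸ of_mem_grade 𝒞 R' (hw w a a.2)
  · exact (map_der f hf (a : A)).symm ▸ der_mem_grade 𝒞 R' (hw w a a.2)

theorem map_mem_formCommutators (f : A →ₐ[k] C) (hf : ∀ r ∈ R, f r ∈ R')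
    (hw : ∀ w, ∀ a ∈ 𝒜 w, f a ∈ 𝒞 w) {x : Forms R} (hx : x ∈ formCommutators 𝒜 R) :
    map f hf x ∈ formCommutators 𝒞 R' := by
  suffices formCommutators 𝒜 R ≤ (formCommutators 𝒞 R').comap (map f hf).toLinearMap from this hx
  refine Submodule.span_le.mpr ?_
  rintro _ ⟨i, j, α, hα, β, hβ, rfl⟩
  refine Submodule.subset_span ⟨i, j, _, map_mem_grade f hf hw hα, _, map_mem_grade f hf hw hβ, ?_⟩
  simp

end Forms

namespace GradedQuiver

open PathAlgebra

variable {k V E : Type*} [Field k] [Fintype V] {P : GradedQuiver V E}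

/-- A form of degree `0` is a sum of commutators of forms if and only if it is a sum of graded
commutators in the algebra. -/
theorem mk_of_eq_zero_iff (x : PathAlgebra k P) :
    DR.mk (grade k P) (vertexAlgebra k P) (Forms.of _ x) = 0 ↔
      x ∈ gradedCommutators (grade k P) := by
  rw [Submodule.mkQ_apply, Submodule.Quotient.mk_eq_zero]
  constructor
  · intro h
    suffices formCommutators (grade k P) (vertexAlgebra k P) ≤
        (gradedCommutators (grade k P)).comap (formsToBase k P).toLinearMap by
      simpa using this h
    have h0 : ∀ {i : ℕ × ℕ} {α : Forms (vertexAlgebra k P)},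
        α ∈ Forms.grade (grade k P) (vertexAlgebra k P) i → i.2 ≠ 0 → formsToBase k P α = 0 := by
      intro i α hα hi
      refine map_eq_zero_of_wordGrading (AddMonoidHom.snd ℕ ℕ) _ ?_ hi hα
      rintro ⟨⟨w, a⟩, b⟩ h
      cases b
      · exact (h rfl).elim
      · exact formsToBase_der (a : PathAlgebra k P)
    have h1 : ∀ {i : ℕ × ℕ} {α : Forms (vertexAlgebra k P)},
        α ∈ Forms.grade (grade k P) (vertexAlgebra k P) i → formsToBase k P α ∈ grade k P i.1 := by
      intro i α hα
      refine map_mem_of_wordGrading (AddMonoidHom.fst ℕ ℕ) _ ?_ hα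
      rintro ⟨⟨w, a⟩, b⟩
      cases b
      · exact (formsToBase_of (a : PathAlgebra k P)).symm ▸ a.2
      · exact (formsToBase_der (a : PathAlgebra k P)).symm ▸ zero_mem _
    refine Submodule.span_le.mpr ?_
    rintro _ ⟨i, j, α, hα, β, hβ, rfl⟩
    change formsToBase k P _ ∈ gradedCommutators (grade k P)
    rw [koszulSign_smul (k := k), map_sub, map_smul, map_mul, map_mul]
    -- In positive form degree both products are killed by the projection; in degree 0 the bigraded
    -- sign reduces to the sign of the weights.
    by_cases hi : i.2 = 0
    · exact Submodule.subset_span ⟨i.1, j.1, _, h1 hα, _, h1 hβ, by rw [hi, zero_mul, add_zero]⟩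
    · rw [h0 hα hi]
      simp
  · intro h
    suffices gradedCommutators (grade k P) ≤ (formCommutators (grade k P)
        (vertexAlgebra k P)).comap (Forms.of (vertexAlgebra k P)).toLinearMap from this h
    refine Submodule.span_le.mpr ?_
    rintro _ ⟨i, j, a, ha, b, hb, rfl⟩
    refine Submodule.subset_span ⟨(i, 0), (j, 0), _, Forms.of_mem_grade _ _ ha, _,
      Forms.of_mem_grade _ _ hb, ?_⟩
    rw [koszulSign_smul (k := k)]
    simp

end GradedQuiver

/-! ### The standard graded quiver -/

namespace PlainQuiver

open GradedQuiver.PathAlgebra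

variable {V E : Type*} (k : Type*) [Field k] [Fintype V] (Q : PlainQuiver V E)

/-- The arrow `â*` of weight `1`, in `A`. -/
def hatStar (a : E) : A k Q := arrow k _ (Sum.inr (Sum.inr a))

theorem hat_mem (a : E) : hat k Q a ∈ gradeA k Q 1 :=
  GradedQuiver.arrow_mem_grade k (Q.hatted.double 2) (Sum.inl (Sum.inr a))

theorem star_mem (a : E) : star k Q a ∈ gradeA k Q 2 :=
  GradedQuiver.arrow_mem_grade k (Q.hatted.double 2) (Sum.inr (Sum.inl a))

theorem e_mem (i : V) : e k (Q.hatted.double 2) i ∈ gradeA k Q 0 :=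
  GradedQuiver.e_mem_grade k (Q.hatted.double 2) i

theorem hatted_weight_le (a : E ⊕ E) : Q.hatted.weight a ≤ 2 := by
  rcases a with a | a
  · exact Nat.zero_le 2
  · exact Nat.le_succ 1

theorem eq_zero_of_mem_gradeB {w : ℕ} (hw : w ≠ 0) {b : B k Q} (hb : b ∈ gradeB k Q w) : b = 0 := by
  -- The criterion is applied to the identity morphism: no generator of B has nonzero weight, so its
  -- hypothesis is empty.
  refine map_eq_zero_of_wordGrading (AddMonoidHom.id ℕ) (AlgHom.id k _) ?_ hw hb
  rintro (i | a) h
  · exact (h rfl).elim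
  · exact (h rfl).elim

theorem mem_gradeB (b : B k Q) : b ∈ gradeB k Q 0 := by
  induction b using GradedQuiver.PathAlgebra.induction with
  | he i => exact GradedQuiver.e_mem_grade k _ i
  | harrow a => exact GradedQuiver.arrow_mem_grade k Q.toGraded a
  | hone => exact SetLike.GradedOne.one_mem
  | hsmul c x hx => exact Submodule.smul_mem _ _ hx
  | hadd x y hx hy => exact add_mem hx hy
  | hmul x y hx hy =>
    have h := SetLike.GradedMul.mul_mem hx hy
    rwa [add_zero] at h

theorem eq_zero_of_mem_gradeForms {i : ℕ × ℕ} (hi : i.1 ≠ 0) {α : Forms (baseB k Q)}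
    (hα : α ∈ Forms.grade (gradeB k Q) (baseB k Q) i) : α = 0 := by
  refine map_eq_zero_of_wordGrading (AddMonoidHom.fst ℕ ℕ) (AlgHom.id k _) ?_ hi hα
  rintro ⟨⟨w, a, ha⟩, b⟩ h
  obtain rfl := eq_zero_of_mem_gradeB k Q h ha
  cases b <;> simp [Forms.gen]

@[simp] theorem lam_of (b : B k Q) : lam k Q (Forms.of _ b) = incl k Q b := Forms.lift_of b
@[simp] theorem lam_der (b : B k Q) : lam k Q (Forms.der _ b) = hatDer k Q b := Forms.lift_der b

theorem hatDer_mem (b : B k Q) : hatDer k Q b ∈ gradeA k Q 1 := by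
  induction b using GradedQuiver.PathAlgebra.induction with
  | he i => rw [hatDer_base k Q _ (GradedQuiver.e_mem_vertexAlgebra i)]; exact zero_mem _
  | harrow a => rw [hatDer_arrow]; exact hat_mem k Q a
  | hone => rw [hatDer_base k Q _ (one_mem _)]; exact zero_mem _
  | hsmul c x hx => rw [map_smul]; exact Submodule.smul_mem _ _ hx
  | hadd x y hx hy => rw [map_add]; exact add_mem hx hy
  | hmul x y hx hy =>
    rw [hatDer_mul]
    exact add_mem (by simpa using SetLike.GradedMul.mul_mem hx (incl_mem_grade k Q y))
      (by simpa using SetLike.GradedMul.mul_mem (incl_mem_grade k Q x) hy)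

/-- The morphism λ trades form degree for weight, since db has degree 1 and goes to weight 1 while B
has weight 0. -/
theorem lam_mem {i : ℕ × ℕ} {α : Forms (baseB k Q)}
    (hα : α ∈ Forms.grade (gradeB k Q) (baseB k Q) i) : lam k Q α ∈ gradeA k Q i.2 := by
  refine map_mem_of_wordGrading (AddMonoidHom.snd ℕ ℕ) (lam k Q) ?_ hα
  rintro ⟨⟨w, a, ha⟩, b⟩
  cases b
  · exact (lam_of k Q a).symm ▸ incl_mem_grade k Q a
  · exact (lam_der k Q a).symm ▸ hatDer_mem k Q a

/-- The retraction `A → B` that kills the arrows of positive weight. -/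
def retract : A k Q →ₐ[k] B k Q :=
  lift (e k _) (Sum.elim (Sum.elim (arrow k _) 0) 0) e_mul_self (fun _ _ h => e_mul_e h) sum_e
    (by
      rintro ((a | a) | a)
      · exact e_head_mul (P := Q.toGraded) a
      · simp
      · simp)
    (by
      rintro ((a | a) | a)
      · exact mul_e_tail (P := Q.toGraded) a
      · simp
      · simp)

@[simp] theorem retract_e (i : V) : retract k Q (e k _ i) = e k _ i := lift_e i
@[simp] theorem retract_arr (a : E) : retract k Q (arr k Q a) = arrow k _ a := lift_arrow _
@[simp] theorem retract_hat (a : E) : retract k Q (hat k Q a) = 0 := lift_arrow _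
@[simp] theorem retract_star (a : E) : retract k Q (star k Q a) = 0 := lift_arrow _
@[simp] theorem retract_hatStar (a : E) : retract k Q (hatStar k Q a) = 0 := lift_arrow _

@[simp] theorem retract_incl (b : B k Q) : retract k Q (incl k Q b) = b := by
  induction b using GradedQuiver.PathAlgebra.induction with
  | he i => simp
  | harrow a => simp
  | hone => simp
  | hsmul c x hx => rw [map_smul, map_smul, hx]
  | hadd x y hx hy => rw [map_add, map_add, hx, hy]
  | hmul x y hx hy => rw [map_mul, map_mul, hx, hy]

theorem retract_mem {w : ℕ} {x : A k Q} (hx : x ∈ gradeA k Q w) :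
    retract k Q x ∈ gradeB k Q w := by
  refine map_mem_of_wordGrading (AddMonoidHom.id ℕ) (retract k Q) ?_ hx
  rintro (i | (a | a) | a | a)
  · exact (retract_e k Q i).symm ▸ GradedQuiver.e_mem_grade k _ i
  · exact (retract_arr k Q a).symm ▸ GradedQuiver.arrow_mem_grade k Q.toGraded a
  · exact (retract_hat k Q a).symm ▸ zero_mem _
  · exact (retract_star k Q a).symm ▸ zero_mem _
  · exact (retract_hatStar k Q a).symm ▸ zero_mem _

theorem retract_eq_zero {w : ℕ} (hw : w ≠ 0) {x : A k Q} (hx : x ∈ gradeA k Q w) :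
    retract k Q x = 0 := eq_zero_of_mem_gradeB k Q hw (retract_mem k Q hx)

theorem retract_base (r : A k Q) (hr : r ∈ baseA k Q) : retract k Q r ∈ baseB k Q := by
  induction hr using Algebra.adjoin_induction with
  | mem x hx =>
    obtain ⟨i, rfl⟩ := hx
    rw [retract_e]
    exact GradedQuiver.e_mem_vertexAlgebra i
  | algebraMap c => rw [AlgHom.commutes]; exact Subalgebra.algebraMap_mem _ c
  | add x y _ _ hx hy => rw [map_add]; exact add_mem hx hy
  | mul x y _ _ hx hy => rw [map_mul]; exact mul_mem hx hy

theorem incl_mem {w : ℕ} {b : B k Q} (hb : b ∈ gradeB k Q w) : incl k Q b ∈ gradeA k Q w := by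
  rcases eq_or_ne w 0 with rfl | hw
  · exact incl_mem_grade k Q b
  · rw [eq_zero_of_mem_gradeB k Q hw hb, map_zero]
    exact zero_mem _

/-- The retraction `A → Ω_R B` of `λ`. -/
def toForms : A k Q →ₐ[k] Forms (baseB k Q) :=
  lift (fun i => Forms.of _ (e k _ i))
    (Sum.elim (Sum.elim (fun a => Forms.of _ (arrow k _ a)) (fun a => Forms.der _ (arrow k _ a))) 0)
    (fun i => by rw [← map_mul, e_mul_self])
    (fun i j h => by rw [← map_mul, e_mul_e h, map_zero])
    (by rw [← map_sum, sum_e, map_one])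
    (by
      rintro ((a | a) | a)
      · exact (map_mul _ _ _).symm.trans (congrArg _ (e_head_mul (P := Q.toGraded) a))
      · have h := Forms.der_mul (R := baseB k Q) (e k _ (Q.toGraded.head a)) (arrow k _ a)
        rw [e_head_mul, GradedQuiver.der_e, zero_mul, zero_add] at h
        exact h.symm
      · simp)
    (by
      rintro ((a | a) | a)
      · exact (map_mul _ _ _).symm.trans (congrArg _ (mul_e_tail (P := Q.toGraded) a))
      · have h := Forms.der_mul (R := baseB k Q) (arrow k _ a) (e k _ (Q.toGraded.tail a))
        rw [mul_e_tail, GradedQuiver.der_e, mul_zero, add_zero] at h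
        exact h.symm
      · simp)

@[simp] theorem toForms_e (i : V) : toForms k Q (e k _ i) = Forms.of _ (e k _ i) := lift_e i
@[simp] theorem toForms_arr (a : E) : toForms k Q (arr k Q a) = Forms.of _ (arrow k _ a) :=
  lift_arrow _
@[simp] theorem toForms_hat (a : E) : toForms k Q (hat k Q a) = Forms.der _ (arrow k _ a) :=
  lift_arrow _
@[simp] theorem toForms_star (a : E) : toForms k Q (star k Q a) = 0 := lift_arrow _
@[simp] theorem toForms_hatStar (a : E) : toForms k Q (hatStar k Q a) = 0 := lift_arrow _

theorem toForms_mem {w : ℕ} {x : A k Q} (hx : x ∈ gradeA k Q w) :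
    toForms k Q x ∈ Forms.grade (gradeB k Q) (baseB k Q) (0, w) := by
  refine map_mem_of_wordGrading (AddMonoidHom.inr ℕ ℕ) (toForms k Q) ?_ hx
  rintro (i | (a | a) | a | a)
  · exact (toForms_e k Q i).symm ▸ Forms.of_mem_grade _ _ (mem_gradeB k Q _)
  · exact (toForms_arr k Q a).symm ▸ Forms.of_mem_grade _ _ (mem_gradeB k Q _)
  · exact (toForms_hat k Q a).symm ▸ Forms.der_mem_grade _ _ (mem_gradeB k Q _)
  · exact (toForms_star k Q a).symm ▸ zero_mem _
  · exact (toForms_hatStar k Q a).symm ▸ zero_mem _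

theorem toForms_incl (b : B k Q) : toForms k Q (incl k Q b) = Forms.of _ b := by
  induction b using GradedQuiver.PathAlgebra.induction with
  | he i => simp
  | harrow a => simp
  | hone => simp
  | hsmul c x hx => rw [map_smul, map_smul, map_smul, hx]
  | hadd x y hx hy => rw [map_add, map_add, map_add, hx, hy]
  | hmul x y hx hy => rw [map_mul, map_mul, map_mul, hx, hy]

theorem toForms_hatDer (b : B k Q) : toForms k Q (hatDer k Q b) = Forms.der _ b := by
  induction b using GradedQuiver.PathAlgebra.induction with
  | he i => rw [hatDer_base k Q _ (GradedQuiver.e_mem_vertexAlgebra i)]; simp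
  | harrow a => simp
  | hone => rw [hatDer_base k Q _ (one_mem _), Forms.der_base (one_mem _), map_zero]
  | hsmul c x hx => rw [map_smul, map_smul, map_smul, hx]
  | hadd x y hx hy => rw [map_add, map_add, map_add, hx, hy]
  | hmul x y hx hy =>
    rw [hatDer_mul, Forms.der_mul, map_add, map_mul, map_mul, hx, hy, toForms_incl, toForms_incl]

theorem toForms_lam (α : Forms (baseB k Q)) : toForms k Q (lam k Q α) = α := by
  have : (toForms k Q).comp (lam k Q) = AlgHom.id k _ :=
    Forms.algHom_ext (fun b => by simp [toForms_incl]) (fun b => by simp [toForms_hatDer])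
  exact congrArg (fun g => g α) this

/-- Both λ and its retraction `toForms` preserve commutators: forms on B have weight 0, so their
Koszul sign depends only on form degree, and this is the weight in A. -/
theorem lam_mem_gradedCommutators_iff (α : Forms (baseB k Q)) :
    lam k Q α ∈ gradedCommutators (gradeA k Q) ↔ α ∈ formCommutators (gradeB k Q) (baseB k Q) := by
  constructor
  · intro h
    suffices gradedCommutators (gradeA k Q) ≤
        (formCommutators (gradeB k Q) (baseB k Q)).comap (toForms k Q).toLinearMap by
      have h' := this h
      rwa [Submodule.mem_comap, AlgHom.toLinearMap_apply, toForms_lam] at h'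
    refine Submodule.span_le.mpr ?_
    rintro _ ⟨i, j, a, ha, b, hb, rfl⟩
    refine Submodule.subset_span ⟨_, _, _, toForms_mem k Q ha, _, toForms_mem k Q hb, ?_⟩
    rw [koszulSign_smul (k := k)]
    simp
  · intro h
    suffices formCommutators (gradeB k Q) (baseB k Q) ≤
        (gradedCommutators (gradeA k Q)).comap (lam k Q).toLinearMap from this h
    refine Submodule.span_le.mpr ?_
    rintro _ ⟨i, j, α, hα, β, hβ, rfl⟩
    change lam k Q _ ∈ gradedCommutators (gradeA k Q)
    rw [koszulSign_smul (k := k), map_sub, map_smul, map_mul, map_mul]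
    by_cases hi : i.1 = 0
    · exact Submodule.subset_span ⟨i.2, j.2, _, lam_mem k Q hα, _, lam_mem k Q hβ,
        by rw [hi, zero_mul, zero_add]⟩
    · rw [eq_zero_of_mem_gradeForms k Q hi hα]
      simp

theorem d_mk_eq_zero_iff_forms (φ : Forms (baseB k Q)) :
    DR.d (gradeB k Q) (baseB k Q) (DR.mk (gradeB k Q) (baseB k Q) φ) = 0 ↔
      Forms.d _ φ ∈ formCommutators (gradeB k Q) (baseB k Q) := by
  rw [Submodule.mkQ_apply, DR.d, Submodule.mapQ_apply, Submodule.Quotient.mk_eq_zero]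

/-- The inclusion B → A and the retraction A → B induce maps of forms that preserve commutators. The
inclusion commutes with d, and the composite on Ω B is the identity, so dφ is a commutator sum in
one place exactly when it is in the other. -/
theorem d_mk_eq_zero_iff_incl (φ : Forms (baseB k Q)) :
    DR.d (gradeB k Q) (baseB k Q) (DR.mk (gradeB k Q) (baseB k Q) φ) = 0 ↔
      DR.d (gradeA k Q) (baseA k Q) (DR.mk (gradeA k Q) (baseA k Q) (inclForms k Q φ)) = 0 := by
  rw [d_mk_eq_zero_iff_forms, Submodule.mkQ_apply, DR.d, Submodule.mapQ_apply,
    Submodule.Quotient.mk_eq_zero, inclForms, ← Forms.map_d]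
  constructor
  · exact Forms.map_mem_formCommutators _ _ fun w b hb => incl_mem k Q hb
  · intro h
    have h' := Forms.map_mem_formCommutators (retract k Q) (retract_base k Q)
      (fun w x hx => retract_mem k Q hx) h
    have : (Forms.map (retract k Q) (retract_base k Q)).comp
        (Forms.map (incl k Q) (incl_base k Q)) = AlgHom.id k _ :=
      Forms.algHom_ext (fun b => by simp) (fun b => by simp)
    have h2 := congrArg (fun g => g (Forms.d _ φ)) this
    exact h2 ▸ h'

end PlainQuiver

/-! ### Brackets with the standard and the deformed Hamiltonian. -/

namespace PlainQuiver

open GradedQuiver GradedQuiver.PathAlgebra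

variable {V E : Type*} (k : Type*) [Field k] [Fintype V] (Q : PlainQuiver V E) [Fintype E]
  [DecidableEq E]

/-- The duality of the arrows of the standard graded quiver. -/
abbrev duality : (Q.hatted.double 2).Duality k := doubleDuality k Q.hatted (hatted_weight_le Q)

/-- The double bracket of `ω₀` as a graded double bracket. -/
abbrev bracket : GradedDoubleBracket (gradeA k Q) := (duality k Q).doubleBracket

theorem dbr_eq (x y : A k Q) : dbr k Q x y = (bracket k Q).br x y :=
  doubleBracket_canonicalForm (hatted_weight_le Q) x y

theorem br_eq (x y : A k Q) : br k Q x y = (bracket k Q).assoc x y :=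
  congrArg (LinearMap.mul' k (A k Q)) (dbr_eq k Q x y)

theorem bracket_e (x : A k Q) (i : V) : (bracket k Q).br x (e k _ i) = 0 :=
  (duality k Q).brLin_e x i

theorem bracket_arrow (x : A k Q) (c : (E ⊕ E) ⊕ E ⊕ E) : (bracket k Q).br x (arrow k _ c) =
    (duality k Q).sign c • (koszulAut (gradeA k Q) ((Q.hatted.double 2).weight c)).toLinearMap.rTensor
      _ (koszulFlip (gradeA k Q) (partialDer k _ (Sum.swap c) x)) :=
  (duality k Q).brLin_arrow x c

theorem assoc_e (x : A k Q) (i : V) : (bracket k Q).assoc x (e k _ i) = 0 := by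
  rw [GradedDoubleBracket.assoc_apply, bracket_e, map_zero]

theorem partialDer_star (c : (E ⊕ E) ⊕ E ⊕ E) (a : E) : partialDer k _ c (star k Q a) =
    if Sum.inr (Sum.inl a) = c then e k _ ((Q.hatted.double 2).head c) ⊗ₜ
      e k _ ((Q.hatted.double 2).tail c) else 0 := partialDer_arrow _ _

theorem partialDer_hat (c : (E ⊕ E) ⊕ E ⊕ E) (a : E) : partialDer k _ c (hat k Q a) =
    if Sum.inl (Sum.inr a) = c then e k _ ((Q.hatted.double 2).head c) ⊗ₜ
      e k _ ((Q.hatted.double 2).tail c) else 0 := partialDer_arrow _ _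

theorem partialDer_arr (c : (E ⊕ E) ⊕ E ⊕ E) (a : E) : partialDer k _ c (arr k Q a) =
    if Sum.inl (Sum.inl a) = c then e k _ ((Q.hatted.double 2).head c) ⊗ₜ
      e k _ ((Q.hatted.double 2).tail c) else 0 := partialDer_arrow _ _

theorem stdHamiltonian_mem : stdHamiltonian k Q ∈ gradeA k Q 3 :=
  Submodule.sum_mem _ fun a _ => by
    have h := SetLike.GradedMul.mul_mem (star_mem k Q a) (hat_mem k Q a)
    rwa [show 2 + 1 = 3 from rfl] at h

/-- Only ∂_{a*} S₀ enters ⦃S₀, a⦄, and a* occurs in S₀ only in the summand a* â. -/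
theorem assoc_std_arr (a : E) :
    (bracket k Q).assoc (stdHamiltonian k Q) (arr k Q a) = hat k Q a := by
  rw [GradedDoubleBracket.assoc_apply, arr, bracket_arrow]
  have : partialDer k _ (Sum.inr (Sum.inl a)) (stdHamiltonian k Q) =
      e k _ (Q.tail a) ⊗ₜ hat k Q a := by
    rw [stdHamiltonian, map_sum, Finset.sum_eq_single a]
    · rw [partialDer_mul, partialDer_star, partialDer_hat, if_pos rfl, if_neg (by simp), mul_zero,
        add_zero, Algebra.TensorProduct.tmul_mul_tmul, mul_one]
      exact congrArg _ (e_head_hat k Q a)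
    · intro b _ hb
      rw [partialDer_mul, partialDer_star, partialDer_hat, if_neg (by simpa using hb),
        if_neg (by simp)]
      simp
    · simp
  change LinearMap.mul' k _ ((1 : k) • (koszulAut (gradeA k Q) 0).toLinearMap.rTensor
    _ (koszulFlip (gradeA k Q) (partialDer k _ (Sum.inr (Sum.inl a)) (stdHamiltonian k Q)))) = _
  rw [this, koszulFlip_tmul _ (e_mem k Q _) (hat_mem k Q a)]
  simp only [zero_mul, pow_zero, one_smul, LinearMap.rTensor_tmul, AlgHom.toLinearMap_apply,
    koszulAut_zero, LinearMap.mul'_apply]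
  exact hat_e_tail k Q a

/-- The bracket with a* involves ∂_a S₀, and a does not occur in S₀. In `assoc_std_hat` the arrow
that does not occur is â*. -/
theorem assoc_std_star (a : E) :
    (bracket k Q).assoc (stdHamiltonian k Q) (star k Q a) = 0 := by
  have : partialDer k _ (Sum.inl (Sum.inl a)) (stdHamiltonian k Q) = 0 := by
    rw [stdHamiltonian, map_sum]
    refine Finset.sum_eq_zero fun b _ => ?_
    rw [partialDer_mul, partialDer_star, partialDer_hat, if_neg (by simp), if_neg (by simp)]
    simp
  rw [GradedDoubleBracket.assoc_apply, star, bracket_arrow, Sum.swap_inr, this]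
  simp

theorem assoc_std_hat (a : E) :
    (bracket k Q).assoc (stdHamiltonian k Q) (hat k Q a) = 0 := by
  have : partialDer k _ (Sum.inr (Sum.inr a)) (stdHamiltonian k Q) = 0 := by
    rw [stdHamiltonian, map_sum]
    refine Finset.sum_eq_zero fun b _ => ?_
    rw [partialDer_mul, partialDer_star, partialDer_hat, if_neg (by simp), if_neg (by simp)]
    simp
  rw [GradedDoubleBracket.assoc_apply, hat, bracket_arrow, Sum.swap_inl, this]
  simp

theorem assoc_std_std :
    (bracket k Q).assoc (stdHamiltonian k Q) (stdHamiltonian k Q) = 0 := by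
  nth_rewrite 2 [stdHamiltonian]
  rw [map_sum]
  refine Finset.sum_eq_zero fun a _ => ?_
  rw [GradedDoubleBracket.assoc_mul _ (stdHamiltonian_mem k Q), assoc_std_star, assoc_std_hat,
    zero_mul, mul_zero, add_zero]

/-- Under λ the parity of the weight is the parity of the form degree, so the Leibniz signs of {S₀,
-} and of d agree. -/
theorem koszulAut_lam (α : Forms (baseB k Q)) :
    koszulAut (gradeA k Q) 3 (lam k Q α) = lam k Q (Forms.sgn _ α) := by
  have : (koszulAut (gradeA k Q) 3).comp (lam k Q) = (lam k Q).comp (Forms.sgn _) :=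
    Forms.algHom_ext
      (fun b => by simp [koszulAut_of_zero _ _ (incl_mem_grade k Q b)])
      (fun b => by simp [koszulAut_apply _ _ (hatDer_mem k Q b), Odd.neg_one_pow (n := 3) ⟨1, rfl⟩])
  exact congrArg (fun g => g α) this

theorem assoc_one {i : ℕ} {x : A k Q} (hx : x ∈ gradeA k Q i) : (bracket k Q).assoc x 1 = 0 := by
  rw [GradedDoubleBracket.assoc_apply, GradedDoubleBracket.br_one _ hx, map_zero]

theorem assoc_std_incl (b : B k Q) :
    (bracket k Q).assoc (stdHamiltonian k Q) (incl k Q b) = hatDer k Q b := by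
  induction b using GradedQuiver.PathAlgebra.induction with
  | he i => rw [incl_e, assoc_e, hatDer_base k Q _ (e_mem_vertexAlgebra i)]
  | harrow a => rw [incl_arrow, hatDer_arrow, assoc_std_arr]
  | hone => rw [map_one, assoc_one k Q (stdHamiltonian_mem k Q), hatDer_base k Q _ (one_mem _)]
  | hsmul c x hx => rw [map_smul, map_smul, map_smul, hx]
  | hadd x y hx hy => rw [map_add, map_add, map_add, hx, hy]
  | hmul x y hx hy =>
    rw [map_mul, GradedDoubleBracket.assoc_mul _ (stdHamiltonian_mem k Q), hx, hy, hatDer_mul,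
      koszulAut_of_zero _ _ (incl_mem_grade k Q x)]

theorem assoc_std_hatDer (b : B k Q) :
    (bracket k Q).assoc (stdHamiltonian k Q) (hatDer k Q b) = 0 := by
  induction b using GradedQuiver.PathAlgebra.induction with
  | he i => rw [hatDer_base k Q _ (e_mem_vertexAlgebra i), map_zero]
  | harrow a => rw [hatDer_arrow, assoc_std_hat]
  | hone => rw [hatDer_base k Q _ (one_mem _), map_zero]
  | hsmul c x hx => rw [map_smul, map_smul, hx, smul_zero]
  | hadd x y hx hy => rw [map_add, map_add, hx, hy, add_zero]
  | hmul x y hx hy =>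
    rw [hatDer_mul, map_add, GradedDoubleBracket.assoc_mul _ (stdHamiltonian_mem k Q),
      GradedDoubleBracket.assoc_mul _ (stdHamiltonian_mem k Q), hx, hy, assoc_std_incl,
      assoc_std_incl, koszulAut_apply _ _ (hatDer_mem k Q x), Odd.neg_one_pow (n := 3 * 1) ⟨1, rfl⟩]
    simp

/-- Both {S₀, -} and d are odd derivations, and they agree on generators: a goes to â and â goes to
0. -/
theorem assoc_std_lam (α : Forms (baseB k Q)) :
    (bracket k Q).assoc (stdHamiltonian k Q) (lam k Q α) = lam k Q (Forms.d _ α) := by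
  induction α using Forms.induction with
  | h0 b => simp [assoc_std_incl]
  | h1 b => simp [assoc_std_hatDer]
  | hadd x y hx hy => simp only [map_add, hx, hy]
  | hmul x y hx hy =>
    rw [map_mul, GradedDoubleBracket.assoc_mul _ (stdHamiltonian_mem k Q), hx, hy, Forms.d_mul,
      map_add, map_mul, map_mul, koszulAut_lam, add_comm]

/-- The image of λ is generated by trivial paths and the arrows a, â; no reversed arrow occurs in
it. -/
theorem partialDer_inr_lam (c : E ⊕ E) (α : Forms (baseB k Q)) :
    partialDer k (Q.hatted.double 2) (Sum.inr c) (lam k Q α) = 0 := by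
  have h0 : ∀ b, partialDer k (Q.hatted.double 2) (Sum.inr c) (incl k Q b) = 0 := by
    intro b
    induction b using GradedQuiver.PathAlgebra.induction with
    | he i => rw [incl_e, partialDer_e]
    | harrow a => rw [incl_arrow, partialDer_arr, if_neg (by simp)]
    | hone => rw [map_one, partialDer_one]
    | hsmul c x hx => rw [map_smul, map_smul, hx, smul_zero]
    | hadd x y hx hy => rw [map_add, map_add, hx, hy, add_zero]
    | hmul x y hx hy => rw [map_mul, partialDer_mul, hx, hy, zero_mul, mul_zero, add_zero]
  have h1 : ∀ b, partialDer k (Q.hatted.double 2) (Sum.inr c) (hatDer k Q b) = 0 := by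
    intro b
    induction b using GradedQuiver.PathAlgebra.induction with
    | he i => rw [hatDer_base k Q _ (e_mem_vertexAlgebra i), map_zero]
    | harrow a => rw [hatDer_arrow, partialDer_hat, if_neg (by simp)]
    | hone => rw [hatDer_base k Q _ (one_mem _), map_zero]
    | hsmul c x hx => rw [map_smul, map_smul, hx, smul_zero]
    | hadd x y hx hy => rw [map_add, map_add, hx, hy, add_zero]
    | hmul x y hx hy =>
      rw [hatDer_mul, map_add, partialDer_mul, partialDer_mul, hx, hy, h0, h0]
      simp
  induction α using Forms.induction with
  | h0 b => rw [lam_of, h0]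
  | h1 b => rw [lam_der, h1]
  | hadd x y hx hy => rw [map_add, map_add, hx, hy, add_zero]
  | hmul x y hx hy => rw [map_mul, partialDer_mul, hx, hy, zero_mul, mul_zero, add_zero]

variable {k Q} {φ : Forms (baseB k Q)}

theorem lam_mem_three (hφ : φ ∈ Forms.grade (gradeB k Q) (baseB k Q) (0, 3)) :
    lam k Q φ ∈ gradeA k Q 3 := by
  have h := lam_mem k Q hφ
  rwa [show ((0, 3) : ℕ × ℕ).2 = 3 from rfl] at h

theorem deformedHamiltonian_mem (hφ : φ ∈ Forms.grade (gradeB k Q) (baseB k Q) (0, 3)) :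
    deformedHamiltonian k Q φ ∈ gradeA k Q 3 :=
  Submodule.add_mem _ (stdHamiltonian_mem k Q) (lam_mem_three hφ)

/-- Each summand of the bracket combines ∂_c with ∂_{c*}, and one of c, c* is a reversed arrow. -/
theorem bracket_lam_lam (hφ : φ ∈ Forms.grade (gradeB k Q) (baseB k Q) (0, 3))
    (α : Forms (baseB k Q)) : (bracket k Q).br (lam k Q φ) (lam k Q α) = 0 := by
  rw [Duality.doubleBracket_br, Duality.brLin_apply _ (lam_mem_three hφ)]
  refine Finset.sum_eq_zero fun c _ => ?_
  rcases c with c | c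
  · rw [Duality.hamValue_apply]
    change sandwich _ _ _ (_ • LinearMap.rTensor _ _ (koszulFlip _
      (partialDer k (Q.hatted.double 2) (Sum.inr c) (lam k Q φ)))) = 0
    rw [partialDer_inr_lam]
    simp
  · rw [partialDer_inr_lam]
    simp

/-- In the expansion of {S_φ, S_φ} the terms {S₀, S₀} and {λφ, λφ} vanish, and {S₀, λφ} = λ(dφ).
Both entries having odd weight, ⦃λφ, S₀⦄ is the signed flip of ⦃S₀, λφ⦄ with sign +1, so {λφ, S₀} is
again λ(dφ) modulo commutators. -/
theorem assoc_deformed_sub_mem (hφ : φ ∈ Forms.grade (gradeB k Q) (baseB k Q) (0, 3)) :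
    (2 : k) • lam k Q (Forms.d _ φ) -
      (bracket k Q).assoc (deformedHamiltonian k Q φ) (deformedHamiltonian k Q φ) ∈
        gradedCommutators (gradeA k Q) := by
  have h := mul'_koszulFlip_sub_mem (gradeA k Q) ((bracket k Q).br (stdHamiltonian k Q) (lam k Q φ))
  have h' := (bracket k Q).skew (lam_mem_three hφ) (stdHamiltonian_mem k Q)
  have h0 := assoc_std_lam k Q φ
  have h1 := assoc_std_std k Q
  rw [Odd.neg_one_pow (n := 3 * 3) ⟨4, rfl⟩, neg_smul, one_smul, neg_neg] at h'
  rw [GradedDoubleBracket.assoc_apply] at h0 h1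
  rw [← h', h0] at h
  convert h using 1
  rw [GradedDoubleBracket.assoc_apply, deformedHamiltonian]
  simp only [map_add, LinearMap.add_apply, h0, h1, bracket_lam_lam hφ, map_zero, two_smul]
  abel

/-- Characteristic 0 serves to divide 2λ(dφ) by 2. -/
theorem assoc_deformed_mem_iff [CharZero k]
    (hφ : φ ∈ Forms.grade (gradeB k Q) (baseB k Q) (0, 3)) :
    (bracket k Q).assoc (deformedHamiltonian k Q φ) (deformedHamiltonian k Q φ) ∈
        gradedCommutators (gradeA k Q) ↔
      DR.d (gradeB k Q) (baseB k Q) (DR.mk (gradeB k Q) (baseB k Q) φ) = 0 := by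
  rw [d_mk_eq_zero_iff_forms, ← lam_mem_gradedCommutators_iff,
    ← Submodule.smul_mem_iff (gradedCommutators (gradeA k Q)) (two_ne_zero (α := k))
      (x := lam k Q (Forms.d _ φ))]
  have h := assoc_deformed_sub_mem hφ
  constructor
  · intro h'
    simpa using add_mem h h'
  · intro h'
    simpa using sub_mem h' h

end PlainQuiver

/-! ### The bimodule of elements of weight `1` -/

section

variable {k A : Type*} [Field k] [Ring A] [Algebra k A] {𝒜 : ℕ → Submodule k A} [GradedAlgebra 𝒜]

theorem tensorGrade_eq_zero {n : ℤ} (hn : n < 0) {t : A ⊗[k] A} (ht : t ∈ tensorGrade 𝒜 n) :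
    t = 0 :=
  eqOn_tensorGrade 𝒜 (f := LinearMap.id) (g := 0) (fun i j h => by omega) ht

theorem GradedDoubleBracket.br_eq_zero (D : GradedDoubleBracket 𝒜) {i j : ℕ} {x y : A}
    (hx : x ∈ 𝒜 i) (hy : y ∈ 𝒜 j) (h : i + j < 2) : D.br x y = 0 :=
  tensorGrade_eq_zero (by omega) (D.weight hx hy)

theorem koszulAut_two (x : A) : koszulAut 𝒜 2 x = x := by
  rw [koszulAut_congr 𝒜 (m := 2) (n := 0) (by simpa using two_eq_zero_zmod_two), koszulAut_zero]

end

namespace GradedQuiver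

open PathAlgebra

variable {k V E : Type*} [Field k] [Fintype V] {P : GradedQuiver V E} [DecidableEq E] [Fintype E]

/-- Euler's formula. -/
theorem sum_weight_smul_sandwich {w : ℕ} {x : PathAlgebra k P} (hx : x ∈ grade k P w) :
    ∑ c, P.weight c • sandwich (AlgHom.id k _) (AlgHom.id k _) (partialDer k P c x) (arrow k P c) =
      w • x := by
  set F : PathAlgebra k P →ₗ[k] PathAlgebra k P := ∑ c, P.weight c •
    (sandwich (AlgHom.id k _) (AlgHom.id k _)).flip (arrow k P c) ∘ₗ partialDer k P c with hF
  have hFx : ∀ x, F x = ∑ c, P.weight c • sandwich (AlgHom.id k _) (AlgHom.id k _)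
      (partialDer k P c x) (arrow k P c) := fun x => by simp [hF, LinearMap.sum_apply]
  have hmul : ∀ x y, F (x * y) = F x * y + x * F y := by
    intro x y
    simp only [hFx, partialDer_mul, map_add, LinearMap.add_apply, sandwich_mul_one,
      sandwich_one_mul, smul_add, Finset.sum_add_distrib, Finset.sum_mul, Finset.mul_sum,
      smul_mul_assoc, mul_smul_comm, AlgHom.id_apply]
  have hgen : ∀ y, F (gen k P y) = P.genWeight y • gen k P y := by
    rintro (i | a)
    · change F (e k P i) = 0 • _
      simp [hFx]
    · change F (arrow k P a) = P.weight a • arrow k P a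
      rw [hFx, Finset.sum_eq_single a]
      · rw [partialDer_arrow, if_pos rfl, sandwich_tmul, AlgHom.id_apply, AlgHom.id_apply,
          e_head_mul, mul_e_tail]
      · intro b _ hb
        rw [partialDer_arrow, if_neg hb.symm, map_zero, LinearMap.zero_apply, smul_zero]
      · simp
  rw [← hFx]
  -- From here on only two facts about F matter: it is a derivation, and it multiplies each
  -- generator by its weight.
  clear_value F
  induction hx using Submodule.span_induction with
  | zero => simp
  | add x y _ _ hx hy => rw [map_add, hx, hy, smul_add]
  | smul c x _ hx => rw [map_smul, hx, smul_comm]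
  | mem x hx =>
    obtain ⟨l, rfl, rfl⟩ := hx
    induction l with
    | nil => simpa using hmul 1 1
    | cons y l ih =>
      simp only [List.map_cons, List.prod_cons, List.sum_cons, hmul, hgen, ih, add_smul,
        smul_mul_assoc, mul_smul_comm]

end GradedQuiver

namespace PlainQuiver

open GradedQuiver GradedQuiver.PathAlgebra

variable {V E : Type*} (k : Type*) [Field k] [Fintype V] (Q : PlainQuiver V E)

variable {k Q} in
-- A word of weight 0 involves only trivial paths and the arrows a, and these come from B.
theorem incl_retract {x : A k Q} (hx : x ∈ gradeA k Q 0) : incl k Q (retract k Q x) = x := by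
  induction hx using Submodule.span_induction with
  | zero => simp
  | add x y _ _ hx hy => rw [map_add, map_add, hx, hy]
  | smul c x _ hx => rw [map_smul, map_smul, hx]
  | mem x hx =>
    obtain ⟨l, hl, rfl⟩ := hx
    induction l with
    | nil => simp
    | cons y l ih =>
      simp only [List.map_cons, List.prod_cons, List.sum_cons, map_mul] at hl ⊢
      rw [ih (by omega)]
      congr 1
      rcases y with i | (a | a) | a | a
      · change incl k Q (retract k Q (e k _ i)) = e k _ i
        simp
      · change incl k Q (retract k Q (arr k Q a)) = arr k Q a
        simp
      · have : (1 : ℕ) + (l.map (Q.hatted.double 2).genWeight).sum = 0 := hl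
        omega
      · have : (2 : ℕ) + (l.map (Q.hatted.double 2).genWeight).sum = 0 := hl
        omega
      · have : (1 : ℕ) + (l.map (Q.hatted.double 2).genWeight).sum = 0 := hl
        omega

/-- The retraction `A → B` as a linear map. -/
abbrev rB : A k Q →ₗ[k] B k Q := (retract k Q).toLinearMap

/-- The inclusion `B → A` as a linear map. -/
abbrev iB : B k Q →ₗ[k] A k Q := (incl k Q).toLinearMap

/-- The projection of `A` onto the elements of weight `1`. -/
def rE : A k Q →ₗ[k] E1 k Q :=
  Forms.ofHomogeneous (gradeA k Q) fun w =>
    if h : w = 1 then (LinearMap.id : gradeA k Q 1 →ₗ[k] gradeA k Q 1) ∘ₗ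
      (Submodule.inclusion (h ▸ le_rfl : gradeA k Q w ≤ gradeA k Q 1)) else 0

variable {k Q}

theorem rE_of_mem {x : A k Q} (hx : x ∈ gradeA k Q 1) : E1.val k Q (rE k Q x) = x := by
  rw [rE, Forms.ofHomogeneous_apply _ _ hx, dif_pos rfl]
  rfl

theorem rE_eq_zero {w : ℕ} (hw : w ≠ 1) {x : A k Q} (hx : x ∈ gradeA k Q w) : rE k Q x = 0 := by
  rw [rE, Forms.ofHomogeneous_apply _ _ hx, dif_neg hw]
  rfl

@[simp] theorem rE_val (x : E1 k Q) : rE k Q (E1.val k Q x) = x :=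
  E1.val_injective (rE_of_mem (E1.val_mem x))

@[simp] theorem rE_incl (b : B k Q) : rE k Q (incl k Q b) = 0 :=
  rE_eq_zero zero_ne_one (incl_mem_grade k Q b)

@[simp] theorem retract_val (x : E1 k Q) : retract k Q (E1.val k Q x) = 0 :=
  retract_eq_zero k Q one_ne_zero (E1.val_mem x)

@[simp] theorem koszulAut_incl (n : ℕ) (b : B k Q) :
    koszulAut (gradeA k Q) n (incl k Q b) = incl k Q b :=
  koszulAut_of_zero _ n (incl_mem_grade k Q b)

theorem koszulAut_val_of_odd {n : ℕ} (hn : Odd n) (x : E1 k Q) :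
    koszulAut (gradeA k Q) n (E1.val k Q x) = -E1.val k Q x := by
  rw [koszulAut_apply _ n (E1.val_mem x), mul_one, hn.neg_one_pow, neg_one_smul]

theorem incl_mul_mem (b : B k Q) {w : ℕ} {x : A k Q} (hx : x ∈ gradeA k Q w) :
    incl k Q b * x ∈ gradeA k Q w := by
  have h := SetLike.GradedMul.mul_mem (incl_mem_grade k Q b) hx
  rwa [zero_add] at h

theorem mul_incl_mem (b : B k Q) {w : ℕ} {x : A k Q} (hx : x ∈ gradeA k Q w) :
    x * incl k Q b ∈ gradeA k Q w := by
  have h := SetLike.GradedMul.mul_mem hx (incl_mem_grade k Q b)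
  rwa [add_zero] at h

theorem rE_incl_mul (b : B k Q) (x : A k Q) : rE k Q (incl k Q b * x) = b • rE k Q x := by
  suffices rE k Q ∘ₗ LinearMap.mulLeft k (incl k Q b) = Algebra.lsmul k k (E1 k Q) b ∘ₗ rE k Q from
    LinearMap.congr_fun this x
  refine linearMap_ext_homogeneous (gradeA k Q) fun w x hx => ?_
  change rE k Q (incl k Q b * x) = b • rE k Q x
  rcases eq_or_ne w 1 with rfl | hw
  · refine E1.val_injective ?_
    rw [rE_of_mem (incl_mul_mem b hx), E1.val_smul, rE_of_mem hx]
  · rw [rE_eq_zero hw (incl_mul_mem b hx), rE_eq_zero hw hx, smul_zero]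

theorem rE_mul_incl (b : B k Q) (x : A k Q) :
    rE k Q (x * incl k Q b) = MulOpposite.op b • rE k Q x := by
  suffices rE k Q ∘ₗ LinearMap.mulRight k (incl k Q b) =
      Algebra.lsmul k k (E1 k Q) (MulOpposite.op b) ∘ₗ rE k Q from LinearMap.congr_fun this x
  refine linearMap_ext_homogeneous (gradeA k Q) fun w x hx => ?_
  change rE k Q (x * incl k Q b) = MulOpposite.op b • rE k Q x
  rcases eq_or_ne w 1 with rfl | hw
  · refine E1.val_injective ?_
    rw [rE_of_mem (mul_incl_mem b hx), E1.val_op_smul, rE_of_mem hx, MulOpposite.unop_op]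
  · rw [rE_eq_zero hw (mul_incl_mem b hx), rE_eq_zero hw hx, smul_zero]

theorem map_incl_retract {n : ℤ} (hn : n = 0) {t : A k Q ⊗[k] A k Q}
    (ht : t ∈ tensorGrade (gradeA k Q) n) :
    TensorProduct.map (iB k Q) (iB k Q) (TensorProduct.map (rB k Q) (rB k Q) t) = t := by
  refine eqOn_tensorGrade (gradeA k Q) (f := TensorProduct.map (iB k Q) (iB k Q) ∘ₗ
    TensorProduct.map (rB k Q) (rB k Q)) (g := LinearMap.id) ?_ ht
  intro i j hij u hu v hv
  obtain rfl : i = 0 := by omega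
  obtain rfl : j = 0 := by omega
  simp [incl_retract hu, incl_retract hv]

/-- The weights of the factors can only be (1, 0) or (0, 1), and each of the two projections kills
the other part. This is the source of the two components of the Dorfman bracket. -/
theorem map_val_rE {n : ℤ} (hn : n = 1) {t : A k Q ⊗[k] A k Q}
    (ht : t ∈ tensorGrade (gradeA k Q) n) :
    TensorProduct.map (E1.val k Q) (iB k Q) (TensorProduct.map (rE k Q) (rB k Q) t) +
      TensorProduct.map (iB k Q) (E1.val k Q) (TensorProduct.map (rB k Q) (rE k Q) t) = t := by
  refine eqOn_tensorGrade (gradeA k Q) (f := TensorProduct.map (E1.val k Q) (iB k Q) ∘ₗ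
    TensorProduct.map (rE k Q) (rB k Q) + TensorProduct.map (iB k Q) (E1.val k Q) ∘ₗ
    TensorProduct.map (rB k Q) (rE k Q)) (g := LinearMap.id) ?_ ht
  intro i j hij u hu v hv
  obtain ⟨rfl, rfl⟩ | ⟨rfl, rfl⟩ : i = 1 ∧ j = 0 ∨ i = 0 ∧ j = 1 := by omega
  · simp [incl_retract hv, rE_of_mem hu, retract_eq_zero k Q one_ne_zero hu]
  · simp [incl_retract hu, rE_of_mem hv, retract_eq_zero k Q one_ne_zero hv]

/-! Compatibility of the projections with the bimodule structures. -/

section outer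

variable {X Y : Type*} [AddCommGroup X] [AddCommGroup Y] [Module k X] [Module k Y]

theorem map_outer [Module (B k Q) X] [IsScalarTower k (B k Q) X] [Module (B k Q)ᵐᵒᵖ Y]
    [IsScalarTower k (B k Q)ᵐᵒᵖ Y] {f : A k Q →ₗ[k] X} {g : A k Q →ₗ[k] Y}
    (hf : ∀ b x, f (incl k Q b * x) = b • f x)
    (hg : ∀ b x, g (x * incl k Q b) = MulOpposite.op b • g x) (b c : B k Q)
    (t : A k Q ⊗[k] A k Q) :
    TensorProduct.map f g ((incl k Q b ⊗ₜ 1) * t * (1 ⊗ₜ incl k Q c)) =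
      outerAct k b c (TensorProduct.map f g t) := by
  induction t using TensorProduct.induction_on with
  | zero => simp
  | add s t hs ht => simp only [mul_add, add_mul, map_add, hs, ht]
  | tmul u v => simp [outerAct, hf, hg]

theorem map_inner [Module (B k Q)ᵐᵒᵖ X] [IsScalarTower k (B k Q)ᵐᵒᵖ X] [Module (B k Q) Y]
    [IsScalarTower k (B k Q) Y] {f : A k Q →ₗ[k] X} {g : A k Q →ₗ[k] Y}
    (hf : ∀ b x, f (x * incl k Q b) = MulOpposite.op b • f x)
    (hg : ∀ b x, g (incl k Q b * x) = b • g x) (b c : B k Q)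
    (t : A k Q ⊗[k] A k Q) :
    TensorProduct.map f g ((1 ⊗ₜ incl k Q b) * t * (incl k Q c ⊗ₜ 1)) =
      innerAct k b c (TensorProduct.map f g t) := by
  induction t using TensorProduct.induction_on with
  | zero => simp
  | add s t hs ht => simp only [mul_add, add_mul, map_add, hs, ht]
  | tmul u v => simp [innerAct, hf, hg]

theorem rB_incl_mul (b : B k Q) (x : A k Q) : rB k Q (incl k Q b * x) = b • rB k Q x := by
  simp

theorem rB_mul_incl (b : B k Q) (x : A k Q) :
    rB k Q (x * incl k Q b) = MulOpposite.op b • rB k Q x := by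
  simp

end outer

end PlainQuiver

/-! ### The derived brackets -/

namespace PlainQuiver

open GradedQuiver GradedQuiver.PathAlgebra

variable {V E : Type*} (k : Type*) [Field k] [Fintype V] (Q : PlainQuiver V E) [Fintype E]
  [DecidableEq E]

theorem isPoisson : (bracket k Q).IsPoisson := (duality k Q).isPoisson

/-- The inner product `⟨e, e'⟩ = ⦃e, e'⦄`. -/
def pairing : E1 k Q →ₗ[k] E1 k Q →ₗ[k] B k Q ⊗[k] B k Q :=
  ((bracket k Q).br.compl₁₂ (E1.val k Q) (E1.val k Q)).compr₂
    (TensorProduct.map (rB k Q) (rB k Q))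

variable {k Q} (S : A k Q)

/-- The anchor `ρ(e)(b) = ⦃{S, e}, b⦄`. -/
def anchor : E1 k Q →ₗ[k] B k Q →ₗ[k] B k Q ⊗[k] B k Q :=
  ((bracket k Q).br.compl₁₂ ((bracket k Q).assoc S ∘ₗ E1.val k Q) (iB k Q)).compr₂
    (TensorProduct.map (rB k Q) (rB k Q))

/-- The map `b ↦ {S, b}`. -/
def coanchor : B k Q →ₗ[k] E1 k Q := rE k Q ∘ₗ (bracket k Q).assoc S ∘ₗ iB k Q

/-- The component in `A¹ ⊗ B` of `⦃{S, e}, e'⦄`. -/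
def dorfmanL : E1 k Q →ₗ[k] E1 k Q →ₗ[k] E1 k Q ⊗[k] B k Q :=
  ((bracket k Q).br.compl₁₂ ((bracket k Q).assoc S ∘ₗ E1.val k Q) (E1.val k Q)).compr₂
    (TensorProduct.map (rE k Q) (rB k Q))

/-- The component in `B ⊗ A¹` of `⦃{S, e}, e'⦄`. -/
def dorfmanR : E1 k Q →ₗ[k] E1 k Q →ₗ[k] B k Q ⊗[k] E1 k Q :=
  ((bracket k Q).br.compl₁₂ ((bracket k Q).assoc S ∘ₗ E1.val k Q) (E1.val k Q)).compr₂
    (TensorProduct.map (rB k Q) (rE k Q))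

theorem pairing_apply (e e' : E1 k Q) : pairing k Q e e' = TensorProduct.map (rB k Q) (rB k Q)
    ((bracket k Q).br (E1.val k Q e) (E1.val k Q e')) := rfl

theorem anchor_apply (e : E1 k Q) (b : B k Q) : anchor S e b =
    TensorProduct.map (rB k Q) (rB k Q)
      ((bracket k Q).br ((bracket k Q).assoc S (E1.val k Q e)) (incl k Q b)) := rfl

theorem dorfmanL_apply (e e' : E1 k Q) : dorfmanL S e e' =
    TensorProduct.map (rE k Q) (rB k Q)
      ((bracket k Q).br ((bracket k Q).assoc S (E1.val k Q e)) (E1.val k Q e')) := rfl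

theorem dorfmanR_apply (e e' : E1 k Q) : dorfmanR S e e' =
    TensorProduct.map (rB k Q) (rE k Q)
      ((bracket k Q).br ((bracket k Q).assoc S (E1.val k Q e)) (E1.val k Q e')) := rfl

theorem map_pairing (e e' : E1 k Q) : TensorProduct.map (iB k Q) (iB k Q) (pairing k Q e e') =
    (bracket k Q).br (E1.val k Q e) (E1.val k Q e') :=
  map_incl_retract (by norm_num) ((bracket k Q).weight (E1.val_mem e) (E1.val_mem e'))

variable {S}

theorem assoc_val_mem (hS : S ∈ gradeA k Q 3) (e : E1 k Q) :
    (bracket k Q).assoc S (E1.val k Q e) ∈ gradeA k Q 2 :=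
  (bracket k Q).assoc_mem hS (E1.val_mem e) rfl

theorem assoc_incl_mem (hS : S ∈ gradeA k Q 3) (b : B k Q) :
    (bracket k Q).assoc S (incl k Q b) ∈ gradeA k Q 1 :=
  (bracket k Q).assoc_mem hS (incl_mem_grade k Q b) rfl

theorem val_coanchor (hS : S ∈ gradeA k Q 3) (b : B k Q) :
    E1.val k Q (coanchor S b) = (bracket k Q).assoc S (incl k Q b) :=
  rE_of_mem (assoc_incl_mem hS b)

theorem map_anchor (hS : S ∈ gradeA k Q 3) (e : E1 k Q) (b : B k Q) :
    TensorProduct.map (iB k Q) (iB k Q) (anchor S e b) =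
      (bracket k Q).br ((bracket k Q).assoc S (E1.val k Q e)) (incl k Q b) :=
  map_incl_retract (by norm_num) ((bracket k Q).weight (assoc_val_mem hS e) (incl_mem_grade k Q b))

theorem map_dorfman (hS : S ∈ gradeA k Q 3) (e e' : E1 k Q) :
    TensorProduct.map (E1.val k Q) (iB k Q) (dorfmanL S e e') +
      TensorProduct.map (iB k Q) (E1.val k Q) (dorfmanR S e e') =
      (bracket k Q).br ((bracket k Q).assoc S (E1.val k Q e)) (E1.val k Q e') :=
  map_val_rE (by norm_num) ((bracket k Q).weight (assoc_val_mem hS e) (E1.val_mem e'))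

/-! Linearity. -/

theorem br_outer {i : ℕ} {x : A k Q} (hx : x ∈ gradeA k Q i) {b c : B k Q}
    (hb : (bracket k Q).br x (incl k Q b) = 0) (hc : (bracket k Q).br x (incl k Q c) = 0)
    (v : A k Q) : (bracket k Q).br x (incl k Q b * (v * incl k Q c)) =
      (incl k Q b ⊗ₜ 1) * (bracket k Q).br x v * (1 ⊗ₜ incl k Q c) := by
  rw [(bracket k Q).leibniz hx, (bracket k Q).leibniz hx, hb, hc, zero_mul, mul_zero, zero_add,
    add_zero, koszulAut_incl, mul_assoc]

/-- Since y has weight less than 2, ⦃b, y⦄ has negative weight and vanishes. So linearity in the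
first argument holds over all of B, not only over R. -/
theorem br_inner {i j : ℕ} {v y : A k Q} (hv : v ∈ gradeA k Q i) (hy : y ∈ gradeA k Q j)
    (hj : j < 2) (b c : B k Q) : (bracket k Q).br (incl k Q b * (v * incl k Q c)) y =
      (1 ⊗ₜ incl k Q b) * (bracket k Q).br v y * (incl k Q c ⊗ₜ 1) := by
  have h0 : ∀ b : B k Q, (bracket k Q).br (incl k Q b) y = 0 := fun b =>
    (bracket k Q).br_eq_zero (incl_mem_grade k Q b) hy (by omega)
  have h1 : (koszulAut (gradeA k Q) 0).toLinearMap = LinearMap.id :=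
    LinearMap.ext (koszulAut_zero _)
  rw [(bracket k Q).br_mul_left (incl_mem_grade k Q b) (mul_incl_mem c hv),
    (bracket k Q).br_mul_left hv (incl_mem_grade k Q c), koszulAut_apply _ i hy, map_smul, h0, h0,
    h1, koszulAut_zero]
  simp [mul_assoc]

theorem br_val_incl (e : E1 k Q) (b : B k Q) :
    (bracket k Q).br (E1.val k Q e) (incl k Q b) = 0 :=
  (bracket k Q).br_eq_zero (E1.val_mem e) (incl_mem_grade k Q b) (by omega)

theorem br_incl_val (b : B k Q) (e : E1 k Q) :
    (bracket k Q).br (incl k Q b) (E1.val k Q e) = 0 :=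
  (bracket k Q).br_eq_zero (incl_mem_grade k Q b) (E1.val_mem e) (by omega)

theorem br_base {i : ℕ} {x : A k Q} (hx : x ∈ gradeA k Q i) {r : B k Q} (hr : r ∈ baseB k Q) :
    (bracket k Q).br x (incl k Q r) = 0 := by
  refine eq_zero_of_mem_vertexAlgebra ((bracket k Q).br x ∘ₗ iB k Q) (fun i => ?_) ?_ hr
  · change (bracket k Q).br x (incl k Q (e k _ i)) = 0
    rw [incl_e, bracket_e]
  · intro y z hy hz
    change (bracket k Q).br x (incl k Q y) = 0 at hy
    change (bracket k Q).br x (incl k Q z) = 0 at hz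
    change (bracket k Q).br x (incl k Q (y * z)) = 0
    rw [map_mul, (bracket k Q).leibniz hx, hy, hz, zero_mul, mul_zero, add_zero]

theorem assoc_base {i : ℕ} {x : A k Q} (hx : x ∈ gradeA k Q i) {r : B k Q} (hr : r ∈ baseB k Q) :
    (bracket k Q).assoc x (incl k Q r) = 0 := by
  rw [GradedDoubleBracket.assoc_apply, br_base hx hr, map_zero]

theorem pairing_outer (b c : B k Q) (e e' : E1 k Q) :
    pairing k Q e (b • MulOpposite.op c • e') = outerAct k b c (pairing k Q e e') := by
  rw [pairing_apply, E1.val_smul, E1.val_op_smul, MulOpposite.unop_op,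
    br_outer (E1.val_mem e) (br_val_incl e b) (br_val_incl e c),
    map_outer rB_incl_mul rB_mul_incl]
  rfl

theorem pairing_inner (b c : B k Q) (e e' : E1 k Q) :
    pairing k Q (b • MulOpposite.op c • e) e' = innerAct k b c (pairing k Q e e') := by
  rw [pairing_apply, E1.val_smul, E1.val_op_smul, MulOpposite.unop_op,
    br_inner (E1.val_mem e) (E1.val_mem e') (by omega), map_inner rB_mul_incl rB_incl_mul]
  rfl

theorem map_incl_leibniz (t s : B k Q ⊗[k] B k Q) (x y : B k Q) :
    TensorProduct.map (rB k Q) (rB k Q) (TensorProduct.map (iB k Q) (iB k Q) t *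
      (1 ⊗ₜ incl k Q y) + (incl k Q x ⊗ₜ 1) * TensorProduct.map (iB k Q) (iB k Q) s) =
      outerAct k 1 y t + outerAct k x 1 s := by
  rw [map_add]
  congr 1
  · induction t using TensorProduct.induction_on with
    | zero => simp
    | add s t hs ht => simp only [map_add, add_mul, hs, ht]
    | tmul p q => simp [outerAct]
  · induction s using TensorProduct.induction_on with
    | zero => simp
    | add s t hs ht => simp only [map_add, mul_add, hs, ht]
    | tmul p q => simp [outerAct]

theorem anchor_leibniz (hS : S ∈ gradeA k Q 3) (e : E1 k Q) (x y : B k Q) :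
    anchor S e (x * y) = outerAct k 1 y (anchor S e x) + outerAct k x 1 (anchor S e y) := by
  rw [← map_incl_leibniz, map_anchor hS, map_anchor hS, anchor_apply, map_mul,
    (bracket k Q).leibniz (assoc_val_mem hS e), koszulAut_incl]

theorem anchor_base (hS : S ∈ gradeA k Q 3) (e : E1 k Q) (r : B k Q) (hr : r ∈ baseB k Q) :
    anchor S e r = 0 := by
  rw [anchor_apply, br_base (assoc_val_mem hS e) hr, map_zero]

/-- A bracket of a weight 1 element with b has weight -1. In `anchor_inner` this removes the terms
of {S, b e c} that contain {S, b} or {S, c}, which is why the anchor is linear over B. -/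
theorem br_mul_incl {x y : A k Q} (hx : x ∈ gradeA k Q 1) (hy : y ∈ gradeA k Q 1) (b : B k Q) :
    (bracket k Q).br (x * y) (incl k Q b) = 0 := by
  have h0 : ∀ {x : A k Q}, x ∈ gradeA k Q 1 → (bracket k Q).br x (incl k Q b) = 0 := fun hx =>
    (bracket k Q).br_eq_zero hx (incl_mem_grade k Q b) (by omega)
  rw [(bracket k Q).br_mul_left hx hy, koszulAut_incl, h0 hx, h0 hy]
  simp

theorem anchor_inner (hS : S ∈ gradeA k Q 3) (b c : B k Q) (e : E1 k Q) (x : B k Q) :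
    anchor S (b • MulOpposite.op c • e) x = innerAct k b c (anchor S e x) := by
  rw [anchor_apply, E1.val_smul, E1.val_op_smul, MulOpposite.unop_op,
    GradedDoubleBracket.assoc_mul _ hS, GradedDoubleBracket.assoc_mul _ hS, koszulAut_incl, mul_add,
    ← mul_assoc (incl k Q b) (koszulAut _ _ _), map_add, map_add, LinearMap.add_apply,
    LinearMap.add_apply,
    br_mul_incl (assoc_incl_mem hS b) (mul_incl_mem c (E1.val_mem e)),
    br_mul_incl (incl_mul_mem b (koszulAut_mem _ _ (E1.val_mem e))) (assoc_incl_mem hS c),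
    zero_add, add_zero, br_inner (assoc_val_mem hS e) (incl_mem_grade k Q x) (by omega),
    map_inner rB_mul_incl rB_incl_mul]
  rfl

/-- For the bracket, as opposed to the anchor, the terms {S, r} and {S, s} must themselves be zero;
this restricts inner linearity to R. -/
theorem assoc_inner_base (hS : S ∈ gradeA k Q 3) {r s : B k Q} (hr : r ∈ baseB k Q)
    (hs : s ∈ baseB k Q) (v : A k Q) :
    (bracket k Q).assoc S (incl k Q r * (v * incl k Q s)) =
      incl k Q r * ((bracket k Q).assoc S v * incl k Q s) := by
  rw [GradedDoubleBracket.assoc_mul _ hS, GradedDoubleBracket.assoc_mul _ hS, koszulAut_incl,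
    assoc_base hS hr, assoc_base hS hs, zero_mul, mul_zero, zero_add, add_zero]

theorem dorfmanL_outer (hS : S ∈ gradeA k Q 3) (e₁ e₂ : E1 k Q) (r : B k Q) (hr : r ∈ baseB k Q)
    (s : B k Q) (hs : s ∈ baseB k Q) : dorfmanL S e₁ (r • MulOpposite.op s • e₂) =
      outerAct k r s (dorfmanL S e₁ e₂) := by
  rw [dorfmanL_apply, E1.val_smul, E1.val_op_smul, MulOpposite.unop_op,
    br_outer (assoc_val_mem hS e₁) (br_base (assoc_val_mem hS e₁) hr)
      (br_base (assoc_val_mem hS e₁) hs), map_outer rE_incl_mul rB_mul_incl]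
  rfl

theorem dorfmanR_outer (hS : S ∈ gradeA k Q 3) (e₁ e₂ : E1 k Q) (r : B k Q) (hr : r ∈ baseB k Q)
    (s : B k Q) (hs : s ∈ baseB k Q) : dorfmanR S e₁ (r • MulOpposite.op s • e₂) =
      outerAct k r s (dorfmanR S e₁ e₂) := by
  rw [dorfmanR_apply, E1.val_smul, E1.val_op_smul, MulOpposite.unop_op,
    br_outer (assoc_val_mem hS e₁) (br_base (assoc_val_mem hS e₁) hr)
      (br_base (assoc_val_mem hS e₁) hs), map_outer rB_incl_mul rE_mul_incl]
  rfl

theorem dorfmanL_inner (hS : S ∈ gradeA k Q 3) (e₁ e₂ : E1 k Q) (r : B k Q) (hr : r ∈ baseB k Q)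
    (s : B k Q) (hs : s ∈ baseB k Q) : dorfmanL S (r • MulOpposite.op s • e₁) e₂ =
      innerAct k r s (dorfmanL S e₁ e₂) := by
  rw [dorfmanL_apply, E1.val_smul, E1.val_op_smul, MulOpposite.unop_op, assoc_inner_base hS hr hs,
    br_inner (assoc_val_mem hS e₁) (E1.val_mem e₂) (by omega), map_inner rE_mul_incl rB_incl_mul]
  rfl

theorem dorfmanR_inner (hS : S ∈ gradeA k Q 3) (e₁ e₂ : E1 k Q) (r : B k Q) (hr : r ∈ baseB k Q)
    (s : B k Q) (hs : s ∈ baseB k Q) : dorfmanR S (r • MulOpposite.op s • e₁) e₂ =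
      innerAct k r s (dorfmanR S e₁ e₂) := by
  rw [dorfmanR_apply, E1.val_smul, E1.val_op_smul, MulOpposite.unop_op, assoc_inner_base hS hr hs,
    br_inner (assoc_val_mem hS e₁) (E1.val_mem e₂) (by omega), map_inner rB_mul_incl rE_incl_mul]
  rfl

section projections

variable (t : B k Q ⊗[k] B k Q) (e : E1 k Q)

/-- The correction ρ(e₁)(b) e₂ in the Leibniz rule lies in B ⊗ A¹ and e₂ ρ(e₁)(b) lies in A¹ ⊗ B.
These four projections explain why each correction shows in one component only. -/
theorem rE_rB_mul_val : TensorProduct.map (rE k Q) (rB k Q)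
    (TensorProduct.map (iB k Q) (iB k Q) t * (1 ⊗ₜ E1.val k Q e)) = 0 := by
  induction t using TensorProduct.induction_on with
  | zero => simp
  | add s t hs ht => simp only [map_add, add_mul, hs, ht, add_zero]
  | tmul p q => simp

theorem rB_rE_mul_val : TensorProduct.map (rB k Q) (rE k Q)
    (TensorProduct.map (iB k Q) (iB k Q) t * (1 ⊗ₜ E1.val k Q e)) =
      (actLeft k e).lTensor (B k Q) t := by
  induction t using TensorProduct.induction_on with
  | zero => simp
  | add s t hs ht => simp only [map_add, add_mul, hs, ht]
  | tmul p q => simp [rE_incl_mul, actLeft]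

theorem rE_rB_val_mul : TensorProduct.map (rE k Q) (rB k Q)
    ((E1.val k Q e ⊗ₜ 1) * TensorProduct.map (iB k Q) (iB k Q) t) =
      (actRight k e).rTensor (B k Q) t := by
  induction t using TensorProduct.induction_on with
  | zero => simp
  | add s t hs ht => simp only [map_add, mul_add, hs, ht]
  | tmul p q => simp [rE_mul_incl, actRight]

theorem rB_rE_val_mul : TensorProduct.map (rB k Q) (rE k Q)
    ((E1.val k Q e ⊗ₜ 1) * TensorProduct.map (iB k Q) (iB k Q) t) = 0 := by
  induction t using TensorProduct.induction_on with
  | zero => simp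
  | add s t hs ht => simp only [map_add, mul_add, hs, ht, add_zero]
  | tmul p q => simp

end projections

/-- The trivial factor `1 ⊗ₜ incl k Q 1` gives the last term the shape to which `map_outer` applies.
-/
theorem br_smul (hS : S ∈ gradeA k Q 3) (e₁ e₂ : E1 k Q) (b : B k Q) :
    (bracket k Q).br ((bracket k Q).assoc S (E1.val k Q e₁)) (E1.val k Q (b • e₂)) =
      TensorProduct.map (iB k Q) (iB k Q) (anchor S e₁ b) * (1 ⊗ₜ E1.val k Q e₂) +
        (incl k Q b ⊗ₜ 1) * (bracket k Q).br ((bracket k Q).assoc S (E1.val k Q e₁))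
          (E1.val k Q e₂) * (1 ⊗ₜ incl k Q 1) := by
  rw [E1.val_smul, (bracket k Q).leibniz (assoc_val_mem hS e₁), map_anchor hS, koszulAut_incl,
    map_one, ← Algebra.TensorProduct.one_def, mul_one]

theorem br_op_smul (hS : S ∈ gradeA k Q 3) (e₁ e₂ : E1 k Q) (b : B k Q) :
    (bracket k Q).br ((bracket k Q).assoc S (E1.val k Q e₁)) (E1.val k Q (MulOpposite.op b • e₂)) =
      (E1.val k Q e₂ ⊗ₜ 1) * TensorProduct.map (iB k Q) (iB k Q) (anchor S e₁ b) +
        (incl k Q 1 ⊗ₜ 1) * (bracket k Q).br ((bracket k Q).assoc S (E1.val k Q e₁))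
          (E1.val k Q e₂) * (1 ⊗ₜ incl k Q b) := by
  -- Passing e₂ costs no sign because {S, e₁} has even weight 2.
  rw [E1.val_op_smul, (bracket k Q).leibniz (assoc_val_mem hS e₁), map_anchor hS, koszulAut_two,
    map_one, ← Algebra.TensorProduct.one_def, one_mul, add_comm, MulOpposite.unop_op]

theorem dorfmanL_smul (hS : S ∈ gradeA k Q 3) (e₁ e₂ : E1 k Q) (b : B k Q) :
    dorfmanL S e₁ (b • e₂) = outerAct k b 1 (dorfmanL S e₁ e₂) := by
  rw [dorfmanL_apply, br_smul hS, map_add, rE_rB_mul_val, zero_add,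
    map_outer rE_incl_mul rB_mul_incl]
  rfl

theorem dorfmanR_smul (hS : S ∈ gradeA k Q 3) (e₁ e₂ : E1 k Q) (b : B k Q) :
    dorfmanR S e₁ (b • e₂) = (actLeft k e₂).lTensor (B k Q) (anchor S e₁ b) +
      outerAct k b 1 (dorfmanR S e₁ e₂) := by
  rw [dorfmanR_apply, br_smul hS, map_add, rB_rE_mul_val, map_outer rB_incl_mul rE_mul_incl]
  rfl

theorem dorfmanL_op_smul (hS : S ∈ gradeA k Q 3) (e₁ e₂ : E1 k Q) (b : B k Q) :
    dorfmanL S e₁ (MulOpposite.op b • e₂) = (actRight k e₂).rTensor (B k Q) (anchor S e₁ b) +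
      outerAct k 1 b (dorfmanL S e₁ e₂) := by
  rw [dorfmanL_apply, br_op_smul hS, map_add, rE_rB_val_mul, map_outer rE_incl_mul rB_mul_incl]
  rfl

theorem dorfmanR_op_smul (hS : S ∈ gradeA k Q 3) (e₁ e₂ : E1 k Q) (b : B k Q) :
    dorfmanR S e₁ (MulOpposite.op b • e₂) = outerAct k 1 b (dorfmanR S e₁ e₂) := by
  rw [dorfmanR_apply, br_op_smul hS, map_add, rB_rE_val_mul, zero_add,
    map_outer rB_incl_mul rE_mul_incl]
  rfl

/-! Symmetry. -/

/-- Here and in the next two lemmas at most one factor has nonzero weight, so the signed flip is the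
plain flip. -/
theorem koszulFlip_incl (t : B k Q ⊗[k] B k Q) :
    koszulFlip (gradeA k Q) (TensorProduct.map (iB k Q) (iB k Q) t) =
      TensorProduct.map (iB k Q) (iB k Q) (TensorProduct.comm k _ _ t) := by
  induction t using TensorProduct.induction_on with
  | zero => simp
  | add s t hs ht => simp only [map_add, hs, ht]
  | tmul p q => simp [koszulFlip_tmul _ (incl_mem_grade k Q p) (incl_mem_grade k Q q)]

theorem koszulFlip_val_incl (t : E1 k Q ⊗[k] B k Q) :
    koszulFlip (gradeA k Q) (TensorProduct.map (E1.val k Q) (iB k Q) t) =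
      TensorProduct.map (iB k Q) (E1.val k Q) (TensorProduct.comm k _ _ t) := by
  induction t using TensorProduct.induction_on with
  | zero => simp
  | add s t hs ht => simp only [map_add, hs, ht]
  | tmul p q => simp [koszulFlip_tmul _ (E1.val_mem p) (incl_mem_grade k Q q)]

theorem koszulFlip_incl_val (t : B k Q ⊗[k] E1 k Q) :
    koszulFlip (gradeA k Q) (TensorProduct.map (iB k Q) (E1.val k Q) t) =
      TensorProduct.map (E1.val k Q) (iB k Q) (TensorProduct.comm k _ _ t) := by
  induction t using TensorProduct.induction_on with
  | zero => simp
  | add s t hs ht => simp only [map_add, hs, ht]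
  | tmul p q => simp [koszulFlip_tmul _ (incl_mem_grade k Q p) (E1.val_mem q)]

theorem map_rB_iB (t : B k Q ⊗[k] B k Q) :
    TensorProduct.map (rB k Q) (rB k Q) (TensorProduct.map (iB k Q) (iB k Q) t) = t := by
  induction t using TensorProduct.induction_on with
  | zero => simp
  | add s t hs ht => simp only [map_add, hs, ht]
  | tmul p q => simp

/-- For two elements of weight 1 the sign of skew symmetry is -(-1)^(1·1) = 1. -/
theorem pairing_symm (e e' : E1 k Q) :
    pairing k Q e e' = TensorProduct.comm k _ _ (pairing k Q e' e) := by
  rw [pairing_apply, (bracket k Q).skew (E1.val_mem e) (E1.val_mem e'), ← map_pairing,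
    koszulFlip_incl, mul_one, pow_one, neg_one_smul, neg_neg, map_rB_iB]

/-- The derivation {S, -} is applied to ⦃e, b⦄ = 0, giving 0 = ⦃{S, e}, b⦄ - ⦃e, {S, b}⦄. This
identifies 𝒟b with {S, b}. -/
theorem br_val_coanchor (hS : S ∈ gradeA k Q 3) (e : E1 k Q) (b : B k Q) :
    (bracket k Q).br (E1.val k Q e) ((bracket k Q).assoc S (incl k Q b)) =
      (bracket k Q).br ((bracket k Q).assoc S (E1.val k Q e)) (incl k Q b) := by
  have h := GradedDoubleBracket.IsPoisson.assocTensor_br (isPoisson k Q) hS (E1.val_mem e) (incl k Q b)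
  rw [br_val_incl, map_zero, Odd.neg_one_pow (n := 3 * 1) ⟨1, rfl⟩, neg_one_smul,
    ← sub_eq_add_neg, eq_comm, sub_eq_zero] at h
  exact h.symm

theorem pairing_coanchor (hS : S ∈ gradeA k Q 3) (e : E1 k Q) (b : B k Q) :
    pairing k Q e (coanchor S b) = anchor S e b := by
  rw [pairing_apply, val_coanchor hS, br_val_coanchor hS, anchor_apply]

/-- By the derivation property {S, -} sends ⦃e, e⦄ to ⦃{S, e}, e⦄ - ⦃e, {S, e}⦄, and the weights 1
and 2 make ⦃e, {S, e}⦄ minus the flip of ⦃{S, e}, e⦄. -/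
theorem assocTensor_pairing (hS : S ∈ gradeA k Q 3) (e : E1 k Q) :
    (bracket k Q).assocTensor 3 S (TensorProduct.map (iB k Q) (iB k Q) (pairing k Q e e)) =
      TensorProduct.map (E1.val k Q) (iB k Q) (dorfmanL S e e +
        TensorProduct.comm k _ _ (dorfmanR S e e)) +
      TensorProduct.map (iB k Q) (E1.val k Q) (dorfmanR S e e +
        TensorProduct.comm k _ _ (dorfmanL S e e)) := by
  rw [map_pairing, GradedDoubleBracket.IsPoisson.assocTensor_br (isPoisson k Q) hS (E1.val_mem e),
    (bracket k Q).skew (E1.val_mem e) (assoc_val_mem hS e), ← map_dorfman hS, map_add, map_add,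
    map_add, koszulFlip_val_incl, koszulFlip_incl_val, Odd.neg_one_pow (n := 3 * 1) ⟨1, rfl⟩,
    Even.neg_one_pow (n := 1 * 2) ⟨1, rfl⟩, neg_one_smul, one_smul, neg_neg]
  abel

theorem map_assocTensor (hS : S ∈ gradeA k Q 3) (t : B k Q ⊗[k] B k Q) :
    (bracket k Q).assocTensor 3 S (TensorProduct.map (iB k Q) (iB k Q) t) =
      TensorProduct.map (E1.val k Q) (iB k Q) ((coanchor S).rTensor _ t) +
      TensorProduct.map (iB k Q) (E1.val k Q) ((coanchor S).lTensor _ t) := by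
  induction t using TensorProduct.induction_on with
  | zero => simp
  | add s t hs ht => simp only [map_add, hs, ht]; abel
  | tmul p q => simp [val_coanchor hS]

theorem map_rE_rB (s : E1 k Q ⊗[k] B k Q) (t : B k Q ⊗[k] E1 k Q) :
    TensorProduct.map (rE k Q) (rB k Q) (TensorProduct.map (E1.val k Q) (iB k Q) s +
      TensorProduct.map (iB k Q) (E1.val k Q) t) = s := by
  rw [map_add]
  conv_rhs => rw [← add_zero s]
  congr 1
  · induction s using TensorProduct.induction_on with
    | zero => simp
    | add s t hs ht => simp only [map_add, hs, ht]
    | tmul p q => simp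
  · induction t using TensorProduct.induction_on with
    | zero => simp
    | add s t hs ht => simp only [map_add, hs, ht, add_zero]
    | tmul p q => simp

theorem map_rB_rE (s : E1 k Q ⊗[k] B k Q) (t : B k Q ⊗[k] E1 k Q) :
    TensorProduct.map (rB k Q) (rE k Q) (TensorProduct.map (E1.val k Q) (iB k Q) s +
      TensorProduct.map (iB k Q) (E1.val k Q) t) = t := by
  rw [map_add]
  conv_rhs => rw [← zero_add t]
  congr 1
  · induction s using TensorProduct.induction_on with
    | zero => simp
    | add s t hs ht => simp only [map_add, hs, ht, add_zero]
    | tmul p q => simp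
  · induction t using TensorProduct.induction_on with
    | zero => simp
    | add s t hs ht => simp only [map_add, hs, ht]
    | tmul p q => simp

theorem coanchor_pairing_left (hS : S ∈ gradeA k Q 3) (e : E1 k Q) :
    (coanchor S).rTensor (B k Q) (pairing k Q e e) =
      dorfmanL S e e + TensorProduct.comm k _ _ (dorfmanR S e e) := by
  have h := congrArg (TensorProduct.map (rE k Q) (rB k Q)) (assocTensor_pairing hS e)
  rwa [map_assocTensor hS, map_rE_rB, map_rE_rB] at h

theorem coanchor_pairing_right (hS : S ∈ gradeA k Q 3) (e : E1 k Q) :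
    (coanchor S).lTensor (B k Q) (pairing k Q e e) =
      dorfmanR S e e + TensorProduct.comm k _ _ (dorfmanL S e e) := by
  have h := congrArg (TensorProduct.map (rB k Q) (rE k Q)) (assocTensor_pairing hS e)
  rwa [map_assocTensor hS, map_rB_rE, map_rB_rE] at h

end PlainQuiver

/-! ### The double Jacobi identity of the derived brackets -/

namespace PlainQuiver

open GradedQuiver GradedQuiver.PathAlgebra GradedDoubleBracket

variable {V E : Type*} {k : Type*} [Field k] [Fintype V] {Q : PlainQuiver V E} [Fintype E]
  [DecidableEq E] {S : A k Q}

section projections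

variable {X Y Z U W : Type*} [AddCommGroup X] [AddCommGroup Y] [AddCommGroup Z] [AddCommGroup U]
  [AddCommGroup W] [Module k X] [Module k Y] [Module k Z] [Module k U] [Module k W]
  (f : A k Q →ₗ[k] X) (g : A k Q →ₗ[k] Y) (h : A k Q →ₗ[k] Z)

theorem map_insert (t : A k Q ⊗[k] A k Q) (v : A k Q) :
    TensorProduct.map (TensorProduct.map f g) h (insert k (A k Q) (t ⊗ₜ v)) =
      TensorProduct.rightComm k X Z Y (TensorProduct.map f h t ⊗ₜ g v) := by
  induction t using TensorProduct.induction_on with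
  | zero => simp
  | add s t hs ht => simp only [map_add, TensorProduct.add_tmul, hs, ht]
  | tmul p q => simp

theorem map_actL (x : A k Q) (i : U →ₗ[k] A k Q) (j : W →ₗ[k] A k Q) (t : U ⊗[k] W) :
    TensorProduct.map (TensorProduct.map f g) h ((bracket k Q).actL x
      (TensorProduct.map i j t)) =
      TensorProduct.map (TensorProduct.map f g ∘ₗ (bracket k Q).br x ∘ₗ i) (h ∘ₗ j) t := by
  induction t using TensorProduct.induction_on with
  | zero => simp
  | add s t hs ht => simp only [map_add, hs, ht]
  | tmul p q => rfl

theorem map_assoc_symm (u : A k Q) (t : A k Q ⊗[k] A k Q) :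
    TensorProduct.map (TensorProduct.map f g) h ((TensorProduct.assoc k _ _ _).symm (u ⊗ₜ t)) =
      (TensorProduct.assoc k X Y Z).symm (f u ⊗ₜ TensorProduct.map g h t) := by
  induction t using TensorProduct.induction_on with
  | zero => simp
  | add s t hs ht => simp only [map_add, TensorProduct.tmul_add, hs, ht]
  | tmul p q => simp

theorem map_actR (n : ℕ) (x : A k Q) (i : U →ₗ[k] A k Q) (j : W →ₗ[k] A k Q) (t : U ⊗[k] W) :
    TensorProduct.map (TensorProduct.map f g) h ((bracket k Q).actR n x
      (TensorProduct.map i j t)) = (TensorProduct.assoc k X Y Z).symm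
      (TensorProduct.map (f ∘ₗ (koszulAut (gradeA k Q) n).toLinearMap ∘ₗ i)
        (TensorProduct.map g h ∘ₗ (bracket k Q).br x ∘ₗ j) t) := by
  induction t using TensorProduct.induction_on with
  | zero => simp
  | add s t hs ht => simp only [map_add, hs, ht]
  | tmul p q => exact map_assoc_symm f g h _ _

theorem nested_zero (u v z : A k Q) :
    (bracket k Q).nested 0 u v z = insert k (A k Q) ((bracket k Q).br u z ⊗ₜ v) := by
  have h1 : (koszulAut (gradeA k Q) 0).toLinearMap = LinearMap.id :=
    LinearMap.ext (koszulAut_zero _)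
  rw [nested_apply, koszulAut_zero, h1, LinearMap.lTensor_id, LinearMap.id_apply]

/-- Moving v, of weight 1, past e' costs a sign, and ⦃e, e'⦄ of weight 0 adds none. The minus in ⟦b,
e⟧ = -⟨𝒟b, e⟩ originates here. -/
theorem nested_one (e e' : E1 k Q) (v : A k Q) :
    (bracket k Q).nested 1 (E1.val k Q e) v (E1.val k Q e') =
      -insert k (A k Q) ((bracket k Q).br (E1.val k Q e) (E1.val k Q e') ⊗ₜ v) := by
  have h : ∀ t : B k Q ⊗[k] B k Q, (koszulAut (gradeA k Q) 1).toLinearMap.lTensor (A k Q)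
      (TensorProduct.map (iB k Q) (iB k Q) t) = TensorProduct.map (iB k Q) (iB k Q) t := by
    intro t
    induction t using TensorProduct.induction_on with
    | zero => simp
    | add s t hs ht => simp only [map_add, hs, ht]
    | tmul p q => simp
  rw [nested_apply, koszulAut_val_of_odd odd_one, map_neg, map_neg, ← map_pairing, h,
    TensorProduct.neg_tmul, map_neg]

theorem nested_incl (q : ℕ) (b : B k Q) (v : A k Q) (e : E1 k Q) :
    (bracket k Q).nested q (incl k Q b) v (E1.val k Q e) = 0 := by
  rw [nested_apply, koszulAut_apply _ q (E1.val_mem e), map_smul, br_incl_val]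
  simp

/-- The derivation {S, -} sends e ⊗ b to {S, e} ⊗ b - e ⊗ {S, b}, and the minus sign is undone by
`nested_one`. This produces ⟦e, e'⟧ ⊗₁ b + ⟨e, e'⟩ ⊗₁ 𝒟b. -/
theorem map_actNested_val (hS : S ∈ gradeA k Q 3) (t : E1 k Q ⊗[k] B k Q) (e : E1 k Q) :
    TensorProduct.map (TensorProduct.map f g) h ((bracket k Q).actNested
      ((bracket k Q).assocTensor 3 S (TensorProduct.map (E1.val k Q) (iB k Q) t))
        (E1.val k Q e)) =
      TensorProduct.rightComm k X Z Y (TensorProduct.map (TensorProduct.map f h ∘ₗ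
        (bracket k Q).br.flip (E1.val k Q e) ∘ₗ (bracket k Q).assoc S ∘ₗ E1.val k Q)
          (g ∘ₗ iB k Q) t) +
      TensorProduct.rightComm k X Z Y (TensorProduct.map (TensorProduct.map f h ∘ₗ
        (bracket k Q).br.flip (E1.val k Q e) ∘ₗ E1.val k Q)
          (g ∘ₗ (bracket k Q).assoc S ∘ₗ iB k Q) t) := by
  induction t using TensorProduct.induction_on with
  | zero => simp
  | add s t hs ht => simp only [map_add, LinearMap.add_apply, hs, ht]; abel
  | tmul p q =>
    have h1 : (bracket k Q).assocTensor 3 S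
        (TensorProduct.map (E1.val k Q) (iB k Q) (p ⊗ₜ q)) =
        (bracket k Q).assoc S (E1.val k Q p) ⊗ₜ incl k Q q -
          E1.val k Q p ⊗ₜ (bracket k Q).assoc S (incl k Q q) := by
      rw [TensorProduct.map_tmul, assocTensor_tmul, koszulAut_val_of_odd (n := 3) ⟨1, rfl⟩,
        TensorProduct.neg_tmul, ← sub_eq_add_neg]
      rfl
    rw [h1, map_sub, LinearMap.sub_apply, actNested_tmul _ _ (incl_mem_grade k Q q),
      actNested_tmul _ _ (assoc_incl_mem hS q), nested_zero, nested_one, sub_neg_eq_add, map_add,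
      map_insert, map_insert]
    rfl

/-- The term b ⊗ {S, e} contributes nothing because ⦃b, e'⦄ = 0. The term {S, b} ⊗ e keeps the sign
of `nested_one`. -/
theorem map_actNested_incl (hS : S ∈ gradeA k Q 3) (t : B k Q ⊗[k] E1 k Q) (e : E1 k Q) :
    TensorProduct.map (TensorProduct.map f g) h ((bracket k Q).actNested
      ((bracket k Q).assocTensor 3 S (TensorProduct.map (iB k Q) (E1.val k Q) t))
        (E1.val k Q e)) =
      -TensorProduct.rightComm k X Z Y (TensorProduct.map (TensorProduct.map f h ∘ₗ
        (bracket k Q).br.flip (E1.val k Q e) ∘ₗ E1.val k Q ∘ₗ coanchor S)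
          (g ∘ₗ E1.val k Q) t) := by
  induction t using TensorProduct.induction_on with
  | zero => simp
  | add s t hs ht => simp only [map_add, LinearMap.add_apply, hs, ht]; abel
  | tmul p q =>
    have h1 : (bracket k Q).assocTensor 3 S
        (TensorProduct.map (iB k Q) (E1.val k Q) (p ⊗ₜ q)) =
        E1.val k Q (coanchor S p) ⊗ₜ E1.val k Q q +
          incl k Q p ⊗ₜ (bracket k Q).assoc S (E1.val k Q q) := by
      rw [val_coanchor hS, TensorProduct.map_tmul, assocTensor_tmul, AlgHom.toLinearMap_apply,
        koszulAut_incl]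
    rw [h1, map_add, LinearMap.add_apply, actNested_tmul _ _ (E1.val_mem q),
      actNested_tmul _ _ (assoc_val_mem hS q), nested_one, nested_incl, add_zero, map_neg,
      map_insert]
    rfl

end projections

theorem rB_comp_iB : rB k Q ∘ₗ iB k Q = LinearMap.id := LinearMap.ext fun b => by simp
theorem rE_comp_val : rE k Q ∘ₗ E1.val k Q = LinearMap.id := LinearMap.ext fun b => by simp
theorem rB_comp_val : rB k Q ∘ₗ E1.val k Q = 0 := LinearMap.ext fun b => by simp
theorem rE_comp_iB : rE k Q ∘ₗ iB k Q = 0 := LinearMap.ext fun b => by simp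

theorem rB_comp_assoc (hS : S ∈ gradeA k Q 3) :
    rB k Q ∘ₗ (bracket k Q).assoc S ∘ₗ iB k Q = 0 :=
  LinearMap.ext fun b => retract_eq_zero k Q one_ne_zero (assoc_incl_mem hS b)

theorem koszulAut_two_comp {X : Type*} [AddCommGroup X] [Module k X] (i : X →ₗ[k] A k Q) :
    (koszulAut (gradeA k Q) 2).toLinearMap ∘ₗ i = i := LinearMap.ext fun _ => koszulAut_two _

theorem koszulAut_comp_incl (n : ℕ) :
    (koszulAut (gradeA k Q) n).toLinearMap ∘ₗ iB k Q = iB k Q :=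
  LinearMap.ext fun x => koszulAut_incl n x

theorem koszulAut_one_comp_val :
    (koszulAut (gradeA k Q) 1).toLinearMap ∘ₗ E1.val k Q = -E1.val k Q :=
  LinearMap.ext fun x => koszulAut_val_of_odd odd_one x

/-- The derivation property for ⦃{S, e₁}, e₂⦄ has an extra term containing {S, {S, e₁}}. This is the
only point at which {S, {S, -}} = 0 enters the algebroid axioms. -/
theorem br_assoc_assoc (hS : S ∈ gradeA k Q 3)
    (hX : ∀ z, (bracket k Q).assoc S ((bracket k Q).assoc S z) = 0) (e₁ e₂ : E1 k Q) :
    (bracket k Q).br ((bracket k Q).assoc S (E1.val k Q e₁))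
        ((bracket k Q).assoc S (E1.val k Q e₂)) =
      (bracket k Q).assocTensor 3 S (TensorProduct.map (E1.val k Q) (iB k Q) (dorfmanL S e₁ e₂)) +
      (bracket k Q).assocTensor 3 S
        (TensorProduct.map (iB k Q) (E1.val k Q) (dorfmanR S e₁ e₂)) := by
  rw [← map_add, map_dorfman hS, IsPoisson.assocTensor_br (isPoisson k Q) hS (assoc_val_mem hS e₁),
    hX, map_zero, LinearMap.zero_apply, zero_add, Even.neg_one_pow (n := 3 * 2) ⟨3, rfl⟩, one_smul]

section jacobi

variable (e₁ e₂ e₃ : E1 k Q)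

/-- The double Jacobi identity for {S, e₁}, {S, e₂}, e₃, with trivial signs because the first two
have weight 2. Its total weight is 1, so the axiom splits according to which of the three factors
lies in A¹. -/
theorem jacobi_assoc (hS : S ∈ gradeA k Q 3)
    (hX : ∀ z, (bracket k Q).assoc S ((bracket k Q).assoc S z) = 0) :
    (bracket k Q).actL ((bracket k Q).assoc S (E1.val k Q e₁))
        (TensorProduct.map (E1.val k Q) (iB k Q) (dorfmanL S e₂ e₃)) +
      (bracket k Q).actL ((bracket k Q).assoc S (E1.val k Q e₁))
        (TensorProduct.map (iB k Q) (E1.val k Q) (dorfmanR S e₂ e₃)) =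
    (bracket k Q).actR 2 ((bracket k Q).assoc S (E1.val k Q e₂))
        (TensorProduct.map (E1.val k Q) (iB k Q) (dorfmanL S e₁ e₃)) +
      (bracket k Q).actR 2 ((bracket k Q).assoc S (E1.val k Q e₂))
        (TensorProduct.map (iB k Q) (E1.val k Q) (dorfmanR S e₁ e₃)) +
      ((bracket k Q).actNested ((bracket k Q).assocTensor 3 S
          (TensorProduct.map (E1.val k Q) (iB k Q) (dorfmanL S e₁ e₂))) (E1.val k Q e₃) +
      (bracket k Q).actNested ((bracket k Q).assocTensor 3 S
        (TensorProduct.map (iB k Q) (E1.val k Q) (dorfmanR S e₁ e₂))) (E1.val k Q e₃)) := by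
  have h := IsPoisson.actL_br (isPoisson k Q) (assoc_val_mem hS e₁) (assoc_val_mem hS e₂)
    (E1.val k Q e₃)
  rwa [br_assoc_assoc hS hX, Even.neg_one_pow (n := 2 * 2) ⟨2, rfl⟩, one_smul, ← map_dorfman hS,
    ← map_dorfman hS, map_add, map_add, map_add, LinearMap.add_apply] at h

theorem dorfman_jacobi_left (hS : S ∈ gradeA k Q 3)
    (hX : ∀ z, (bracket k Q).assoc S ((bracket k Q).assoc S z) = 0) :
    (dorfmanL S e₁).rTensor (B k Q) (dorfmanL S e₂ e₃) =
      prepend k (anchor S e₂) (dorfmanL S e₁ e₃) +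
        insertMid k ((dorfmanL S).flip e₃) (dorfmanL S e₁ e₂) := by
  have h := congrArg (TensorProduct.map (TensorProduct.map (rE k Q) (rB k Q)) (rB k Q))
    (jacobi_assoc e₁ e₂ e₃ hS hX)
  simp only [map_add, map_actL, map_actR, map_actNested_val _ _ _ hS, map_actNested_incl _ _ _ hS,
    rB_comp_iB, rE_comp_val, rB_comp_val, rE_comp_iB, rB_comp_assoc hS, koszulAut_two_comp,
    TensorProduct.map_zero_left, TensorProduct.map_zero_right, LinearMap.zero_apply, map_zero,
    add_zero, neg_zero] at h
  exact h

/-- The middle factor is the slot filled by ⊗₁. Only here can the inserted element be of weight 1,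
and so only here do the terms with 𝒟 appear. -/
theorem dorfman_jacobi_mid (hS : S ∈ gradeA k Q 3)
    (hX : ∀ z, (bracket k Q).assoc S ((bracket k Q).assoc S z) = 0) :
    (dorfmanR S e₁).rTensor (B k Q) (dorfmanL S e₂ e₃) =
      prepend k (dorfmanL S e₂) (dorfmanR S e₁ e₃) -
        insertMid k ((pairing k Q).flip e₃ ∘ₗ coanchor S) (dorfmanR S e₁ e₂) +
        insertMid k ((pairing k Q).flip e₃) ((coanchor S).lTensor _ (dorfmanL S e₁ e₂)) := by
  have h := congrArg (TensorProduct.map (TensorProduct.map (rB k Q) (rE k Q)) (rB k Q))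
    (jacobi_assoc e₁ e₂ e₃ hS hX)
  simp only [map_add, map_actL, map_actR, map_actNested_val _ _ _ hS, map_actNested_incl _ _ _ hS,
    rB_comp_iB, rE_comp_val, rB_comp_val, rE_comp_iB, koszulAut_two_comp,
    TensorProduct.map_zero_left, TensorProduct.map_zero_right, LinearMap.zero_apply, map_zero,
    add_zero, zero_add] at h
  have h1 : insertMid k ((pairing k Q).flip e₃) ((coanchor S).lTensor _ (dorfmanL S e₁ e₂)) =
      TensorProduct.rightComm k _ _ _ (TensorProduct.map ((pairing k Q).flip e₃) (coanchor S)
        (dorfmanL S e₁ e₂)) := by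
    rw [insertMid, LinearMap.comp_apply, ← LinearMap.comp_apply (LinearMap.rTensor _ _),
      LinearMap.rTensor_comp_lTensor]
    rfl
  have key : ∀ {M : Type _} [AddCommGroup M] {x p m n : M}, x = p + (m + -n) → x = p - n + m := by
    intro M _ x p m n h
    rw [h]
    abel
  rw [h1]
  exact key h

theorem dorfman_jacobi_right (hS : S ∈ gradeA k Q 3)
    (hX : ∀ z, (bracket k Q).assoc S ((bracket k Q).assoc S z) = 0) :
    (anchor S e₁).rTensor (E1 k Q) (dorfmanR S e₂ e₃) =
      prepend k (dorfmanR S e₂) (dorfmanR S e₁ e₃) +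
        insertMid k ((dorfmanR S).flip e₃) (dorfmanL S e₁ e₂) := by
  have h := congrArg (TensorProduct.map (TensorProduct.map (rB k Q) (rB k Q)) (rE k Q))
    (jacobi_assoc e₁ e₂ e₃ hS hX)
  simp only [map_add, map_actL, map_actR, map_actNested_val _ _ _ hS, map_actNested_incl _ _ _ hS,
    rB_comp_iB, rE_comp_val, rB_comp_val, rE_comp_iB, rB_comp_assoc hS, koszulAut_two_comp,
    TensorProduct.map_zero_left, TensorProduct.map_zero_right, LinearMap.zero_apply, map_zero,
    add_zero, zero_add] at h
  have key : ∀ {M : Type _} [AddCommGroup M] {x p m : M}, x = p + (m + -0) → x = p + m := by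
    intro M _ x p m h
    rw [h, neg_zero, add_zero]
  exact key h

theorem map_actNested_dorfmanL (t : E1 k Q ⊗[k] B k Q) (e : E1 k Q) :
    TensorProduct.map (TensorProduct.map (rB k Q) (rB k Q)) (rB k Q) ((bracket k Q).actNested
      (TensorProduct.map (E1.val k Q) (iB k Q) t) (E1.val k Q e)) =
      insertMid k ((pairing k Q).flip e) t := by
  induction t using TensorProduct.induction_on with
  | zero => simp
  | add s t hs ht => simp only [map_add, LinearMap.add_apply, hs, ht]
  | tmul p q =>
    rw [TensorProduct.map_tmul, AlgHom.toLinearMap_apply,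
      actNested_tmul _ _ (incl_mem_grade k Q q), nested_zero, map_insert, AlgHom.toLinearMap_apply,
      retract_incl]
    rfl

theorem actNested_dorfmanR (t : B k Q ⊗[k] E1 k Q) (e : E1 k Q) : (bracket k Q).actNested
      (TensorProduct.map (iB k Q) (E1.val k Q) t) (E1.val k Q e) = 0 := by
  induction t using TensorProduct.induction_on with
  | zero => simp
  | add s t hs ht => simp only [map_add, LinearMap.add_apply, hs, ht, add_zero]
  | tmul p q =>
    rw [TensorProduct.map_tmul, AlgHom.toLinearMap_apply, actNested_tmul _ _ (E1.val_mem q),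
      nested_incl]

/-- The double Jacobi identity for {S, e₁}, e₂, e₂ has total weight 0 and is projected to B ⊗ B ⊗ B.
On the nested side the component of ⟦e₁, e₂⟧ in B ⊗ A¹ drops out, since ⦃b, e₂⦄ = 0. -/
theorem anchor_pairing (hS : S ∈ gradeA k Q 3) :
    (anchor S e₁).rTensor (B k Q) (pairing k Q e₂ e₂) =
      insertMid k ((pairing k Q).flip e₂) (dorfmanL S e₁ e₂) +
        prepend k (pairing k Q e₂) (dorfmanR S e₁ e₂) := by
  have h := congrArg (TensorProduct.map (TensorProduct.map (rB k Q) (rB k Q)) (rB k Q))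
    (IsPoisson.actL_br (isPoisson k Q) (assoc_val_mem hS e₁) (E1.val_mem e₂) (E1.val k Q e₂))
  rw [← map_pairing, Even.neg_one_pow (n := 2 * 1) ⟨1, rfl⟩, one_smul, ← map_dorfman hS] at h
  simp only [map_add, LinearMap.add_apply, map_actL, map_actR, map_actNested_dorfmanL,
    actNested_dorfmanR, koszulAut_comp_incl, koszulAut_one_comp_val, LinearMap.comp_neg, rB_comp_iB,
    rB_comp_val, neg_zero, TensorProduct.map_zero_left, LinearMap.zero_apply, map_zero,
    add_zero, zero_add] at h
  rw [add_comm]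
  exact h

end jacobi

end PlainQuiver

/-! ### The inner product is non-degenerate -/

namespace PlainQuiver

open GradedQuiver GradedQuiver.PathAlgebra

variable {V E : Type*} (k : Type*) [Field k] [Fintype V] (Q : PlainQuiver V E)

/-- The arrows of weight `1`. -/
def oddArrow : E ⊕ E → (E ⊕ E) ⊕ E ⊕ E :=
  Sum.elim (fun a => Sum.inl (Sum.inr a)) fun a => Sum.inr (Sum.inr a)

theorem oddArrow_injective : Function.Injective (oddArrow (E := E)) := by
  rintro (a | a) (b | b) h <;> simp [oddArrow] at h <;> rw [h]

theorem swap_oddArrow (c : E ⊕ E) : Sum.swap (oddArrow c) = oddArrow (Sum.swap c) := by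
  rcases c with a | a <;> rfl

theorem weight_oddArrow (c : E ⊕ E) : (Q.hatted.double 2).weight (oddArrow c) = 1 := by
  rcases c with a | a <;> rfl

/-- The generators `â`, `â*` of the bimodule `A¹`. -/
def oddGen (c : E ⊕ E) : E1 k Q :=
  (⟨arrow k (Q.hatted.double 2) (oddArrow c), by
    have h := arrow_mem_grade k (Q.hatted.double 2) (oddArrow c)
    rwa [weight_oddArrow] at h⟩ : gradeA k Q 1)

theorem val_oddGen (c : E ⊕ E) : E1.val k Q (oddGen k Q c) = arrow k _ (oddArrow c) := rfl

theorem head_smul_oddGen (c : E ⊕ E) :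
    (e k _ ((Q.hatted.double 2).head (oddArrow c)) : B k Q) • MulOpposite.op
      (e k _ ((Q.hatted.double 2).tail (oddArrow c)) : B k Q) • oddGen k Q c = oddGen k Q c := by
  refine E1.val_injective ?_
  rw [E1.val_smul, E1.val_op_smul, MulOpposite.unop_op, incl_e, incl_e, val_oddGen, mul_e_tail,
    e_head_mul]

/-- The map `p ⊗ q ↦ p m q`. -/
def biAct (m : E1 k Q) : B k Q ⊗[k] B k Q →ₗ[k] E1 k Q :=
  TensorProduct.lift (LinearMap.mk₂ k (fun p q => p • MulOpposite.op q • m)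
    (fun p p' q => by rw [add_smul]) (fun c p q => by rw [smul_assoc])
    (fun p q q' => by rw [MulOpposite.op_add, add_smul, smul_add])
    (fun c p q => E1.val_injective (by simp)))

variable {k Q}

@[simp] theorem biAct_tmul (m : E1 k Q) (p q : B k Q) :
    biAct k Q m (p ⊗ₜ q) = p • MulOpposite.op q • m := rfl

theorem val_biAct (m : E1 k Q) (t : B k Q ⊗[k] B k Q) : E1.val k Q (biAct k Q m t) =
    sandwich (AlgHom.id k _) (AlgHom.id k _) (TensorProduct.map (iB k Q) (iB k Q) t)
      (E1.val k Q m) := by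
  induction t using TensorProduct.induction_on with
  | zero => simp
  | add s t hs ht => simp only [map_add, LinearMap.add_apply, hs, ht]
  | tmul p q => simp [mul_assoc]

variable [Fintype E] [DecidableEq E]

theorem sign_oddArrow (c : E ⊕ E) : (duality k Q).sign (oddArrow c) = 1 := by
  rcases c with a | a <;> simp [oddArrow, duality, doubleDuality, hatted]

/-- Pairing with the dual generator reads off a partial derivative. No sign survives, because both
factors of this derivative have weight 0 and the arrows of weight 1 carry sign 1. -/
theorem comm_pairing_oddGen (x : E1 k Q) (c : E ⊕ E) :
    TensorProduct.comm k _ _ (pairing k Q x (oddGen k Q (Sum.swap c))) =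
      TensorProduct.map (rB k Q) (rB k Q)
        (partialDer k (Q.hatted.double 2) (oddArrow c) (E1.val k Q x)) := by
  have hm := map_incl_retract (by rw [weight_oddArrow]; norm_num)
    (partialDer_mem (P := Q.hatted.double 2) (oddArrow c) (E1.val_mem x))
  have h : ∀ t : B k Q ⊗[k] B k Q, (koszulAut (gradeA k Q) 1).toLinearMap.rTensor (A k Q)
      (TensorProduct.map (iB k Q) (iB k Q) t) = TensorProduct.map (iB k Q) (iB k Q) t := by
    intro t
    induction t using TensorProduct.induction_on with
    | zero => simp
    | add s t hs ht => simp only [map_add, hs, ht]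
    | tmul p q => simp
  rw [pairing_apply, val_oddGen, bracket_arrow, swap_oddArrow, Sum.swap_swap, sign_oddArrow,
    one_smul, weight_oddArrow]
  generalize TensorProduct.map (rB k Q) (rB k Q) _ = s at hm ⊢
  rw [← hm, koszulFlip_incl, h, map_rB_iB]
  exact (TensorProduct.comm k _ _).symm_apply_apply s

theorem map_partialDer (x : E1 k Q) (c : E ⊕ E) :
    partialDer k (Q.hatted.double 2) (oddArrow c) (E1.val k Q x) =
      TensorProduct.map (iB k Q) (iB k Q)
        (TensorProduct.comm k _ _ (pairing k Q x (oddGen k Q (Sum.swap c)))) := by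
  rw [comm_pairing_oddGen]
  exact (map_incl_retract (by rw [weight_oddArrow]; norm_num)
    (partialDer_mem (P := Q.hatted.double 2) (oddArrow c) (E1.val_mem x))).symm

/-- This is Euler's formula in weight 1: arrows of weight 0 get coefficient 0, derivatives along
arrows of weight 2 vanish for reasons of weight, and the remaining derivatives are pairings. -/
theorem sum_biAct_oddGen (x : E1 k Q) : ∑ c, biAct k Q (oddGen k Q c)
    (TensorProduct.comm k _ _ (pairing k Q x (oddGen k Q (Sum.swap c)))) = x := by
  refine E1.val_injective ?_
  have h := sum_weight_smul_sandwich (P := Q.hatted.double 2) (E1.val_mem x)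
  rw [one_smul] at h
  rw [map_sum, ← h, Fintype.sum_sum_type, Fintype.sum_sum_type, Fintype.sum_sum_type,
    Fintype.sum_sum_type]
  simp only [val_biAct, ← map_partialDer]
  have h0 : ∀ a : E, (Q.hatted.double 2).weight (Sum.inl (Sum.inl a)) •
      sandwich (AlgHom.id k _) (AlgHom.id k _)
        (partialDer k (Q.hatted.double 2) (Sum.inl (Sum.inl a)) (E1.val k Q x))
        (arrow k _ (Sum.inl (Sum.inl a))) = 0 := fun a => zero_smul ℕ _
  have h1 : ∀ a : E, (Q.hatted.double 2).weight (Sum.inr (Sum.inl a)) •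
      sandwich (AlgHom.id k _) (AlgHom.id k _)
        (partialDer k (Q.hatted.double 2) (Sum.inr (Sum.inl a)) (E1.val k Q x))
        (arrow k _ (Sum.inr (Sum.inl a))) = 0 := by
    intro a
    rw [tensorGrade_eq_zero (by change ((1 : ℕ) : ℤ) - (2 : ℕ) < 0; norm_num)
      (partialDer_mem (P := Q.hatted.double 2) (Sum.inr (Sum.inl a)) (E1.val_mem x))]
    simp
  rw [Finset.sum_congr rfl fun a _ => h0 a, Finset.sum_congr rfl fun a _ => h1 a,
    Finset.sum_const_zero, zero_add, zero_add]
  congr 1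
  · exact Finset.sum_congr rfl fun a _ => (one_smul ℕ _).symm
  · exact Finset.sum_congr rfl fun a _ => (one_smul ℕ _).symm

theorem pairing_oddGen (c d : E ⊕ E) : pairing k Q (oddGen k Q c) (oddGen k Q d) =
    if c = Sum.swap d then (e k _ ((Q.hatted.double 2).head (oddArrow d)) : B k Q) ⊗ₜ
      (e k _ ((Q.hatted.double 2).tail (oddArrow d)) : B k Q) else 0 := by
  have h := comm_pairing_oddGen (oddGen k Q c) (Sum.swap d)
  rw [Sum.swap_swap, val_oddGen, partialDer_arrow] at h
  refine (TensorProduct.comm k (B k Q) (B k Q)).injective (h.trans ?_)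
  by_cases hc : c = Sum.swap d
  · rw [if_pos hc, if_pos (congrArg _ hc), TensorProduct.map_tmul, AlgHom.toLinearMap_apply,
      AlgHom.toLinearMap_apply, retract_e, retract_e, TensorProduct.comm_tmul]
    rcases d with a | a <;> rfl
  · rw [if_neg hc, if_neg (fun h => hc (oddArrow_injective h)), map_zero, map_zero]

theorem pairing_biAct (m y : E1 k Q) (p q : B k Q) (t : B k Q ⊗[k] B k Q)
    (h : pairing k Q m y = p ⊗ₜ q) :
    pairing k Q (biAct k Q m (TensorProduct.comm k _ _ t)) y = outerAct k p q t := by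
  induction t using TensorProduct.induction_on with
  | zero => simp
  | add s t hs ht => simp only [map_add, LinearMap.add_apply, hs, ht]
  | tmul u v =>
    rw [TensorProduct.comm_tmul, biAct_tmul, pairing_inner, h]
    rfl

theorem outer_ext {f g : E1 k Q →ₗ[k] B k Q ⊗[k] B k Q}
    (hf : ∀ (b c : B k Q) x, f (b • MulOpposite.op c • x) = outerAct k b c (f x))
    (hg : ∀ (b c : B k Q) x, g (b • MulOpposite.op c • x) = outerAct k b c (g x))
    (h : ∀ c, f (oddGen k Q c) = g (oddGen k Q c)) : f = g := by
  have key : ∀ c t, f (biAct k Q (oddGen k Q c) t) = g (biAct k Q (oddGen k Q c) t) := by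
    intro c t
    induction t using TensorProduct.induction_on with
    | zero => simp
    | add s t hs ht => simp only [map_add, hs, ht]
    | tmul u v => rw [biAct_tmul, hf, hg, h]
  ext x
  rw [← sum_biAct_oddGen x, map_sum, map_sum]
  exact Finset.sum_congr rfl fun c _ => key c _

/-- The generators â, â* form a dual basis up to the exchange of â and â*, so the preimage of f has
the values of f on the exchanged generators as coefficients. Uniqueness is the expansion
`sum_biAct_oddGen`. -/
theorem pairing_nondegenerate (f : E1 k Q →ₗ[k] B k Q ⊗[k] B k Q)
    (hf : ∀ (b c : B k Q) x, f (b • MulOpposite.op c • x) = outerAct k b c (f x)) :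
    ∃! x, pairing k Q x = f := by
  refine ⟨∑ c, biAct k Q (oddGen k Q c) (TensorProduct.comm k _ _ (f (oddGen k Q (Sum.swap c)))),
    ?_, ?_⟩
  · refine outer_ext (fun b c x => pairing_outer b c _ x) hf fun d => ?_
    rw [map_sum, LinearMap.sum_apply, Finset.sum_eq_single (Sum.swap d)]
    · rw [pairing_biAct _ _ _ _ _ ((pairing_oddGen _ _).trans (if_pos rfl)), Sum.swap_swap, ← hf,
        head_smul_oddGen]
    · intro c _ hc
      -- `pairing_biAct` expects a pure tensor, so the vanishing pairing is presented as `0 ⊗ 0`.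
      rw [pairing_biAct _ _ 0 0 _ (((pairing_oddGen _ _).trans (if_neg hc)).trans
        (TensorProduct.zero_tmul _ _).symm)]
      simp [outerAct]
    · simp
  · rintro x rfl
    exact (sum_biAct_oddGen x).symm

/-! ### Finite generation and projectivity -/

section

variable (k Q)

/-- The bimodule `A¹` as a module over the enveloping algebra of `B`. -/
abbrev envelopingModule : Module (B k Q ⊗[k] (B k Q)ᵐᵒᵖ) (E1 k Q) :=
  TensorProduct.Algebra.module

attribute [local instance] envelopingModule

/-- The coordinates of an element of `A¹` in the generators. -/
def oddCoord : E1 k Q →ₗ[B k Q ⊗[k] (B k Q)ᵐᵒᵖ] E ⊕ E → B k Q ⊗[k] (B k Q)ᵐᵒᵖ where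
  toFun x c := (MulOpposite.opLinearEquiv k : B k Q ≃ₗ[k] (B k Q)ᵐᵒᵖ).toLinearMap.lTensor _
    (TensorProduct.comm k _ _ (pairing k Q x (oddGen k Q (Sum.swap c))))
  map_add' x y := by
    ext c
    simp
  map_smul' r x := by
    ext c
    induction r using TensorProduct.induction_on with
    | zero =>
      rw [zero_smul (B k Q ⊗[k] (B k Q)ᵐᵒᵖ) x]
      simp
    | add s t hs ht =>
      simp only [RingHom.id_apply, Pi.smul_apply, smul_eq_mul] at hs ht ⊢
      rw [add_smul, map_add, LinearMap.add_apply, map_add, map_add, hs, ht, add_mul]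
    | tmul b c' =>
      rw [TensorProduct.Algebra.smul_def, ← MulOpposite.op_unop c', pairing_inner]
      simp only [RingHom.id_apply, Pi.smul_apply, smul_eq_mul]
      generalize pairing k Q x _ = t
      induction t using TensorProduct.induction_on with
      | zero => simp
      | add s t hs ht => simp only [map_add, mul_add, hs, ht]
      | tmul u v => simp [innerAct]

variable {k Q}

theorem lTensor_op_smul (m : E1 k Q) (t : B k Q ⊗[k] B k Q) :
    (MulOpposite.opLinearEquiv k : B k Q ≃ₗ[k] (B k Q)ᵐᵒᵖ).toLinearMap.lTensor _ t • m =
      biAct k Q m t := by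
  induction t using TensorProduct.induction_on with
  | zero =>
    rw [map_zero, map_zero]
    exact zero_smul (B k Q ⊗[k] (B k Q)ᵐᵒᵖ) m
  | add s t hs ht => simp only [map_add, add_smul, hs, ht]
  | tmul u v => exact TensorProduct.Algebra.smul_def _ _ _

/-- The expansion in the generators, read over the enveloping algebra: the coordinates split the map
from a finite free module onto A¹, which gives finite generation and projectivity together. -/
theorem linearCombination_oddCoord (x : E1 k Q) :
    Fintype.linearCombination (B k Q ⊗[k] (B k Q)ᵐᵒᵖ) (oddGen k Q) (oddCoord k Q x) = x := by
  rw [Fintype.linearCombination_apply]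
  conv_rhs => rw [← sum_biAct_oddGen x]
  exact Finset.sum_congr rfl fun c _ => lTensor_op_smul _ _

theorem finite_E1 : Module.Finite (B k Q ⊗[k] (B k Q)ᵐᵒᵖ) (E1 k Q) :=
  Module.Finite.of_surjective (Fintype.linearCombination _ (oddGen k Q)) fun x =>
    ⟨_, linearCombination_oddCoord x⟩

theorem projective_E1 : Module.Projective (B k Q ⊗[k] (B k Q)ᵐᵒᵖ) (E1 k Q) :=
  Module.Projective.of_split (oddCoord k Q) (Fintype.linearCombination _ (oddGen k Q))
    (LinearMap.ext linearCombination_oddCoord)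

end

/-! ### The double Courant algebroid -/

/-- The double Courant algebroid of a Hamiltonian `S` with `{S, {S, -}} = 0`. -/
def derivedCourantAlgebroid {S : A k Q} (hS : S ∈ gradeA k Q 3)
    (hX : ∀ z, (bracket k Q).assoc S ((bracket k Q).assoc S z) = 0) :
    DoubleCourantAlgebroid k (baseB k Q) (E1 k Q) where
  finite := finite_E1
  projective := projective_E1
  pairing := pairing k Q
  pairing_outer := pairing_outer
  pairing_inner := pairing_inner
  pairing_symm := pairing_symm
  pairing_nondegenerate := pairing_nondegenerate
  anchor := anchor S
  anchor_leibniz := anchor_leibniz hS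
  anchor_base := anchor_base hS
  anchor_inner := anchor_inner hS
  coanchor := coanchor S
  pairing_coanchor := pairing_coanchor hS
  brL := dorfmanL S
  brR := dorfmanR S
  brL_outer := dorfmanL_outer hS
  brR_outer := dorfmanR_outer hS
  brL_inner := dorfmanL_inner hS
  brR_inner := dorfmanR_inner hS
  brL_smul := dorfmanL_smul hS
  brR_smul := dorfmanR_smul hS
  brL_op_smul := dorfmanL_op_smul hS
  brR_op_smul := dorfmanR_op_smul hS
  coanchor_pairing_left := coanchor_pairing_left hS
  coanchor_pairing_right := coanchor_pairing_right hS
  anchor_pairing e₁ e₂ := anchor_pairing e₁ e₂ hS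
  jacobi_left e₁ e₂ e₃ := dorfman_jacobi_left e₁ e₂ e₃ hS hX
  jacobi_mid e₁ e₂ e₃ := dorfman_jacobi_mid e₁ e₂ e₃ hS hX
  jacobi_right e₁ e₂ e₃ := dorfman_jacobi_right e₁ e₂ e₃ hS hX

theorem isDerivedFrom_derivedCourantAlgebroid {S : A k Q} (hS : S ∈ gradeA k Q 3)
    (hX : ∀ z, (bracket k Q).assoc S ((bracket k Q).assoc S z) = 0) :
    Q.IsDerivedFrom k (derivedCourantAlgebroid hS hX) S := by
  refine ⟨fun x y => ?_, fun x b => ?_, fun x y => ?_⟩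
  · rw [dbr_eq]
    exact map_pairing x y
  · rw [dbr_eq, br_eq]
    exact map_anchor hS x b
  · rw [dbr_eq, br_eq]
    exact map_dorfman hS x y

end PlainQuiver

/-! ### The theorem. -/

theorem mainTheorem10 {k : Type*} [Field k] [CharZero k] {V E : Type*} [Fintype V] [Fintype E]
    (Q : PlainQuiver V E) (φ : Forms (Q.baseB k))
    (hφ : φ ∈ Forms.grade (Q.gradeB k) (Q.baseB k) (0, 3)) :
    (∀ (w : ℕ), ∀ x ∈ Q.gradeA k w,
      ∃! Θ : DoubleDer (Q.gradeA k) (Q.baseA k) ((w : ℤ) - 2), IsHamiltonian (Q.omega k) x Θ) ∧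
    Q.deformedHamiltonian k φ ∈ Q.gradeA k 3 ∧
    (DR.mk (Q.gradeA k) (Q.baseA k) (Forms.of (Q.baseA k)
        (Q.br k (Q.deformedHamiltonian k φ) (Q.deformedHamiltonian k φ))) = 0 ↔
      DR.d (Q.gradeB k) (Q.baseB k) (DR.mk (Q.gradeB k) (Q.baseB k) φ) = 0) ∧
    (DR.d (Q.gradeB k) (Q.baseB k) (DR.mk (Q.gradeB k) (Q.baseB k) φ) = 0 ↔
      DR.d (Q.gradeA k) (Q.baseA k)
        (DR.mk (Q.gradeA k) (Q.baseA k) (Q.inclForms k φ)) = 0) ∧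
    (DR.d (Q.gradeB k) (Q.baseB k) (DR.mk (Q.gradeB k) (Q.baseB k) φ) = 0 →
      ∃ D : DoubleCourantAlgebroid k (Q.baseB k) (PlainQuiver.E1 k Q),
        Q.IsDerivedFrom k D (Q.deformedHamiltonian k φ)) := by
  -- Partial derivatives compare arrows, hence need decidable equality.
  classical
  have hS := PlainQuiver.deformedHamiltonian_mem hφ
  refine ⟨fun w x hx => ?_, hS, ?_, PlainQuiver.d_mk_eq_zero_iff_incl k Q φ, fun h => ?_⟩
  · exact ⟨_, (GradedQuiver.isHamiltonian_canonicalForm_iff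
      (PlainQuiver.hatted_weight_le Q) hx _).mpr rfl, fun Θ hΘ =>
      (GradedQuiver.isHamiltonian_canonicalForm_iff (PlainQuiver.hatted_weight_le Q) hx Θ).mp hΘ⟩
  · rw [GradedQuiver.mk_of_eq_zero_iff, PlainQuiver.br_eq]
    exact PlainQuiver.assoc_deformed_mem_iff hφ
  · refine ⟨_, PlainQuiver.isDerivedFrom_derivedCourantAlgebroid hS fun z => ?_⟩
    -- As dφ = 0 in DR, {S, S} is a sum of commutators and {{S, S}, z} = 0; so 2{S, {S, z}} = 0, and
    -- 2 is invertible.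
    have h2 := GradedDoubleBracket.IsPoisson.two_assoc_assoc (PlainQuiver.isPoisson k Q)
      (N := 3) ⟨1, rfl⟩ hS z
    rw [GradedDoubleBracket.assoc_of_mem_gradedCommutators _
      ((PlainQuiver.assoc_deformed_mem_iff hφ).mpr h)] at h2
    exact (smul_eq_zero.mp h2).resolve_left two_ne_zero
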